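/- Fix $\beta>0$, let $M_\beta(x)=\frac{x-i\beta}{x+i\beta}$ and $T(\theta)=M_\beta^{-1}(e^{i\theta})$ for $\theta\in(0,2\pi)$, so that $T$ maps $(0,2\pi)$ onto $\mathbb R$. For a continuous $f:\mathbb R\to\mathbb C$ with $f(x)\to0$ as $|x|\to\infty$ let $F=f\circ T$ on $(0,2\pi)$, extended continuously and $2\pi$-periodically by $F(0)=0$. For real $s$ write $\hat F_k=\frac1{2\pi}\int_0^{2\pi}e^{-ik\theta}F(\theta)\,d\theta$ and $$\|F\|_{H^s(\mathbb T)}=\Big(\sum_{k\in\mathbb Z}(1+|k|)^{2s}|\hat F_k|^2\Big)^{1/2},$$ and let $H^s(\mathbb T)$ be the set of $F\in L^2(\mathbb T)$ for which this is finite. For an integer $n\ge1$ put $n_+=\lfloor n/2\rfloor$, $n_-=\lfloor (n-1)/2\rfloor$, $\theta_\ell=2\pi\ell/n$, $$\tilde F_k=\frac1n\sum_{\ell=0}^{n-1}e^{-ik\theta_\ell}F(\theta_\ell),\qquad \mathcal R_nf(x)=\sum_{k=-n_-}^{n_+}\tilde F_k\,M_\beta(x)^k ,$$ so that $\mathcal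 R_nf\circ T$ is the trigonometric interpolant of $F$ at the points $\theta_\ell$. Let $\mathcal Fh(k)=\int_{\mathbb R}e^{-ikx}h(x)\,dx$, understood as the Plancherel transform for $h\in L^2(\mathbb R)$ in (1), and for each individual $k$ as the principal value $\lim_{R\to\infty}\int_{-R}^Re^{-ikx}h(x)\,dx$ in (2) and (3). Suppose $F\in H^s(\mathbb T)$. All constants below may depend on $\beta$ and on the displayed subscripts, but not on $f$, $n$ or $k$. 1. If $\epsilon>0$, $s>1+\epsilon$ and $t\le s$ ($t$ real), then $f,\mathcal R_nf\in L^2(\mathbb R)$ and, for all $n\ge1$, $$\big\|(1+|\cdot|)^t\,\mathcal F(\mathcal R_nf-f)\big\|_{L^2(\mathbb R)}\le\big[C_{\epsilon,s}\,n^{1+\epsilon-s}+C_{s,t}\,n^{t-s}\big]\,\|F\|_{H^s(\mathbb T)} .$$ 2. If $\epsilon>0$ and $s>3/2+\epsilon$, then for all $n\ge1$ and all $k\in\mathbb R$ the principal values $\mathcal F\mathcal R_nf(k)$ and $\mathcal Ff(k)$ exist and $$|\mathcal F\mathcal R_nf(k)-\mathcal Ff(k)|\le C_{\epsilon,s}\,n^{3/2+\epsilon-s}\,\|F\|_{H^s(\mathbb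 T)} .$$ 3. If $j$ is an integer with $0<j\le s$, then for all $n\ge1$ and all real $k\ne0$ the principal values $\mathcal F\mathcal R_nf(k)$ and $\mathcal Ff(k)$ exist and $$|\mathcal F\mathcal R_nf(k)-\mathcal Ff(k)|\le C_{j,s}\,|k|^{-j}\,n^{j-s}\,\|F\|_{H^s(\mathbb T)} .$$ -/

import Mathlib

open MeasureTheory Filter Topology
open scoped FourierTransform

noncomputable section

namespace RationalFourier

/-! ### Periodic Sobolev spaces

A function on the periodic interval `[0, 2π)` is represented by a function `F : ℝ → ℂ`. -/

/-- The Fourier coefficient `(1 / 2π) ∫_0^{2π} e^{-ikθ} F(θ) dθ`. -/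
def fourierCoef (F : ℝ → ℂ) (k : ℤ) : ℂ :=
  (1 / (2 * (Real.pi : ℂ))) *
    ∫ θ in (0 : ℝ)..(2 * Real.pi), Complex.exp (-(Complex.I * k * θ)) * F θ

/-- The general term `(1 + |k|)^{2s} |F̂_k|²` of the squared periodic Sobolev norm. -/
def sobolevTerm (s : ℝ) (F : ℝ → ℂ) (k : ℤ) : ℝ :=
  (1 + |(k : ℝ)|) ^ (2 * s) * ‖fourierCoef F k‖ ^ 2

/-- `F ∈ H^s(𝕋)`: `F` is square integrable over a period and `∑ (1 + |k|)^{2s} |F̂_k|² < ∞`. -/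
def MemSobolevT (s : ℝ) (F : ℝ → ℂ) : Prop :=
  MemLp F 2 (volume.restrict (Set.Ico 0 (2 * Real.pi))) ∧ Summable (sobolevTerm s F)

/-- The norm of `H^s(𝕋)`. -/
def sobolevNormT (s : ℝ) (F : ℝ → ℂ) : ℝ :=
  Real.sqrt (∑' k : ℤ, sobolevTerm s F k)

/-! ### Trigonometric interpolation -/

/-- The discrete Fourier coefficient `(1/n) ∑_{ℓ < n} e^{-ikθ_ℓ} F(θ_ℓ)`, `θ_ℓ = 2πℓ/n`. -/
def discreteCoef (n : ℕ) (F : ℝ → ℂ) (k : ℤ) : ℂ :=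
  (1 / (n : ℂ)) * ∑ l ∈ Finset.range n,
    Complex.exp (-(Complex.I * k * ((2 * Real.pi * l / n : ℝ) : ℂ))) * F (2 * Real.pi * l / n)

/-- The indices `-n₋ ≤ k ≤ n₊` with `n₊ = ⌊n/2⌋` and `n₋ = ⌊(n-1)/2⌋` (`n ≥ 1`). -/
def modes (n : ℕ) : Finset ℤ :=
  Finset.Icc (-(((n - 1) / 2 : ℕ) : ℤ)) ((n / 2 : ℕ) : ℤ)

/-- The trigonometric interpolant `ℐ_n F`. -/
def trigInterp (n : ℕ) (F : ℝ → ℂ) (θ : ℝ) : ℂ :=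
  ∑ k ∈ modes n, discreteCoef n F k * Complex.exp (Complex.I * k * θ)

/-! ### The Möbius change of variables and rational interpolation -/

/-- `M_β(z) = (z - iβ) / (z + iβ)`. -/
def mobius (β : ℝ) (z : ℂ) : ℂ := (z - Complex.I * β) / (z + Complex.I * β)

/-- `M_β⁻¹(z) = (β / i) (z + 1) / (z - 1)`. -/
def mobiusInv (β : ℝ) (z : ℂ) : ℂ := (β / Complex.I) * ((z + 1) / (z - 1))

/-- `T(θ) = M_β⁻¹(e^{iθ})`, which is real for `θ ∉ 2πℤ` (see `changeVar_eq`). -/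
def changeVar (β θ : ℝ) : ℝ := (mobiusInv β (Complex.exp (Complex.I * θ))).re

open Classical in
/-- `F = f ∘ T`. The points `θ ∈ 2πℤ` correspond to `x = ±∞`; there `F` takes the value `0`, which
is its limit when `f` vanishes at infinity. -/
def pullback (β : ℝ) (f : ℝ → ℂ) (θ : ℝ) : ℂ :=
  if Complex.exp (Complex.I * θ) = 1 then 0 else f (changeVar β θ)

/-- The rational interpolant `ℛ_n f(x) = ∑_{k=-n₋}^{n₊} F̃_k M_β(x)^k`, that is
`ℛ_n f = (ℐ_n F) ∘ T⁻¹` (see `rationalInterp_changeVar`). -/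
def rationalInterp (β : ℝ) (n : ℕ) (f : ℝ → ℂ) (x : ℝ) : ℂ :=
  ∑ k ∈ modes n, discreteCoef n (pullback β f) k * mobius β x ^ k

theorem changeVar_eq (β θ : ℝ) :
    (changeVar β θ : ℂ) = mobiusInv β (Complex.exp (Complex.I * θ)) := by
  have hconj : (starRingEnd ℂ) (Complex.exp (Complex.I * θ))
      = (Complex.exp (Complex.I * θ))⁻¹ := by
    rw [← Complex.exp_conj, ← Complex.exp_neg]
    simp
  rw [changeVar, ← Complex.conj_eq_iff_re, mobiusInv]
  simp only [map_mul, map_div₀, map_add, map_sub, map_one, Complex.conj_ofReal, Complex.conj_I,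
    hconj]
  have h0 : Complex.exp (Complex.I * θ) ≠ 0 := Complex.exp_ne_zero _
  by_cases h1 : Complex.exp (Complex.I * θ) = 1
  · simp [h1]
  · have h2 : Complex.exp (Complex.I * θ) - 1 ≠ 0 := sub_ne_zero.mpr h1
    have h3 : 1 - Complex.exp (Complex.I * θ) ≠ 0 := sub_ne_zero.mpr (Ne.symm h1)
    have hI := Complex.I_ne_zero
    have h4 : (Complex.exp (Complex.I * θ))⁻¹ - 1
        = (1 - Complex.exp (Complex.I * θ)) / Complex.exp (Complex.I * θ) := by
      field_simp
    rw [h4]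
    field_simp
    ring

theorem mobius_changeVar {β : ℝ} (hβ : 0 < β) {θ : ℝ} (h : Complex.exp (Complex.I * θ) ≠ 1) :
    mobius β (changeVar β θ) = Complex.exp (Complex.I * θ) := by
  have hβ' : (β : ℂ) ≠ 0 := by exact_mod_cast hβ.ne'
  have h2 : Complex.exp (Complex.I * θ) - 1 ≠ 0 := sub_ne_zero.mpr h
  have hI := Complex.I_ne_zero
  rw [changeVar_eq, mobius, mobiusInv]
  set z := Complex.exp (Complex.I * θ)
  have e1 : (β / Complex.I) * ((z + 1) / (z - 1)) - Complex.I * β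
      = (β / Complex.I) * (2 * z / (z - 1)) := by
    field_simp
    rw [Complex.I_sq]
    ring
  have e2 : (β / Complex.I) * ((z + 1) / (z - 1)) + Complex.I * β
      = (β / Complex.I) * (2 / (z - 1)) := by
    field_simp
    rw [Complex.I_sq]
    ring
  rw [e1, e2]
  field_simp

theorem rationalInterp_changeVar {β : ℝ} (hβ : 0 < β) (n : ℕ) (f : ℝ → ℂ) {θ : ℝ}
    (h : Complex.exp (Complex.I * θ) ≠ 1) :
    rationalInterp β n f (changeVar β θ) = trigInterp n (pullback β f) θ := by
  simp only [rationalInterp, trigInterp, mobius_changeVar hβ h, ← Complex.exp_int_mul]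
  refine Finset.sum_congr rfl fun k _ => ?_
  congr 2
  ring

/-! ### Fourier transforms on the line, `ℱ h(k) = ∫ e^{-ikx} h(x) dx` -/

open Classical in
/-- The Fourier transform of `h ∈ L²(ℝ)`. Mathlib's transform has the kernel `e^{-2πiξx}`,
whence the rescaling of the argument. -/
def l2Fourier (h : ℝ → ℂ) (k : ℝ) : ℂ :=
  if hh : MemLp h 2 (volume : Measure ℝ) then
    (𝓕 (hh.toLp h) : Lp ℂ 2 (volume : Measure ℝ)) (k / (2 * Real.pi))
  else 0

/-- The norm of `H^t(ℝ)`, i.e. `‖(1 + |k|)^t ℱ h(k)‖_{L²(ℝ, dk)}`, for `h ∈ L²(ℝ)`. -/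
def sobolevNormR (t : ℝ) (h : ℝ → ℂ) : ENNReal :=
  eLpNorm (fun k : ℝ => (((1 + |k|) ^ t : ℝ) : ℂ) * l2Fourier h k) 2 volume

/-- The principal value integral `lim_{R → ∞} ∫_{-R}^R e^{-ikx} h(x) dx` exists and equals `a`. -/
def HasPVFourier (h : ℝ → ℂ) (k : ℝ) (a : ℂ) : Prop :=
  Tendsto (fun R : ℝ => ∫ x in (-R)..R, Complex.exp (-(Complex.I * k * x)) * h x) atTop (𝓝 a)

end RationalFourier

end

namespace RationalFourier

open scoped ENNReal

/-! ### Weighted sequence norms -/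

/-! Write c for the Fourier coefficients of F = f ∘ T. Since F(0) = 0, the c_k sum to zero, so f = ∑
c_k (M^k - 1). The interpolant also vanishes at the node θ = 0, hence R_n f - f = ∑ g_k (M^k - 1),
where g is the difference of the interpolation and Fourier coefficients (`interpolation_setup`). The
theorem thus splits into a bound on g and bounds for the Fourier transform of `mobiusSeries β g` by
weighted norms of g.

The bound on g is aliasing: the k-th discrete coefficient is the sum of c_j over j ≡ k mod n.
Cauchy–Schwarz over the aliases gives ‖g‖_σ ≲ n^(σ-s) ‖c‖_s for 0 ≤ σ ≤ s and s > 1/2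
(`exists_weightedSq_interpCoef_sub_le`). Each claim is this bound at one or two values of σ.

Two facts about M drive the transform bounds. With w = 2β/(x²+β²), the powers M^k are orthogonal in
L²(w dx), and 2βw = |1-M|² = 2 - M - M⁻¹. Consequently ‖M^k - 1‖² = 4πβ|k| in L²(ℝ), and
differentiation maps finite series in M^k - 1 to finite series of the same kind, through a
three-term operator on coefficients that costs one order of weight (`derivCoef`).

For (1), the L² norm is controlled by ∑ |k|^(1/2)|g_k|, hence by σ = 1 + ε. Iterated derivatives
control integer orders at high frequency, and a dyadic splitting of the coefficients reaches every
real t > 1, with σ = t (`exists_setLIntegral_one_le_abs_le`).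

For (2), M^k - 1 = k(M - 1) + remainder. The truncated Fourier integrals of M - 1 are bounded
uniformly in frequency and cutoff; the remainder is O(|k|^(1+δ)) in L¹. So the transform is at most
a constant times ∑ (1+|k|)^(1+δ)|g_k|, which needs σ = 3/2 + ε
(`exists_hasPVFourier_le_weightedSq`).

For (3), each integration by parts gains 1/|ξ| and costs one order of weight. The last one uses the
L¹ norm of the derivative, which order 1 controls without loss, so σ = j
(`exists_hasPVFourier_sq_le`).

Bounds obtained from the derivative are proved for finitely supported coefficients and extended by
truncation. -/

/-- The squared weighted norm `∑ (1 + |k|)^{2s} |c_k|²`. -/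
noncomputable def weightedSq (s : ℝ) (c : ℤ → ℂ) : ℝ≥0∞ :=
  ∑' k : ℤ, ENNReal.ofReal ((1 + |(k : ℝ)|) ^ (2 * s)) * ‖c k‖ₑ ^ 2

/-- The absolute moment `∑ (1 + |k|)^p |c_k|`. -/
noncomputable def absMoment (p : ℝ) (c : ℤ → ℂ) : ℝ≥0∞ :=
  ∑' k : ℤ, ENNReal.ofReal ((1 + |(k : ℝ)|) ^ p) * ‖c k‖ₑ

/-- The lattice zeta sum `∑ (1 + |k|)^{-r}`. -/
noncomputable def latticeZeta (r : ℝ) : ℝ≥0∞ :=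
  ∑' k : ℤ, ENNReal.ofReal ((1 + |(k : ℝ)|) ^ (-r))

theorem one_le_one_add_abs (k : ℤ) : (1 : ℝ) ≤ 1 + |(k : ℝ)| := by
  have := abs_nonneg (k : ℝ)
  linarith

theorem one_add_abs_pos (k : ℤ) : (0 : ℝ) < 1 + |(k : ℝ)| :=
  lt_of_lt_of_le one_pos (one_le_one_add_abs k)

theorem latticeZeta_ne_top {r : ℝ} (hr : 1 < r) : latticeZeta r ≠ ⊤ := by
  have hnat : Summable fun n : ℕ => (1 + (n : ℝ)) ^ (-r) := by
    have h := (summable_nat_add_iff 1).2 (Real.summable_nat_rpow.2 (by linarith : -r < -1))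
    refine h.congr fun n => ?_
    push_cast
    rw [add_comm]
  have hsum : Summable fun k : ℤ => (1 + |(k : ℝ)|) ^ (-r) := by
    refine Summable.of_nat_of_neg ?_ ?_
    · refine hnat.congr fun n => ?_
      simp
    · refine hnat.congr fun n => ?_
      simp
  rw [latticeZeta, ← ENNReal.ofReal_tsum_of_nonneg
    (fun k => Real.rpow_nonneg (one_add_abs_pos k).le _) hsum]
  exact ENNReal.ofReal_ne_top

theorem lintegral_mul_sq_le {α : Type*} [MeasurableSpace α] (μ : Measure α) {f g : α → ℝ≥0∞}
    (hf : AEMeasurable f μ) (hg : AEMeasurable g μ) :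
    (∫⁻ a, f a * g a ∂μ) ^ 2 ≤ (∫⁻ a, f a ^ 2 ∂μ) * ∫⁻ a, g a ^ 2 ∂μ := by
  have h := ENNReal.lintegral_mul_le_Lp_mul_Lq μ Real.HolderConjugate.two_two hf hg
  simp only [Pi.mul_apply, ENNReal.rpow_two] at h
  calc (∫⁻ a, f a * g a ∂μ) ^ 2
      ≤ ((∫⁻ a, f a ^ 2 ∂μ) ^ ((1 : ℝ) / 2) * (∫⁻ a, g a ^ 2 ∂μ) ^ ((1 : ℝ) / 2)) ^ 2 := by
        gcongr
    _ = _ := by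
        rw [mul_pow, ← ENNReal.rpow_mul_natCast, ← ENNReal.rpow_mul_natCast]
        norm_num

theorem tsum_mul_sq_le {ι : Type*} (f g : ι → ℝ≥0∞) :
    (∑' i, f i * g i) ^ 2 ≤ (∑' i, f i ^ 2) * ∑' i, g i ^ 2 := by
  let _ : MeasurableSpace ι := ⊤
  have h := lintegral_mul_sq_le (Measure.count : Measure ι)
    (measurable_from_top (f := f)).aemeasurable (measurable_from_top (f := g)).aemeasurable
  simpa only [lintegral_count' (measurable_from_top)] using h

theorem ofReal_rpow_sq {a : ℝ} (ha : 0 ≤ a) (p : ℝ) :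
    ENNReal.ofReal (a ^ p) ^ 2 = ENNReal.ofReal (a ^ (2 * p)) := by
  rw [← ENNReal.ofReal_pow (Real.rpow_nonneg ha _), ← Real.rpow_mul_natCast ha]
  norm_num [mul_comm]

theorem ofReal_rpow_add {a : ℝ} (ha : 0 < a) (p q : ℝ) :
    ENNReal.ofReal (a ^ (p + q)) = ENNReal.ofReal (a ^ p) * ENNReal.ofReal (a ^ q) := by
  rw [Real.rpow_add ha, ENNReal.ofReal_mul (Real.rpow_nonneg ha.le _)]

/-- Cauchy–Schwarz after splitting the weight as (p - σ) + σ. The zeta factor is finite only for σ >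
p + 1/2; this is the source of the ε in the theorem, with p = 1/2 giving σ > 1 and p slightly above
1 giving σ > 3/2. -/
theorem absMoment_sq_le (p σ : ℝ) (c : ℤ → ℂ) :
    absMoment p c ^ 2 ≤ latticeZeta (2 * (σ - p)) * weightedSq σ c := by
  have h := tsum_mul_sq_le (fun k : ℤ => ENNReal.ofReal ((1 + |(k : ℝ)|) ^ (p - σ)))
    (fun k : ℤ => ENNReal.ofReal ((1 + |(k : ℝ)|) ^ σ) * ‖c k‖ₑ)
  refine le_trans (le_of_eq ?_) (h.trans (le_of_eq ?_))
  · rw [absMoment]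
    congr 1
    refine tsum_congr fun k => ?_
    rw [← mul_assoc, ← ofReal_rpow_add (one_add_abs_pos k)]
    simp
  · rw [latticeZeta, weightedSq]
    congr 1
    · refine tsum_congr fun k => ?_
      rw [ofReal_rpow_sq (one_add_abs_pos k).le]
      congr 2
      ring
    · refine tsum_congr fun k => ?_
      rw [mul_pow, ofReal_rpow_sq (one_add_abs_pos k).le]

theorem absMoment_ne_top {p σ : ℝ} (h : 1 < 2 * (σ - p)) {c : ℤ → ℂ} (hc : weightedSq σ c ≠ ⊤) :
    absMoment p c ≠ ⊤ := by
  intro htop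
  have := absMoment_sq_le p σ c
  rw [htop] at this
  simp only [ne_eq, OfNat.ofNat_ne_zero, not_false_eq_true, ENNReal.top_pow, top_le_iff] at this
  exact ENNReal.mul_ne_top (latticeZeta_ne_top h) hc this

theorem ofReal_rpow_mono {p q : ℝ} (h : p ≤ q) (k : ℤ) :
    ENNReal.ofReal ((1 + |(k : ℝ)|) ^ p) ≤ ENNReal.ofReal ((1 + |(k : ℝ)|) ^ q) :=
  ENNReal.ofReal_le_ofReal (Real.rpow_le_rpow_of_exponent_le (one_le_one_add_abs k) h)

theorem weightedSq_mono_exponent {s t : ℝ} (h : s ≤ t) (c : ℤ → ℂ) :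
    weightedSq s c ≤ weightedSq t c :=
  ENNReal.tsum_le_tsum fun k => by
    gcongr ?_ * _
    exact ofReal_rpow_mono (by linarith) k

theorem weightedSq_mono {s : ℝ} {c d : ℤ → ℂ} (h : ∀ k, ‖c k‖ₑ ≤ ‖d k‖ₑ) :
    weightedSq s c ≤ weightedSq s d :=
  ENNReal.tsum_le_tsum fun k => by
    gcongr
    exact h k

theorem absMoment_mono {s : ℝ} {c d : ℤ → ℂ} (h : ∀ k, ‖c k‖ₑ ≤ ‖d k‖ₑ) :
    absMoment s c ≤ absMoment s d :=
  ENNReal.tsum_le_tsum fun k => by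
    gcongr
    exact h k

theorem enorm_add_sq_le {E : Type*} [SeminormedAddCommGroup E] (a b : E) :
    ‖a + b‖ₑ ^ 2 ≤ 2 * (‖a‖ₑ ^ 2 + ‖b‖ₑ ^ 2) := by
  rw [← ofReal_norm, ← ofReal_norm, ← ofReal_norm, ← ENNReal.ofReal_pow (norm_nonneg _),
    ← ENNReal.ofReal_pow (norm_nonneg _), ← ENNReal.ofReal_pow (norm_nonneg _),
    ← ENNReal.ofReal_add (by positivity) (by positivity),
    ← ENNReal.ofReal_ofNat 2, ← ENNReal.ofReal_mul (by norm_num)]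
  refine ENNReal.ofReal_le_ofReal ?_
  nlinarith [norm_add_le a b, norm_nonneg (a + b), sq_nonneg (‖a‖ - ‖b‖), norm_nonneg a,
    norm_nonneg b]

theorem weightedSq_add_le (s : ℝ) (c d : ℤ → ℂ) :
    weightedSq s (c + d) ≤ 2 * (weightedSq s c + weightedSq s d) := by
  rw [weightedSq, weightedSq, weightedSq, ← ENNReal.tsum_add, ← ENNReal.tsum_mul_left]
  refine ENNReal.tsum_le_tsum fun k => ?_
  rw [← mul_add, mul_left_comm]
  gcongr
  exact enorm_add_sq_le _ _

theorem weightedSq_const_mul (s : ℝ) (a : ℂ) (c : ℤ → ℂ) :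
    weightedSq s (fun k => a * c k) = ‖a‖ₑ ^ 2 * weightedSq s c := by
  rw [weightedSq, weightedSq, ← ENNReal.tsum_mul_left]
  refine tsum_congr fun k => ?_
  rw [enorm_mul]
  ring

/-! ### Truncation to a finite set of modes -/

/-- Restriction of a sequence to a finite set of indices. -/
noncomputable def truncate (S : Finset ℤ) (c : ℤ → ℂ) : ℤ → ℂ := Set.indicator (S : Set ℤ) c

theorem truncate_finite (S : Finset ℤ) (c : ℤ → ℂ) : (truncate S c).support.Finite :=
  S.finite_toSet.subset (Set.support_indicator_subset)

theorem enorm_truncate_le (S : Finset ℤ) (c : ℤ → ℂ) (k : ℤ) : ‖truncate S c k‖ₑ ≤ ‖c k‖ₑ :=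
  enorm_indicator_le_enorm_self _ _

theorem enorm_sub_truncate_le (S : Finset ℤ) (c : ℤ → ℂ) (k : ℤ) :
    ‖(c - truncate S c) k‖ₑ ≤ ‖c k‖ₑ := by
  by_cases h : k ∈ S <;> simp [truncate, h]

/-- Tails of a convergent sum tend to zero. A general summand φ lets one argument serve both the
squared norm and the absolute moment. -/
theorem tendsto_tsum_sub_truncate {φ : ℤ → ℂ → ℝ≥0∞} (h0 : ∀ k, φ k 0 = 0) {c : ℤ → ℂ}
    (hc : ∑' k, φ k (c k) ≠ ⊤) :
    Tendsto (fun S : Finset ℤ => ∑' k, φ k ((c - truncate S c) k)) atTop (𝓝 0) := by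
  refine (ENNReal.tendsto_tsum_compl_atTop_zero hc).congr fun S => ?_
  refine (tsum_subtype {k : ℤ | k ∉ S} (fun k => φ k (c k))).trans (tsum_congr fun k => ?_)
  by_cases h : k ∈ S <;> simp [truncate, h, h0]

theorem tendsto_weightedSq_sub_truncate {s : ℝ} {c : ℤ → ℂ} (hc : weightedSq s c ≠ ⊤) :
    Tendsto (fun S : Finset ℤ => weightedSq s (c - truncate S c)) atTop (𝓝 0) :=
  tendsto_tsum_sub_truncate
    (φ := fun k z => ENNReal.ofReal ((1 + |(k : ℝ)|) ^ (2 * s)) * ‖z‖ₑ ^ 2) (by simp) hc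

theorem tendsto_absMoment_sub_truncate {p : ℝ} {c : ℤ → ℂ} (hc : absMoment p c ≠ ⊤) :
    Tendsto (fun S : Finset ℤ => absMoment p (c - truncate S c)) atTop (𝓝 0) :=
  tendsto_tsum_sub_truncate
    (φ := fun k z => ENNReal.ofReal ((1 + |(k : ℝ)|) ^ p) * ‖z‖ₑ) (by simp) hc

theorem summable_norm_of_absMoment {p : ℝ} (hp : 0 ≤ p) {c : ℤ → ℂ} (hc : absMoment p c ≠ ⊤) :
    Summable fun k => ‖c k‖ := by
  have h : ∑' k, ‖c k‖ₑ ≠ ⊤ := by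
    refine ne_top_of_le_ne_top hc (ENNReal.tsum_le_tsum fun k => ?_)
    refine le_mul_of_one_le_left (by simp) ?_
    rw [← ENNReal.ofReal_one]
    exact ENNReal.ofReal_le_ofReal (Real.one_le_rpow (one_le_one_add_abs k) hp)
  simpa using ENNReal.summable_toReal h

/-! ### The Möbius map on the real line -/

/-- The derivative `2β / (x² + β²)` of the argument of `M_β` along the real line. -/
noncomputable def mobiusWeight (β x : ℝ) : ℝ := 2 * β / (x ^ 2 + β ^ 2)

section Mobius

variable {β : ℝ}

theorem add_I_mul_ne_zero (hβ : 0 < β) (x : ℝ) : (x : ℂ) + Complex.I * β ≠ 0 := by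
  intro h
  have := congrArg Complex.im h
  simp at this
  exact hβ.ne' this

theorem sub_I_mul_ne_zero (hβ : 0 < β) (x : ℝ) : (x : ℂ) - Complex.I * β ≠ 0 := by
  intro h
  have := congrArg Complex.im h
  simp at this
  exact hβ.ne' this

theorem sq_add_sq_pos (hβ : 0 < β) (x : ℝ) : 0 < x ^ 2 + β ^ 2 := by positivity

theorem mobiusWeight_pos (hβ : 0 < β) (x : ℝ) : 0 < mobiusWeight β x := by
  unfold mobiusWeight
  positivity

theorem mobiusWeight_continuous (hβ : 0 < β) : Continuous (mobiusWeight β) := by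
  unfold mobiusWeight
  exact continuous_const.div (by fun_prop) fun x => (sq_add_sq_pos hβ x).ne'

theorem mobius_ne_zero (hβ : 0 < β) (x : ℝ) : mobius β x ≠ 0 :=
  div_ne_zero (sub_I_mul_ne_zero hβ x) (add_I_mul_ne_zero hβ x)

theorem conj_mobius (x : ℝ) :
    (starRingEnd ℂ) (mobius β x) = (mobius β x)⁻¹ := by
  simp [mobius, sub_eq_add_neg]

theorem norm_mobius (hβ : 0 < β) (x : ℝ) : ‖mobius β x‖ = 1 := by
  have h1 : ‖(x : ℂ) - Complex.I * β‖ = ‖(x : ℂ) + Complex.I * β‖ := by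
    rw [← Complex.norm_conj]
    simp
  rw [mobius, norm_div, h1, div_self]
  exact norm_ne_zero_iff.2 (add_I_mul_ne_zero hβ x)

theorem norm_mobius_zpow (hβ : 0 < β) (x : ℝ) (k : ℤ) : ‖mobius β x ^ k‖ = 1 := by
  rw [norm_zpow, norm_mobius hβ, one_zpow]

theorem sq_add_sq_eq (x : ℝ) :
    ((x : ℂ) - Complex.I * β) * (x + Complex.I * β) = (x : ℂ) ^ 2 + (β : ℂ) ^ 2 := by
  have := Complex.I_sq
  linear_combination (-(β : ℂ) ^ 2) * this

theorem sq_add_sq_ne_zero (hβ : 0 < β) (x : ℝ) : (x : ℂ) ^ 2 + (β : ℂ) ^ 2 ≠ 0 := by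
  exact_mod_cast (sq_add_sq_pos hβ x).ne'

theorem one_sub_mobius (hβ : 0 < β) (x : ℝ) :
    1 - mobius β x = 2 * Complex.I * β / (x + Complex.I * β) := by
  rw [mobius, eq_div_iff (add_I_mul_ne_zero hβ x), sub_mul,
    div_mul_cancel₀ _ (add_I_mul_ne_zero hβ x)]
  ring

/-- On the unit circle |1 - M|² = 2 - M - M⁻¹. That the weight is a Laurent polynomial in M is what
makes the derivative of a series in M^k again such a series. -/
theorem mobiusWeight_eq (hβ : 0 < β) (x : ℝ) :
    (mobiusWeight β x : ℂ) * (2 * β) = 2 - mobius β x - (mobius β x)⁻¹ := by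
  have h1 := add_I_mul_ne_zero hβ x
  have h2 := sub_I_mul_ne_zero hβ x
  have hab : (2 * (β : ℂ)) * (2 * β) =
      -((x + Complex.I * β) - (x - Complex.I * β)) ^ 2 := by
    have := Complex.I_sq
    linear_combination (4 * (β : ℂ) ^ 2) * this
  rw [mobius, inv_div, mobiusWeight]
  push_cast
  rw [← sq_add_sq_eq, div_mul_eq_mul_div, hab]
  generalize (x : ℂ) + Complex.I * β = a at *
  generalize (x : ℂ) - Complex.I * β = b at *
  field_simp
  ring

theorem norm_one_sub_mobius_sq (hβ : 0 < β) (x : ℝ) :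
    ‖1 - mobius β x‖ ^ 2 = 2 * β * mobiusWeight β x := by
  have h : (‖1 - mobius β x‖ ^ 2 : ℂ) = ((2 * β * mobiusWeight β x : ℝ) : ℂ) := by
    rw [← Complex.mul_conj']
    have h0 := mobius_ne_zero hβ x
    have h1 := mobiusWeight_eq hβ x
    simp only [map_sub, map_one, conj_mobius]
    push_cast
    rw [mul_comm, mul_comm (2 * (β : ℂ)), h1]
    field_simp
    ring
  exact_mod_cast h

theorem hasDerivAt_mobius (hβ : 0 < β) (x : ℝ) :
    HasDerivAt (fun x : ℝ => mobius β x)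
      (Complex.I * mobiusWeight β x * mobius β x) x := by
  have h1 := add_I_mul_ne_zero hβ x
  have h2 := sub_I_mul_ne_zero hβ x
  have h3 := sq_add_sq_ne_zero hβ x
  have hid : HasDerivAt (fun x : ℝ => (x : ℂ)) 1 x := Complex.ofRealCLM.hasDerivAt
  have h := (hid.sub_const (Complex.I * β)).div (hid.add_const (Complex.I * β)) h1
  refine h.congr_deriv ?_
  rw [mobius, mobiusWeight]
  push_cast
  rw [← sq_add_sq_eq]
  field_simp
  ring

theorem hasDerivAt_mobius_zpow (hβ : 0 < β) (k : ℤ) (x : ℝ) :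
    HasDerivAt (fun x : ℝ => mobius β x ^ k)
      (Complex.I * k * mobiusWeight β x * mobius β x ^ k) x := by
  have h0 := mobius_ne_zero hβ x
  have h := (hasDerivAt_zpow k (mobius β x) (Or.inl h0)).comp x (hasDerivAt_mobius hβ x)
  refine h.congr_deriv ?_
  rw [zpow_sub_one₀ h0]
  field_simp

theorem mobius_zpow_continuous (hβ : 0 < β) (k : ℤ) :
    Continuous fun x : ℝ => mobius β x ^ k :=
  continuous_iff_continuousAt.2 fun x => (hasDerivAt_mobius_zpow hβ k x).continuousAt

theorem tendsto_mobius_zpow (hβ : 0 < β) (k : ℤ) :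
    Tendsto (fun x : ℝ => mobius β x ^ k) (cocompact ℝ) (𝓝 1) := by
  have h1 : Tendsto (fun x : ℝ => mobius β x) (cocompact ℝ) (𝓝 1) := by
    have hn : Tendsto (fun x : ℝ => ‖(x : ℂ) + Complex.I * β‖) (cocompact ℝ) atTop := by
      refine tendsto_atTop_mono (fun x => ?_) (tendsto_norm_cocompact_atTop (E := ℝ))
      have := Complex.abs_re_le_norm ((x : ℂ) + Complex.I * β)
      simpa using this
    have h2 : Tendsto (fun x : ℝ => 2 * Complex.I * β / ((x : ℂ) + Complex.I * β))
        (cocompact ℝ) (𝓝 0) := by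
      simp only [div_eq_mul_inv]
      rw [← mul_zero (2 * Complex.I * (β : ℂ))]
      exact (tendsto_inv₀_cobounded.comp (tendsto_norm_atTop_iff_cobounded.1 hn)).const_mul _
    have h3 := (tendsto_const_nhds (x := (1 : ℂ))).sub h2
    rw [sub_zero] at h3
    refine h3.congr fun x => ?_
    rw [← one_sub_mobius hβ]
    ring
  have := h1.zpow₀ k (Or.inl one_ne_zero)
  simpa using this

theorem integrable_mobiusWeight (hβ : 0 < β) : Integrable (mobiusWeight β) := by
  have h := (integrable_inv_one_add_sq.comp_div hβ.ne').const_mul (2 / β)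
  refine h.congr (Eventually.of_forall fun x => ?_)
  simp only [mobiusWeight]
  have := sq_add_sq_pos hβ x
  field_simp
  ring

theorem integral_mobiusWeight (hβ : 0 < β) : ∫ x, mobiusWeight β x = 2 * Real.pi := by
  have h : ∀ x, mobiusWeight β x = (2 / β) * (1 + (x / β) ^ 2)⁻¹ := fun x => by
    simp only [mobiusWeight]
    have := sq_add_sq_pos hβ x
    field_simp
    ring
  simp only [h]
  rw [integral_const_mul, Measure.integral_comp_div (fun x => (1 + x ^ 2)⁻¹) β,
    integral_univ_inv_one_add_sq, abs_of_pos hβ, smul_eq_mul]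
  field_simp

theorem integrable_mobiusWeight_mul_zpow (hβ : 0 < β) (k : ℤ) :
    Integrable fun x : ℝ => (mobiusWeight β x : ℂ) * mobius β x ^ k := by
  refine (integrable_mobiusWeight hβ).mono' ?_ ?_
  · exact ((Complex.continuous_ofReal.comp (mobiusWeight_continuous hβ)).mul
      (mobius_zpow_continuous hβ k)).aestronglyMeasurable
  · refine Eventually.of_forall fun x => ?_
    rw [norm_mul, norm_mobius_zpow hβ, mul_one, Complex.norm_real,
      Real.norm_of_nonneg (mobiusWeight_pos hβ x).le]

/-- For k ≠ 0 the integrand is the derivative of M^k/(ik), which has the same limit at both ends of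
the line. This gives orthogonality without changing variables to the circle. -/
theorem integral_mobiusWeight_mul_zpow (hβ : 0 < β) (k : ℤ) :
    ∫ x : ℝ, (mobiusWeight β x : ℂ) * mobius β x ^ k = if k = 0 then 2 * (Real.pi : ℂ) else 0 := by
  split_ifs with hk
  · subst hk
    simp only [zpow_zero, mul_one]
    rw [integral_complex_ofReal, integral_mobiusWeight hβ]
    push_cast
    rfl
  · have hk' : (k : ℂ) ≠ 0 := by exact_mod_cast hk
    have hd : ∀ x : ℝ, HasDerivAt (fun x : ℝ => (Complex.I * k)⁻¹ * mobius β x ^ k)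
        ((mobiusWeight β x : ℂ) * mobius β x ^ k) x := fun x => by
      refine ((hasDerivAt_mobius_zpow hβ k x).const_mul (Complex.I * (k : ℂ))⁻¹).congr_deriv ?_
      field_simp [Complex.I_ne_zero]
    have hlim := (tendsto_mobius_zpow hβ k).const_mul (Complex.I * (k : ℂ))⁻¹
    rw [cocompact_eq_atBot_atTop, tendsto_sup] at hlim
    rw [integral_of_hasDerivAt_of_tendsto hd (integrable_mobiusWeight_mul_zpow hβ k) hlim.1 hlim.2,
      sub_self]

end Mobius

/-! ### Parseval's identity for powers of M, and the L² norm of M^k - 1. -/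

section Orthogonality

variable {β : ℝ}

theorem weighted_normSq_eq (a : ℤ → ℂ) (S : Finset ℤ) (hβ : 0 < β) (x : ℝ) :
    ((mobiusWeight β x * ‖∑ k ∈ S, a k * mobius β x ^ k‖ ^ 2 : ℝ) : ℂ) =
      ∑ k ∈ S, ∑ l ∈ S, a k * (starRingEnd ℂ) (a l) *
        ((mobiusWeight β x : ℂ) * mobius β x ^ (k - l)) := by
  have h0 := mobius_ne_zero hβ x
  push_cast
  rw [← Complex.mul_conj', map_sum, Finset.sum_mul_sum, Finset.mul_sum]
  refine Finset.sum_congr rfl fun k _ => ?_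
  rw [Finset.mul_sum]
  refine Finset.sum_congr rfl fun l _ => ?_
  rw [map_mul, map_zpow₀, conj_mobius, zpow_sub₀ h0, inv_zpow]
  ring

theorem integrable_weighted_normSq (a : ℤ → ℂ) (S : Finset ℤ) (hβ : 0 < β) :
    Integrable fun x : ℝ => mobiusWeight β x * ‖∑ k ∈ S, a k * mobius β x ^ k‖ ^ 2 := by
  have h : Integrable fun x : ℝ =>
      ((mobiusWeight β x * ‖∑ k ∈ S, a k * mobius β x ^ k‖ ^ 2 : ℝ) : ℂ) := by
    simp only [weighted_normSq_eq a S hβ]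
    exact integrable_finsetSum _ fun k _ => integrable_finsetSum _ fun l _ =>
      (integrable_mobiusWeight_mul_zpow hβ (k - l)).const_mul _
  exact h.re

theorem integral_weighted_normSq (a : ℤ → ℂ) (S : Finset ℤ) (hβ : 0 < β) :
    ∫ x : ℝ, mobiusWeight β x * ‖∑ k ∈ S, a k * mobius β x ^ k‖ ^ 2 =
      2 * Real.pi * ∑ k ∈ S, ‖a k‖ ^ 2 := by
  have h : ((∫ x : ℝ, mobiusWeight β x * ‖∑ k ∈ S, a k * mobius β x ^ k‖ ^ 2 : ℝ) : ℂ) =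
      ((2 * Real.pi * ∑ k ∈ S, ‖a k‖ ^ 2 : ℝ) : ℂ) := by
    rw [← integral_complex_ofReal]
    simp only [weighted_normSq_eq a S hβ]
    rw [integral_finsetSum _ fun k _ => integrable_finsetSum _ fun l _ =>
      (integrable_mobiusWeight_mul_zpow hβ (k - l)).const_mul _]
    push_cast
    rw [Finset.mul_sum]
    refine Finset.sum_congr rfl fun k hk => ?_
    rw [integral_finsetSum _ fun l _ =>
      (integrable_mobiusWeight_mul_zpow hβ (k - l)).const_mul _]
    simp only [integral_const_mul, integral_mobiusWeight_mul_zpow hβ, sub_eq_zero]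
    rw [Finset.sum_eq_single k]
    · rw [if_pos rfl, Complex.mul_conj']
      ring
    · intro l _ hl
      rw [if_neg (Ne.symm hl), mul_zero]
    · exact fun h => absurd hk h
  exact_mod_cast h

theorem lintegral_weighted_enormSq (a : ℤ → ℂ) (S : Finset ℤ) (hβ : 0 < β) :
    ∫⁻ x : ℝ, ENNReal.ofReal (mobiusWeight β x) * ‖∑ k ∈ S, a k * mobius β x ^ k‖ₑ ^ 2 =
      ENNReal.ofReal (2 * Real.pi) * ∑ k ∈ S, ‖a k‖ₑ ^ 2 := by
  have h := ofReal_integral_eq_lintegral_ofReal (integrable_weighted_normSq a S hβ)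
    (Eventually.of_forall fun x => mul_nonneg (mobiusWeight_pos hβ x).le (sq_nonneg _))
  rw [integral_weighted_normSq a S hβ] at h
  simp only [ENNReal.ofReal_mul (mobiusWeight_pos hβ _).le, ENNReal.ofReal_pow (norm_nonneg _),
    ofReal_norm] at h
  rw [← h, ENNReal.ofReal_mul (by positivity), ENNReal.ofReal_sum_of_nonneg (by simp)]
  simp only [ENNReal.ofReal_pow (norm_nonneg _), ofReal_norm]

theorem lintegral_mobiusWeight (hβ : 0 < β) :
    ∫⁻ x, ENNReal.ofReal (mobiusWeight β x) = ENNReal.ofReal (2 * Real.pi) := by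
  rw [← ofReal_integral_eq_lintegral_ofReal (integrable_mobiusWeight hβ)
    (Eventually.of_forall fun x => (mobiusWeight_pos hβ x).le), integral_mobiusWeight hβ]

/-- Factor M^n - 1 through 1 - M and the geometric sum 1 + … + M^(n-1). Since |1 - M|² = 2βw, the
integral is a Parseval sum of n unit coefficients. Growth like n, not n², is why only a half moment
of the coefficients is needed in L². -/
theorem lintegral_mobius_pow_sub_one (hβ : 0 < β) (n : ℕ) :
    ∫⁻ x : ℝ, ‖mobius β x ^ n - 1‖ₑ ^ 2 = ENNReal.ofReal (4 * Real.pi * β) * n := by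
  have h : ∀ x : ℝ, ‖mobius β x ^ n - 1‖ₑ ^ 2 = ENNReal.ofReal (2 * β) *
      (ENNReal.ofReal (mobiusWeight β x) *
        ‖∑ k ∈ (Finset.range n).map Nat.castEmbedding, (1 : ℂ) * mobius β x ^ (k : ℤ)‖ₑ ^ 2) := by
    intro x
    rw [← mul_assoc, ← ENNReal.ofReal_mul (by positivity), ← norm_one_sub_mobius_sq hβ,
      ENNReal.ofReal_pow (norm_nonneg _), ofReal_norm, ← mul_pow, ← enorm_mul,
      Finset.sum_map]
    simp only [Nat.castEmbedding_apply, one_mul, zpow_natCast]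
    rw [mul_comm, mul_one_sub, ← mul_one_sub, ← enorm_neg (_ * _), ← mul_neg, neg_sub, geom_sum_mul]
  simp only [h]
  rw [lintegral_const_mul' _ _ ENNReal.ofReal_ne_top, lintegral_weighted_enormSq _ _ hβ,
    ← mul_assoc, ← ENNReal.ofReal_mul (by positivity)]
  simp
  congr 2
  ring

theorem enorm_mobius_zpow_sub_one (hβ : 0 < β) (k : ℤ) (x : ℝ) :
    ‖mobius β x ^ k - 1‖ₑ = ‖mobius β x ^ k.natAbs - 1‖ₑ := by
  rcases Int.natAbs_eq k with h | h
  · conv_lhs => rw [h]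
    rw [zpow_natCast]
  · conv_lhs => rw [h]
    have h0 := mobius_ne_zero hβ x
    have h1 : mobius β x ^ (-(k.natAbs : ℤ)) - 1 =
        -(mobius β x ^ (-(k.natAbs : ℤ)) * (mobius β x ^ k.natAbs - 1)) := by
      rw [zpow_neg, zpow_natCast, mul_sub, inv_mul_cancel₀ (pow_ne_zero _ h0)]
      ring
    rw [h1, enorm_neg, enorm_mul, ← ofReal_norm (_ ^ (-_)), norm_mobius_zpow hβ]
    simp

theorem lintegral_mobius_zpow_sub_one_le (hβ : 0 < β) (k : ℤ) :
    ∫⁻ x : ℝ, ‖mobius β x ^ k - 1‖ₑ ^ 2 ≤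
      ENNReal.ofReal (4 * Real.pi * β) * ENNReal.ofReal (1 + |(k : ℝ)|) := by
  simp only [enorm_mobius_zpow_sub_one hβ k]
  rw [lintegral_mobius_pow_sub_one hβ]
  gcongr
  rw [← ENNReal.ofReal_natCast]
  refine ENNReal.ofReal_le_ofReal ?_
  rw [Nat.cast_natAbs]
  push_cast
  linarith

end Orthogonality

/-! ### Series in `M_β^k - 1` -/

/-- The function `∑ c_k (M_β(x)^k - 1)`, which vanishes at infinity. -/
noncomputable def mobiusSeries (β : ℝ) (c : ℤ → ℂ) (x : ℝ) : ℂ :=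
  ∑' k : ℤ, c k * (mobius β x ^ k - 1)

/-- The action on coefficients of the derivative of `∑ c_k (M_β^k - 1)`. -/
noncomputable def derivCoef (β : ℝ) (c : ℤ → ℂ) (m : ℤ) : ℂ :=
  Complex.I / (2 * β) * (2 * (m * c m) - ((m - 1 : ℤ) * c (m - 1)) - ((m + 1 : ℤ) * c (m + 1)))

section Series

variable {β : ℝ}

theorem norm_mobius_zpow_sub_one_le (hβ : 0 < β) (k : ℤ) (x : ℝ) :
    ‖mobius β x ^ k - 1‖ ≤ 2 := by
  refine (norm_sub_le _ _).trans ?_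
  rw [norm_mobius_zpow hβ, norm_one]
  norm_num

theorem summable_mobiusSeries (hβ : 0 < β) {c : ℤ → ℂ} (hc : Summable fun k => ‖c k‖) (x : ℝ) :
    Summable fun k : ℤ => c k * (mobius β x ^ k - 1) := by
  refine Summable.of_norm_bounded (hc.mul_right 2) fun k => ?_
  rw [norm_mul]
  gcongr
  exact norm_mobius_zpow_sub_one_le hβ k x

theorem summable_norm_of_finite {c : ℤ → ℂ} (hc : c.support.Finite) : Summable fun k => ‖c k‖ :=
  summable_of_hasFiniteSupport (hc.subset fun k hk => by simpa using hk)

theorem mobiusSeries_sub (hβ : 0 < β) {c d : ℤ → ℂ} (hc : Summable fun k => ‖c k‖)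
    (hd : Summable fun k => ‖d k‖) (x : ℝ) :
    mobiusSeries β (c - d) x = mobiusSeries β c x - mobiusSeries β d x := by
  rw [mobiusSeries, mobiusSeries, mobiusSeries,
    ← (summable_mobiusSeries hβ hc x).tsum_sub (summable_mobiusSeries hβ hd x)]
  refine tsum_congr fun k => ?_
  rw [Pi.sub_apply, sub_mul]

theorem mobiusSeries_add (hβ : 0 < β) {c d : ℤ → ℂ} (hc : Summable fun k => ‖c k‖)
    (hd : Summable fun k => ‖d k‖) (x : ℝ) :
    mobiusSeries β (c + d) x = mobiusSeries β c x + mobiusSeries β d x := by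
  rw [mobiusSeries, mobiusSeries, mobiusSeries,
    ← (summable_mobiusSeries hβ hc x).tsum_add (summable_mobiusSeries hβ hd x)]
  refine tsum_congr fun k => ?_
  rw [Pi.add_apply, add_mul]

theorem mobiusSeries_continuous (hβ : 0 < β) {c : ℤ → ℂ} (hc : Summable fun k => ‖c k‖) :
    Continuous (mobiusSeries β c) := by
  refine continuous_tsum (fun k => continuous_const.mul
    ((mobius_zpow_continuous hβ k).sub continuous_const)) (hc.mul_right 2) fun k x => ?_
  rw [norm_mul]
  gcongr
  exact norm_mobius_zpow_sub_one_le hβ k x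

theorem enorm_mobiusSeries_le (hβ : 0 < β) {c : ℤ → ℂ} (hc : Summable fun k => ‖c k‖) (x : ℝ) :
    ‖mobiusSeries β c x‖ₑ ≤ ∑' k : ℤ, ‖c k‖ₑ * ‖mobius β x ^ k - 1‖ₑ := by
  have h := (summable_mobiusSeries hβ hc x)
  refine le_trans ?_ (ENNReal.tsum_le_tsum fun k => (enorm_mul (c k) _).le)
  exact enorm_tsum_le_tsum_enorm

/-- In substance Minkowski's inequality with ‖M^k - 1‖ ≲ (1+|k|)^(1/2). It is carried out pointwise
by Cauchy–Schwarz with weights (1+|k|)^(±1/2)|c_k|, followed by Tonelli. -/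
theorem lintegral_mobiusSeries_sq_le (hβ : 0 < β) {c : ℤ → ℂ} (hc : Summable fun k => ‖c k‖) :
    ∫⁻ x : ℝ, ‖mobiusSeries β c x‖ₑ ^ 2 ≤
      ENNReal.ofReal (4 * Real.pi * β) * absMoment (1 / 2) c ^ 2 := by
  set ρ : ℤ → ℝ → ℝ≥0∞ := fun k p => ENNReal.ofReal ((1 + |(k : ℝ)|) ^ p) with hρ
  have hpt : ∀ x : ℝ, ‖mobiusSeries β c x‖ₑ ^ 2 ≤ absMoment (1 / 2) c *
      ∑' k : ℤ, ρ k (-1 / 2) * ‖c k‖ₑ * ‖mobius β x ^ k - 1‖ₑ ^ 2 := by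
    intro x
    have h := tsum_mul_sq_le (fun k : ℤ => (ρ k (1 / 2) * ‖c k‖ₑ) ^ (1 / 2 : ℝ))
      (fun k : ℤ => (ρ k (-1 / 2) * ‖c k‖ₑ) ^ (1 / 2 : ℝ) * ‖mobius β x ^ k - 1‖ₑ)
    have hs : ∀ a : ℝ≥0∞, (a ^ (1 / 2 : ℝ)) ^ 2 = a := fun a => by
      rw [← ENNReal.rpow_mul_natCast]
      norm_num
    simp only [mul_pow, hs] at h
    refine le_trans ?_ h
    gcongr
    refine (enorm_mobiusSeries_le hβ hc x).trans (ENNReal.tsum_le_tsum fun k => le_of_eq ?_)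
    rw [← mul_assoc, ← ENNReal.mul_rpow_of_nonneg _ _ (by norm_num : (0:ℝ) ≤ 1 / 2)]
    congr 1
    have : ρ k (1 / 2) * ‖c k‖ₑ * (ρ k (-1 / 2) * ‖c k‖ₑ) = ‖c k‖ₑ ^ 2 := by
      rw [mul_mul_mul_comm, hρ, ← ofReal_rpow_add (one_add_abs_pos k)]
      norm_num
      ring
    rw [this, ← ENNReal.rpow_natCast_mul]
    norm_num
  refine (lintegral_mono hpt).trans ?_
  -- Pulling the moment out of the integral needs it finite. If it is infinite the right side is
  -- `⊤`, because 4πβ ≠ 0.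
  by_cases htop : absMoment (1 / 2) c = ⊤
  · rw [htop]
    have : ENNReal.ofReal (4 * Real.pi * β) ≠ 0 := by
      rw [Ne, ENNReal.ofReal_eq_zero, not_le]
      positivity
    simp [ENNReal.mul_top this]
  have hm : ∀ k : ℤ, Measurable fun x : ℝ => ‖mobius β x ^ k - 1‖ₑ ^ 2 := fun k =>
    (((mobius_zpow_continuous hβ k).sub continuous_const).enorm.measurable).pow_const 2
  rw [lintegral_const_mul' _ _ htop, lintegral_tsum fun k => ((hm k).const_mul _).aemeasurable,
    sq, ← mul_assoc, mul_comm (ENNReal.ofReal _), mul_assoc]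
  gcongr
  conv_rhs => rw [absMoment, ← ENNReal.tsum_mul_left]
  refine ENNReal.tsum_le_tsum fun k => ?_
  rw [lintegral_const_mul _ (hm k)]
  calc ρ k (-1 / 2) * ‖c k‖ₑ * ∫⁻ x : ℝ, ‖mobius β x ^ k - 1‖ₑ ^ 2
      ≤ ρ k (-1 / 2) * ‖c k‖ₑ * (ENNReal.ofReal (4 * Real.pi * β) * ρ k 1) := by
        gcongr
        simpa [hρ] using lintegral_mobius_zpow_sub_one_le hβ k
    _ = ENNReal.ofReal (4 * Real.pi * β) * ((ρ k (-1 / 2) * ρ k 1) * ‖c k‖ₑ) := by ring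
    _ = _ := by
        rw [hρ, ← ofReal_rpow_add (one_add_abs_pos k)]
        norm_num

end Series

/-! ### The derivative of a finite series and its action on coefficients. -/

section Derivative

variable {β : ℝ}

theorem hasFiniteSupport_mul {c : ℤ → ℂ} (hc : c.support.Finite) (d : ℤ → ℂ) :
    (fun k => c k * d k).HasFiniteSupport :=
  hc.subset fun k hk => by
    intro h
    simp [h] at hk

theorem mobiusSeries_eq_sum {c : ℤ → ℂ} (hc : c.support.Finite) (x : ℝ) :
    mobiusSeries β c x = ∑ k ∈ hc.toFinset, c k * (mobius β x ^ k - 1) :=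
  tsum_eq_sum fun k hk => by
    have : c k = 0 := by simpa using hk
    rw [this, zero_mul]

theorem weightedSq_eq_sum (s : ℝ) {c : ℤ → ℂ} (hc : c.support.Finite) :
    weightedSq s c =
      ∑ k ∈ hc.toFinset, ENNReal.ofReal ((1 + |(k : ℝ)|) ^ (2 * s)) * ‖c k‖ₑ ^ 2 :=
  tsum_eq_sum fun k hk => by
    have : c k = 0 := by simpa using hk
    rw [this]
    simp

theorem weightedSq_ne_top_of_finite (s : ℝ) {c : ℤ → ℂ} (hc : c.support.Finite) :
    weightedSq s c ≠ ⊤ := by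
  rw [weightedSq_eq_sum s hc]
  exact ENNReal.sum_ne_top.2 fun k _ => ENNReal.mul_ne_top ENNReal.ofReal_ne_top (by simp)

theorem derivCoef_finite {c : ℤ → ℂ} (hc : c.support.Finite) : (derivCoef β c).support.Finite := by
  refine ((hc.union (hc.image (· + 1))).union (hc.image (· - 1))).subset fun m hm => ?_
  by_contra h
  simp only [Set.mem_union, Set.mem_image, not_or, not_exists, not_and] at h
  obtain ⟨⟨h1, h2⟩, h3⟩ := h
  have e1 : c m = 0 := by simpa using h1
  have e2 : c (m - 1) = 0 := by
    by_contra h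
    exact h2 (m - 1) h (by ring)
  have e3 : c (m + 1) = 0 := by
    by_contra h
    exact h3 (m + 1) h (by ring)
  simp [derivCoef, e1, e2, e3] at hm

/-- The right side is the termwise derivative. Substituting 2βw = 2 - M - M⁻¹ turns w M^k into a
combination of M^k, M^(k+1), M^(k-1) with coefficients proportional to 2, -1, -1. These sum to zero,
so each power may be replaced by the power minus 1. -/
theorem mobiusSeries_derivCoef (hβ : 0 < β) {c : ℤ → ℂ} (hc : c.support.Finite) (x : ℝ) :
    mobiusSeries β (derivCoef β c) x =
      Complex.I * mobiusWeight β x * ∑ k ∈ hc.toFinset, (k * c k) * mobius β x ^ k := by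
  have h0 := mobius_ne_zero hβ x
  have hβ' : (β : ℂ) ≠ 0 := by exact_mod_cast hβ.ne'
  set e : ℤ → ℂ := fun k => k * c k with he
  have hfe : e.support.Finite := hc.subset fun k hk => by
    intro h
    simp [he, h] at hk
  set g : ℤ → ℂ := fun k => mobius β x ^ k - 1
  have hs : ∀ d : ℤ → ℂ, Summable fun k => e k * d k := fun d =>
    summable_of_hasFiniteSupport (hasFiniteSupport_mul hfe d)
  have s0 := (hs g).hasSum
  -- Summation by parts: the shifts in `derivCoef` are moved from the coefficients to the powers of
  -- M.
  have s1 : HasSum (fun m : ℤ => e (m - 1) * g m) (∑' k, e k * g (k + 1)) := by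
    have := (Equiv.subRight (1 : ℤ)).hasSum_iff.2 (hs fun k => g (k + 1)).hasSum
    simpa [Function.comp_def] using this
  have s2 : HasSum (fun m : ℤ => e (m + 1) * g m) (∑' k, e k * g (k - 1)) := by
    have := (Equiv.addRight (1 : ℤ)).hasSum_iff.2 (hs fun k => g (k - 1)).hasSum
    simpa [Function.comp_def] using this
  have hsum := (((s0.mul_left 2).sub s1).sub s2).mul_left (Complex.I / (2 * β))
  have hL : mobiusSeries β (derivCoef β c) x = Complex.I / (2 * β) *
      (2 * ∑' k, e k * g k - ∑' k, e k * g (k + 1) - ∑' k, e k * g (k - 1)) := by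
    rw [← hsum.tsum_eq, mobiusSeries]
    refine tsum_congr fun m => ?_
    simp only [derivCoef, he, g]
    ring
  rw [hL, ← tsum_mul_left, ← ((hs g).mul_left 2).tsum_sub (hs _),
    ← (((hs g).mul_left 2).sub (hs _)).tsum_sub (hs _), ← tsum_mul_left,
    tsum_eq_sum (s := hc.toFinset), Finset.mul_sum]
  · refine Finset.sum_congr rfl fun k _ => ?_
    have hw : (mobiusWeight β x : ℂ) = (2 - mobius β x - (mobius β x)⁻¹) / (2 * β) := by
      rw [← mobiusWeight_eq hβ, mul_div_cancel_right₀]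
      simpa using hβ'
    simp only [g, zpow_add_one₀ h0, zpow_sub_one₀ h0]
    rw [hw]
    ring
  · intro k hk
    have : c k = 0 := by simpa using hk
    simp [he, this]

theorem hasDerivAt_mobiusSeries (hβ : 0 < β) {c : ℤ → ℂ} (hc : c.support.Finite) (x : ℝ) :
    HasDerivAt (mobiusSeries β c) (mobiusSeries β (derivCoef β c) x) x := by
  have h : HasDerivAt (fun x : ℝ => ∑ k ∈ hc.toFinset, c k * (mobius β x ^ k - 1))
      (∑ k ∈ hc.toFinset, c k * (Complex.I * k * mobiusWeight β x * mobius β x ^ k)) x :=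
    HasDerivAt.fun_sum fun k _ => ((hasDerivAt_mobius_zpow hβ k x).sub_const 1).const_mul (c k)
  have he : mobiusSeries β c = fun x : ℝ => ∑ k ∈ hc.toFinset, c k * (mobius β x ^ k - 1) :=
    funext fun x => mobiusSeries_eq_sum hc x
  rw [he]
  refine h.congr_deriv ?_
  rw [mobiusSeries_derivCoef hβ hc, Finset.mul_sum]
  exact Finset.sum_congr rfl fun k _ => by ring

theorem tendsto_mobiusSeries (hβ : 0 < β) {c : ℤ → ℂ} (hc : c.support.Finite) :
    Tendsto (mobiusSeries β c) (cocompact ℝ) (𝓝 0) := by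
  have he : mobiusSeries β c = fun x : ℝ => ∑ k ∈ hc.toFinset, c k * (mobius β x ^ k - 1) :=
    funext fun x => mobiusSeries_eq_sum hc x
  rw [he]
  have : Tendsto (fun x : ℝ => ∑ k ∈ hc.toFinset, c k * (mobius β x ^ k - 1)) (cocompact ℝ)
      (𝓝 (∑ k ∈ hc.toFinset, c k * (1 - 1))) :=
    tendsto_finsetSum _ fun k _ => ((tendsto_mobius_zpow hβ k).sub_const 1).const_mul (c k)
  simpa using this

theorem sum_enorm_mul_sq_le {c : ℤ → ℂ} (hc : c.support.Finite) :
    ∑ k ∈ hc.toFinset, ‖(k : ℂ) * c k‖ₑ ^ 2 ≤ weightedSq 1 c := by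
  rw [weightedSq_eq_sum 1 hc]
  refine Finset.sum_le_sum fun k _ => ?_
  rw [enorm_mul, mul_pow]
  gcongr
  rw [← ofReal_norm, ← ENNReal.ofReal_pow (norm_nonneg _)]
  refine ENNReal.ofReal_le_ofReal ?_
  rw [mul_one, Real.rpow_two, Complex.norm_intCast]
  gcongr
  linarith

theorem enorm_mobiusSeries_derivCoef (hβ : 0 < β) {c : ℤ → ℂ} (hc : c.support.Finite) (x : ℝ) :
    ‖mobiusSeries β (derivCoef β c) x‖ₑ = ENNReal.ofReal (mobiusWeight β x) *
      ‖∑ k ∈ hc.toFinset, (k * c k) * mobius β x ^ k‖ₑ := by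
  rw [mobiusSeries_derivCoef hβ hc, enorm_mul, enorm_mul, ← ofReal_norm, ← ofReal_norm,
    Complex.norm_real, Real.norm_of_nonneg (mobiusWeight_pos hβ x).le]
  simp

theorem mobiusWeight_le (hβ : 0 < β) (x : ℝ) : mobiusWeight β x ≤ 2 / β := by
  rw [mobiusWeight, div_le_div_iff₀ (sq_add_sq_pos hβ x) hβ]
  nlinarith [sq_nonneg x]

/-- The derivative is iwP with P = ∑ k c_k M^k. Bounding one factor w by its maximum 2/β leaves ∫
w|P|², which Parseval evaluates. -/
theorem lintegral_mobiusSeries_derivCoef_sq_le (hβ : 0 < β) {c : ℤ → ℂ} (hc : c.support.Finite) :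
    ∫⁻ x, ‖mobiusSeries β (derivCoef β c) x‖ₑ ^ 2 ≤
      ENNReal.ofReal (4 * Real.pi / β) * weightedSq 1 c := by
  calc ∫⁻ x, ‖mobiusSeries β (derivCoef β c) x‖ₑ ^ 2
      ≤ ∫⁻ x : ℝ, ENNReal.ofReal (2 / β) * (ENNReal.ofReal (mobiusWeight β x) *
          ‖∑ k ∈ hc.toFinset, (k * c k) * mobius β x ^ k‖ₑ ^ 2) := by
        refine lintegral_mono fun x => ?_
        rw [enorm_mobiusSeries_derivCoef hβ hc, mul_pow, sq (ENNReal.ofReal _), mul_assoc]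
        gcongr
        exact mobiusWeight_le hβ x
    _ = ENNReal.ofReal (4 * Real.pi / β) * ∑ k ∈ hc.toFinset, ‖(k : ℂ) * c k‖ₑ ^ 2 := by
        rw [lintegral_const_mul' _ _ ENNReal.ofReal_ne_top, lintegral_weighted_enormSq _ _ hβ,
          ← mul_assoc, ← ENNReal.ofReal_mul (by positivity)]
        congr 2
        ring
    _ ≤ _ := by
        gcongr
        exact sum_enorm_mul_sq_le hc

/-- Cauchy–Schwarz for the finite measure w dx: (∫ w|P|)² ≤ ∫ w · ∫ w|P|², and both factors are
known. Order 1 suffices here with no ε lost. -/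
theorem sq_lintegral_mobiusSeries_derivCoef_le (hβ : 0 < β) {c : ℤ → ℂ} (hc : c.support.Finite) :
    (∫⁻ x, ‖mobiusSeries β (derivCoef β c) x‖ₑ) ^ 2 ≤
      ENNReal.ofReal (2 * Real.pi) ^ 2 * weightedSq 1 c := by
  set P : ℝ → ℂ := fun x => ∑ k ∈ hc.toFinset, (k * c k) * mobius β x ^ k with hP
  have hPc : Continuous P := continuous_finsetSum _ fun k _ =>
    continuous_const.mul (mobius_zpow_continuous hβ k)
  have hw : ∀ x, ENNReal.ofReal (√(mobiusWeight β x)) ^ 2 = ENNReal.ofReal (mobiusWeight β x) :=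
    fun x => by
      rw [← ENNReal.ofReal_pow (Real.sqrt_nonneg _), Real.sq_sqrt (mobiusWeight_pos hβ x).le]
  have hwm : Measurable fun x => ENNReal.ofReal (√(mobiusWeight β x)) :=
    ENNReal.measurable_ofReal.comp
      (Real.continuous_sqrt.comp (mobiusWeight_continuous hβ)).measurable
  have h := lintegral_mul_sq_le volume hwm.aemeasurable
    (hwm.mul hPc.enorm.measurable).aemeasurable
  simp only [← mul_assoc, Pi.mul_apply] at h
  simp only [← sq, mul_pow, hw] at h
  rw [lintegral_mobiusWeight hβ, lintegral_weighted_enormSq _ _ hβ] at h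
  simp only [enorm_mobiusSeries_derivCoef hβ hc]
  refine h.trans ?_
  rw [sq, mul_assoc]
  gcongr
  exact sum_enorm_mul_sq_le hc

theorem weightedSq_shift_le {s : ℝ} (hs : 0 ≤ s) (c : ℤ → ℂ) {a : ℤ} (ha : |a| = 1) :
    weightedSq s (fun m => c (m + a)) ≤ ENNReal.ofReal (2 ^ (2 * s)) * weightedSq s c := by
  rw [weightedSq, weightedSq, ← ENNReal.tsum_mul_left, ← (Equiv.addRight a).tsum_eq
    (fun k : ℤ => ENNReal.ofReal (2 ^ (2 * s)) *
      (ENNReal.ofReal ((1 + |(k : ℝ)|) ^ (2 * s)) * ‖c k‖ₑ ^ 2))]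
  refine ENNReal.tsum_le_tsum fun m => ?_
  rw [← mul_assoc, ← ENNReal.ofReal_mul (by positivity), Equiv.coe_addRight,
    ← Real.mul_rpow (by norm_num) (one_add_abs_pos _).le]
  gcongr ENNReal.ofReal (?_ ^ (2 * s)) * _
  have h1 : |(a : ℝ)| = 1 := by exact_mod_cast ha
  have h2 : |(m : ℝ)| ≤ |((m + a : ℤ) : ℝ)| + |(a : ℝ)| := by
    have := abs_sub ((m + a : ℤ) : ℝ) (a : ℝ)
    push_cast at this ⊢
    simpa using this
  linarith [abs_nonneg ((m + a : ℤ) : ℝ)]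

theorem weightedSq_int_mul_le (s : ℝ) (c : ℤ → ℂ) :
    weightedSq s (fun k => k * c k) ≤ weightedSq (s + 1) c := by
  refine ENNReal.tsum_le_tsum fun k => ?_
  rw [enorm_mul, mul_pow, ← mul_assoc, mul_add 2 s, ofReal_rpow_add (one_add_abs_pos k)]
  gcongr
  rw [← ofReal_norm, ← ENNReal.ofReal_pow (norm_nonneg _)]
  refine ENNReal.ofReal_le_ofReal ?_
  rw [mul_one, Real.rpow_two, Complex.norm_intCast]
  gcongr
  linarith

/-- Multiplication by k costs one order of weight, and a shift by one costs only a constant because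
1 + |m| ≤ 2(1 + |m ± 1|). -/
theorem exists_weightedSq_derivCoef_le (β : ℝ) {s : ℝ} (hs : 0 ≤ s) :
    ∃ C : ℝ≥0∞, C ≠ ⊤ ∧ ∀ c, weightedSq s (derivCoef β c) ≤ C * weightedSq (s + 1) c := by
  set A := ENNReal.ofReal (2 ^ (2 * s))
  refine ⟨‖Complex.I / (2 * β)‖ₑ ^ 2 * (2 * (2 * (4 + A) + A)), ?_, fun c => ?_⟩
  · exact ENNReal.mul_ne_top (by simp) (by finiteness)
  set e : ℤ → ℂ := fun k => k * c k with he
  have hd : derivCoef β c = fun m => Complex.I / (2 * β) *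
      (((fun m => 2 * e m) + (fun m => -1 * e (m + -1))) + fun m => -1 * e (m + 1)) m := by
    funext m
    simp only [derivCoef, he, Pi.add_apply]
    push_cast
    ring_nf
  rw [hd, weightedSq_const_mul, mul_assoc]
  gcongr
  have h1 : ‖(2 : ℂ)‖ₑ ^ 2 = 4 := by
    rw [← ofReal_norm, ← ENNReal.ofReal_pow (norm_nonneg _)]
    norm_num
  refine (weightedSq_add_le _ _ _).trans ?_
  rw [mul_assoc]
  gcongr
  rw [add_mul]
  gcongr
  · refine (weightedSq_add_le _ _ _).trans ?_
    rw [mul_assoc]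
    gcongr
    rw [add_mul]
    gcongr
    · rw [weightedSq_const_mul, h1]
      gcongr
      exact weightedSq_int_mul_le s c
    · rw [weightedSq_const_mul]
      simp only [enorm_neg, enorm_one, one_pow, one_mul]
      refine (weightedSq_shift_le hs e (by norm_num)).trans ?_
      gcongr
      exact weightedSq_int_mul_le s c
  · rw [weightedSq_const_mul]
    simp only [enorm_neg, enorm_one, one_pow, one_mul]
    refine (weightedSq_shift_le hs e (by norm_num)).trans ?_
    gcongr
    exact weightedSq_int_mul_le s c

end Derivative

/-! ### Principal values and decay in frequency by repeated integration by parts. -/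

section PrincipalValue

variable {β : ℝ}

/-- The truncated Fourier integral `∫_{-R}^R e^{-iξx} h(x) dx`. -/
noncomputable def partialFourier (h : ℝ → ℂ) (ξ R : ℝ) : ℂ :=
  ∫ x in (-R)..R, Complex.exp (-(Complex.I * ξ * x)) * h x

theorem norm_exp_neg_I_mul (ξ x : ℝ) : ‖Complex.exp (-(Complex.I * ξ * x))‖ = 1 := by
  have : -(Complex.I * ξ * x) = ((-(ξ * x) : ℝ) : ℂ) * Complex.I := by
    push_cast
    ring
  rw [this, Complex.norm_exp_ofReal_mul_I]

theorem continuous_exp_neg_I_mul (ξ : ℝ) :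
    Continuous fun x : ℝ => Complex.exp (-(Complex.I * ξ * x)) := by fun_prop

theorem hasPVFourier_iff {h : ℝ → ℂ} {ξ : ℝ} {a : ℂ} :
    HasPVFourier h ξ a ↔ Tendsto (partialFourier h ξ) atTop (𝓝 a) := Iff.rfl

theorem HasPVFourier.unique {h : ℝ → ℂ} {ξ : ℝ} {a b : ℂ} (ha : HasPVFourier h ξ a)
    (hb : HasPVFourier h ξ b) : a = b :=
  tendsto_nhds_unique ha hb

theorem partialFourier_sub {g h : ℝ → ℂ} (hg : Continuous g) (hh : Continuous h) (ξ R : ℝ) :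
    partialFourier (fun x => g x - h x) ξ R = partialFourier g ξ R - partialFourier h ξ R := by
  rw [partialFourier, partialFourier, partialFourier, ← intervalIntegral.integral_sub]
  · simp only [mul_sub]
  · exact ((continuous_exp_neg_I_mul ξ).mul hg).intervalIntegrable _ _
  · exact ((continuous_exp_neg_I_mul ξ).mul hh).intervalIntegrable _ _

theorem HasPVFourier.sub {g h : ℝ → ℂ} (hg : Continuous g) (hh : Continuous h) {ξ : ℝ} {a b : ℂ}
    (ha : HasPVFourier g ξ a) (hb : HasPVFourier h ξ b) :
    HasPVFourier (fun x => g x - h x) ξ (a - b) := by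
  rw [hasPVFourier_iff] at *
  exact (ha.sub hb).congr fun R => (partialFourier_sub hg hh ξ R).symm

theorem mobiusSeries_continuous_of_finite (hβ : 0 < β) {c : ℤ → ℂ} (hc : c.support.Finite) :
    Continuous (mobiusSeries β c) :=
  mobiusSeries_continuous hβ (summable_norm_of_finite hc)

theorem integral_exp_neg_I_mul_mul {h h' : ℝ → ℂ} (hd : ∀ x, HasDerivAt h (h' x) x)
    (hc : Continuous h') {ξ : ℝ} (hξ : ξ ≠ 0) (a b : ℝ) :
    ∫ x in a..b, Complex.exp (-(Complex.I * ξ * x)) * h x = Complex.I / ξ *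
      (Complex.exp (-(Complex.I * ξ * b)) * h b - Complex.exp (-(Complex.I * ξ * a)) * h a -
        ∫ x in a..b, Complex.exp (-(Complex.I * ξ * x)) * h' x) := by
  have hξ' : (ξ : ℂ) ≠ 0 := by exact_mod_cast hξ
  have hh : Continuous h := continuous_iff_continuousAt.2 fun x => (hd x).continuousAt
  have hu : ∀ x : ℝ, HasDerivAt (fun x : ℝ => Complex.I / ξ * Complex.exp (-(Complex.I * ξ * x)))
      (Complex.exp (-(Complex.I * ξ * x))) x := fun x => by
    have h1 : HasDerivAt (fun x : ℝ => -(Complex.I * ξ * x)) (-(Complex.I * ξ * 1)) x :=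
      ((Complex.ofRealCLM.hasDerivAt (x := x)).const_mul (Complex.I * ξ)).neg
    refine (h1.cexp.const_mul (Complex.I / ξ)).congr_deriv ?_
    field_simp
    have := Complex.I_sq
    linear_combination -this
  have hp := intervalIntegral.integral_deriv_mul_eq_sub (a := a) (b := b)
    (fun x _ => hu x) (fun x _ => hd x) ((continuous_exp_neg_I_mul ξ).intervalIntegrable _ _)
    (hc.intervalIntegrable _ _)
  simp only [mul_assoc (Complex.I / (ξ : ℂ))] at hp
  have i1 : IntervalIntegrable (fun x : ℝ => Complex.exp (-(Complex.I * ξ * x)) * h x) volume a b :=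
    ((continuous_exp_neg_I_mul ξ).mul hh).intervalIntegrable _ _
  have i2 : IntervalIntegrable (fun x : ℝ => Complex.exp (-(Complex.I * ξ * x)) * h' x)
      volume a b :=
    ((continuous_exp_neg_I_mul ξ).mul hc).intervalIntegrable _ _
  rw [intervalIntegral.integral_add i1 (i2.const_mul _), intervalIntegral.integral_const_mul] at hp
  rw [mul_sub, mul_sub, ← hp]
  ring

theorem partialFourier_mobiusSeries (hβ : 0 < β) {c : ℤ → ℂ} (hc : c.support.Finite) {ξ : ℝ}
    (hξ : ξ ≠ 0) (R : ℝ) :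
    partialFourier (mobiusSeries β c) ξ R = Complex.I / ξ *
      (Complex.exp (-(Complex.I * ξ * R)) * mobiusSeries β c R -
        Complex.exp (-(Complex.I * ξ * (-R : ℝ))) * mobiusSeries β c (-R) -
        partialFourier (mobiusSeries β (derivCoef β c)) ξ R) :=
  integral_exp_neg_I_mul_mul (fun x => hasDerivAt_mobiusSeries hβ hc x)
    (mobiusSeries_continuous_of_finite hβ (derivCoef_finite hc)) hξ (-R) R

theorem integrable_mobiusSeries_derivCoef (hβ : 0 < β) {c : ℤ → ℂ} (hc : c.support.Finite) :
    Integrable (mobiusSeries β (derivCoef β c)) := by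
  refine ⟨(mobiusSeries_continuous_of_finite hβ (derivCoef_finite hc)).aestronglyMeasurable, ?_⟩
  have h := sq_lintegral_mobiusSeries_derivCoef_le hβ hc
  have h2 : ENNReal.ofReal (2 * Real.pi) ^ 2 * weightedSq 1 c ≠ ⊤ :=
    ENNReal.mul_ne_top (by finiteness) (weightedSq_ne_top_of_finite 1 hc)
  rw [HasFiniteIntegral, lt_top_iff_ne_top]
  intro htop
  rw [htop] at h
  exact h2 (top_le_iff.1 (by simpa using h))

theorem exists_hasPVFourier_derivCoef (hβ : 0 < β) {c : ℤ → ℂ} (hc : c.support.Finite) (ξ : ℝ) :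
    ∃ b, HasPVFourier (mobiusSeries β (derivCoef β c)) ξ b := by
  refine ⟨_, intervalIntegral_tendsto_integral (μ := volume) ?_ tendsto_neg_atTop_atBot tendsto_id⟩
  refine (integrable_mobiusSeries_derivCoef hβ hc).bdd_mul
    (continuous_exp_neg_I_mul ξ).aestronglyMeasurable (c := 1) ?_
  exact Eventually.of_forall fun x => (norm_exp_neg_I_mul ξ x).le

/-- Let R → ∞ in the integration by parts. The boundary terms vanish because every M^k - 1 tends to
zero at infinity. -/
theorem hasPVFourier_of_derivCoef (hβ : 0 < β) {c : ℤ → ℂ} (hc : c.support.Finite) {ξ : ℝ}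
    (hξ : ξ ≠ 0) {b : ℂ} (hb : HasPVFourier (mobiusSeries β (derivCoef β c)) ξ b) :
    HasPVFourier (mobiusSeries β c) ξ (Complex.I / ξ * -b) := by
  have hlim := tendsto_mobiusSeries hβ hc
  have hzero : ∀ u : ℝ → ℝ, Tendsto u atTop (cocompact ℝ) →
      Tendsto (fun R => Complex.exp (-(Complex.I * ξ * (u R : ℝ))) * mobiusSeries β c (u R)) atTop
        (𝓝 0) := fun u hu => by
    refine squeeze_zero_norm (fun R => ?_) ((tendsto_norm_zero.comp hlim).comp hu)
    rw [norm_mul, norm_exp_neg_I_mul, one_mul]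
    rfl
  have h1 := hzero id (by rw [cocompact_eq_atBot_atTop]; exact tendsto_id.mono_right le_sup_right)
  have h2 := hzero (fun R => -R) (by
    rw [cocompact_eq_atBot_atTop]; exact tendsto_neg_atTop_atBot.mono_right le_sup_left)
  have h3 := ((h1.sub h2).sub hb).const_mul (Complex.I / ξ)
  rw [sub_zero, zero_sub] at h3
  rw [hasPVFourier_iff]
  exact h3.congr fun R => (partialFourier_mobiusSeries hβ hc hξ R).symm

theorem exists_hasPVFourier_of_finite (hβ : 0 < β) {c : ℤ → ℂ} (hc : c.support.Finite) {ξ : ℝ}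
    (hξ : ξ ≠ 0) : ∃ a, HasPVFourier (mobiusSeries β c) ξ a :=
  let ⟨_, hb⟩ := exists_hasPVFourier_derivCoef hβ hc ξ
  ⟨_, hasPVFourier_of_derivCoef hβ hc hξ hb⟩

theorem enorm_mobiusSeries_le_absMoment (hβ : 0 < β) {c : ℤ → ℂ} (hc : Summable fun k => ‖c k‖)
    (x : ℝ) : ‖mobiusSeries β c x‖ₑ ≤ 2 * absMoment 0 c := by
  refine (enorm_mobiusSeries_le hβ hc x).trans ?_
  rw [absMoment, ← ENNReal.tsum_mul_left]
  refine ENNReal.tsum_le_tsum fun k => ?_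
  rw [Real.rpow_zero, ENNReal.ofReal_one, one_mul, mul_comm]
  gcongr
  rw [← ofReal_norm, ← ENNReal.ofReal_ofNat 2]
  exact ENNReal.ofReal_le_ofReal (norm_mobius_zpow_sub_one_le hβ k x)

theorem enorm_partialFourier_le_lintegral (h : ℝ → ℂ) (ξ R : ℝ) :
    ‖partialFourier h ξ R‖ₑ ≤ ∫⁻ x, ‖h x‖ₑ := by
  rw [partialFourier]
  have hn : ∀ x : ℝ, ‖Complex.exp (-(Complex.I * ξ * x)) * h x‖ₑ = ‖h x‖ₑ := fun x => by
    rw [enorm_mul, ← ofReal_norm (Complex.exp _), norm_exp_neg_I_mul, ENNReal.ofReal_one, one_mul]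
  have key : ‖∫ x in Set.uIoc (-R) R, Complex.exp (-(Complex.I * ξ * x)) * h x‖ₑ ≤
      ∫⁻ x, ‖h x‖ₑ := by
    refine (enorm_integral_le_lintegral_enorm _).trans ?_
    simp only [hn]
    exact setLIntegral_le_lintegral _ _
  rwa [← ofReal_norm, intervalIntegral.norm_intervalIntegral_eq, ofReal_norm]

theorem enorm_I_div {ξ : ℝ} (hξ : ξ ≠ 0) (z : ℂ) :
    ‖ξ‖ₑ * ‖Complex.I / ξ * z‖ₑ = ‖z‖ₑ := by
  have hξ' : (ξ : ℂ) ≠ 0 := by exact_mod_cast hξ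
  rw [← ofReal_norm, ← ofReal_norm, ← ofReal_norm, ← ENNReal.ofReal_mul (norm_nonneg _)]
  congr 1
  rw [norm_mul, norm_div, Complex.norm_I, Complex.norm_real]
  field_simp [norm_ne_zero_iff.2 hξ]

/-- One integration by parts, with the boundary terms bounded by the supremum of the series and the
remaining integral by the L¹ norm of the derivative. Uniformity in R is what later allows principal
values to survive the passage to infinite series. -/
theorem exists_partialFourier_sq_le_of_finite (hβ : 0 < β) :
    ∃ C : ℝ≥0∞, C ≠ ⊤ ∧ ∀ c : ℤ → ℂ, c.support.Finite → ∀ ξ : ℝ, ξ ≠ 0 → ∀ R : ℝ,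
      ‖ξ‖ₑ ^ 2 * ‖partialFourier (mobiusSeries β c) ξ R‖ₑ ^ 2 ≤ C * weightedSq 1 c := by
  -- The 4 collects two boundary terms of size 2 `absMoment 0 c`, the zeta value compares that
  -- moment with order 1, and the leading 2 comes from the square of a sum.
  refine ⟨2 * (4 ^ 2 * latticeZeta 2 + ENNReal.ofReal (2 * Real.pi) ^ 2), ?_, ?_⟩
  · have := latticeZeta_ne_top (r := 2) (by norm_num)
    finiteness
  intro c hc ξ hξ R
  rw [partialFourier_mobiusSeries hβ hc hξ, ← mul_pow, enorm_I_div hξ, sub_eq_add_neg _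
    (partialFourier _ _ _)]
  refine (enorm_add_sq_le _ _).trans ?_
  rw [mul_assoc (2 : ℝ≥0∞) (_ + _) _, add_mul, enorm_neg]
  gcongr
  · have hs := summable_norm_of_finite hc
    have h1 : ∀ x : ℝ, ‖Complex.exp (-(Complex.I * ξ * x)) * mobiusSeries β c x‖ₑ ≤
        2 * absMoment 0 c := fun x => by
      rw [enorm_mul, ← ofReal_norm (Complex.exp _), norm_exp_neg_I_mul, ENNReal.ofReal_one,
        one_mul]
      exact enorm_mobiusSeries_le_absMoment hβ hs x
    have h2 := absMoment_sq_le 0 1 c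
    rw [sub_zero, mul_one] at h2
    calc _ ≤ (2 * absMoment 0 c + 2 * absMoment 0 c) ^ 2 := by
          gcongr
          exact (enorm_sub_le).trans (add_le_add (h1 R) (h1 (-R)))
      _ = 4 ^ 2 * absMoment 0 c ^ 2 := by ring
      _ ≤ _ := by
          rw [mul_assoc]
          gcongr
  · refine le_trans ?_ (sq_lintegral_mobiusSeries_derivCoef_le hβ hc)
    gcongr
    exact enorm_partialFourier_le_lintegral _ _ _

/-- Each step trades a factor ξ for one application of `derivCoef`, hence one order of weight. The
base case is the limit R → ∞ of the uniform bound above. -/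
theorem exists_hasPVFourier_sq_le_of_finite (hβ : 0 < β) (j : ℕ) :
    ∃ C : ℝ≥0∞, C ≠ ⊤ ∧ ∀ c : ℤ → ℂ, c.support.Finite → ∀ ξ : ℝ, ξ ≠ 0 → ∀ a,
      HasPVFourier (mobiusSeries β c) ξ a →
        ‖ξ‖ₑ ^ (2 * (j + 1)) * ‖a‖ₑ ^ 2 ≤ C * weightedSq (j + 1) c := by
  induction j with
  | zero =>
    obtain ⟨C, hC, h⟩ := exists_partialFourier_sq_le_of_finite hβ
    refine ⟨C, hC, fun c hc ξ hξ a ha => ?_⟩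
    have hlim : Tendsto (fun R => ‖ξ‖ₑ ^ 2 * ‖partialFourier (mobiusSeries β c) ξ R‖ₑ ^ 2) atTop
        (𝓝 (‖ξ‖ₑ ^ 2 * ‖a‖ₑ ^ 2)) :=
      ENNReal.Tendsto.const_mul (ENNReal.Tendsto.pow (Tendsto.enorm ha)) (Or.inr (by simp))
    have := le_of_tendsto' hlim (h c hc ξ hξ)
    simpa using this
  | succ j ih =>
    obtain ⟨C, hC, h⟩ := ih
    obtain ⟨C', hC', h'⟩ := exists_weightedSq_derivCoef_le β (s := (j : ℝ) + 1) (by positivity)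
    refine ⟨C * C', ENNReal.mul_ne_top hC hC', fun c hc ξ hξ a ha => ?_⟩
    obtain ⟨b, hb⟩ := exists_hasPVFourier_derivCoef hβ hc ξ
    have hab := ha.unique (hasPVFourier_of_derivCoef hβ hc hξ hb)
    calc ‖ξ‖ₑ ^ (2 * (j + 1 + 1)) * ‖a‖ₑ ^ 2 = ‖ξ‖ₑ ^ (2 * (j + 1)) * (‖ξ‖ₑ * ‖a‖ₑ) ^ 2 := by ring
      _ = ‖ξ‖ₑ ^ (2 * (j + 1)) * ‖b‖ₑ ^ 2 := by rw [hab, enorm_I_div hξ, enorm_neg]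
      _ ≤ C * weightedSq (j + 1) (derivCoef β c) := h _ (derivCoef_finite hc) ξ hξ b hb
      _ ≤ C * (C' * weightedSq (j + 1 + 1) c) := by
          gcongr
          exact h' c
      _ = _ := by
          push_cast
          ring

theorem summable_norm_of_weightedSq {c : ℤ → ℂ} {s : ℝ} (hs : 1 ≤ s) (hc : weightedSq s c ≠ ⊤) :
    Summable fun k => ‖c k‖ :=
  summable_norm_of_absMoment le_rfl (absMoment_ne_top (p := 0) (by linarith) hc)

theorem partialFourier_mobiusSeries_sub (hβ : 0 < β) {c d : ℤ → ℂ}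
    (hc : Summable fun k => ‖c k‖) (hd : Summable fun k => ‖d k‖) (ξ R : ℝ) :
    partialFourier (mobiusSeries β (c - d)) ξ R =
      partialFourier (mobiusSeries β c) ξ R - partialFourier (mobiusSeries β d) ξ R := by
  rw [← partialFourier_sub (mobiusSeries_continuous hβ hc) (mobiusSeries_continuous hβ hd)]
  congr 1
  exact funext fun x => mobiusSeries_sub hβ hc hd x

theorem enorm_partialFourier_le_absMoment (hβ : 0 < β) {c : ℤ → ℂ}
    (hc : Summable fun k => ‖c k‖) (ξ R : ℝ) :
    ‖partialFourier (mobiusSeries β c) ξ R‖ₑ ≤ 2 * absMoment 0 c * ENNReal.ofReal |R - -R| := by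
  have hfin : absMoment 0 c ≠ ⊤ := by
    have h : (∑' k, ‖c k‖ₑ) ≠ ⊤ := by
      simpa [ofReal_norm] using hc.tsum_ofReal_ne_top
    simpa [absMoment] using h
  have h := intervalIntegral.norm_integral_le_of_norm_le_const (a := -R) (b := R)
    (f := fun x : ℝ => Complex.exp (-(Complex.I * ξ * x)) * mobiusSeries β c x)
    (C := (2 * absMoment 0 c).toReal) (fun x _ => by
      rw [norm_mul, norm_exp_neg_I_mul, one_mul, ← toReal_enorm]
      exact ENNReal.toReal_mono (by finiteness) (enorm_mobiusSeries_le_absMoment hβ hc x))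
  rw [← ofReal_norm, partialFourier]
  refine (ENNReal.ofReal_le_ofReal h).trans ?_
  rw [ENNReal.ofReal_mul ENNReal.toReal_nonneg, ENNReal.ofReal_toReal (by finiteness)]

/-- At fixed R the interval is bounded, so uniform convergence of the truncated series is enough. -/
theorem tendsto_partialFourier_truncate (hβ : 0 < β) {c : ℤ → ℂ} (hc : absMoment 0 c ≠ ⊤)
    (ξ R : ℝ) :
    Tendsto (fun S : Finset ℤ => partialFourier (mobiusSeries β (truncate S c)) ξ R) atTop
      (𝓝 (partialFourier (mobiusSeries β c) ξ R)) := by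
  have hs := summable_norm_of_absMoment le_rfl hc
  have h0 : Tendsto (fun S : Finset ℤ => 2 * absMoment 0 (c - truncate S c) *
      ENNReal.ofReal |R - -R|) atTop (𝓝 0) := by
    have := ENNReal.Tendsto.mul_const (b := ENNReal.ofReal |R - -R|) (ENNReal.Tendsto.const_mul
      (a := 2) (tendsto_absMoment_sub_truncate hc) (Or.inr (by finiteness)))
      (Or.inr (by finiteness))
    simpa using this
  rw [tendsto_iff_edist_tendsto_0]
  refine tendsto_of_tendsto_of_tendsto_of_le_of_le tendsto_const_nhds h0 (fun _ => zero_le)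
    fun S => ?_
  have hS := summable_norm_of_finite (truncate_finite S c)
  show edist _ _ ≤ _
  rw [edist_comm, edist_eq_enorm_sub, ← partialFourier_mobiusSeries_sub hβ hs hS]
  refine enorm_partialFourier_le_absMoment hβ ?_ ξ R
  exact Summable.of_nonneg_of_le (fun _ => norm_nonneg _) (fun k => norm_sub_le _ _) (hs.add hS)

theorem exists_partialFourier_sq_le (hβ : 0 < β) :
    ∃ C : ℝ≥0∞, C ≠ ⊤ ∧ ∀ c : ℤ → ℂ, weightedSq 1 c ≠ ⊤ → ∀ ξ : ℝ, ξ ≠ 0 → ∀ R : ℝ,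
      ‖ξ‖ₑ ^ 2 * ‖partialFourier (mobiusSeries β c) ξ R‖ₑ ^ 2 ≤ C * weightedSq 1 c := by
  obtain ⟨C, hC, h⟩ := exists_partialFourier_sq_le_of_finite hβ
  refine ⟨C, hC, fun c hc ξ hξ R => ?_⟩
  have hlim := tendsto_partialFourier_truncate hβ
    (absMoment_ne_top (p := 0) (by norm_num) hc) ξ R
  have hlim2 := ENNReal.Tendsto.const_mul (a := ‖ξ‖ₑ ^ 2)
    (ENNReal.Tendsto.pow (n := 2) (Tendsto.enorm hlim)) (Or.inr (by simp))
  refine le_of_tendsto' hlim2 fun S => (h _ (truncate_finite S c) ξ hξ R).trans ?_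
  gcongr
  exact weightedSq_mono (enorm_truncate_le S c)

/-- A three-ε argument: by the order 1 bound applied to the tail, the truncated series has partial
integrals close to those of the full series uniformly in R, and its own partial integrals converge.
-/
theorem exists_hasPVFourier (hβ : 0 < β) {c : ℤ → ℂ} (hc : weightedSq 1 c ≠ ⊤) {ξ : ℝ}
    (hξ : ξ ≠ 0) : ∃ a, HasPVFourier (mobiusSeries β c) ξ a := by
  obtain ⟨C, hC, h⟩ := exists_partialFourier_sq_le hβ
  have hs := summable_norm_of_weightedSq le_rfl hc
  have hlim : Tendsto (fun S : Finset ℤ => C * weightedSq 1 (c - truncate S c)) atTop (𝓝 0) := by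
    simpa using ENNReal.Tendsto.const_mul (a := C) (tendsto_weightedSq_sub_truncate hc)
      (Or.inr hC)
  refine cauchySeq_tendsto_of_complete (Metric.cauchySeq_iff.2 fun ε hε => ?_)
  have hδ : 0 < ‖ξ‖ₑ ^ 2 * ENNReal.ofReal (ε / 3) ^ 2 := by
    have : 0 < ENNReal.ofReal (ε / 3) := ENNReal.ofReal_pos.2 (by positivity)
    have : 0 < ‖ξ‖ₑ := by simpa using hξ
    positivity
  obtain ⟨S, hS⟩ := ((tendsto_order.1 hlim).2 _ hδ).exists
  have hfin := truncate_finite S c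
  have hclose : ∀ R, dist (partialFourier (mobiusSeries β c) ξ R)
      (partialFourier (mobiusSeries β (truncate S c)) ξ R) < ε / 3 := fun R => by
    rw [dist_eq_norm, ← partialFourier_mobiusSeries_sub hβ hs (summable_norm_of_finite hfin)]
    have h1 := (h (c - truncate S c) (ne_top_of_le_ne_top hc
      (weightedSq_mono (enorm_sub_truncate_le S c))) ξ hξ R).trans_lt hS
    have h2 := not_le.1 fun hle => h1.not_ge (mul_le_mul_right hle (‖ξ‖ₑ ^ 2))
    rw [← ofReal_norm] at h2
    have h3 := not_le.1 fun hle => h2.not_ge (pow_le_pow_left' hle 2)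
    exact (ENNReal.ofReal_lt_ofReal_iff (by positivity)).1 h3
  obtain ⟨b, hb⟩ := exists_hasPVFourier_of_finite hβ hfin hξ
  obtain ⟨N, hN⟩ := Metric.cauchySeq_iff.1 (Tendsto.cauchySeq (hasPVFourier_iff.1 hb)) (ε / 3)
    (by positivity)
  refine ⟨N, fun m hm n hn => ?_⟩
  have t1 := hclose m
  have t2 := hclose n
  have t3 := hN m hm n hn
  have t4 := dist_triangle4 (partialFourier (mobiusSeries β c) ξ m)
    (partialFourier (mobiusSeries β (truncate S c)) ξ m)
    (partialFourier (mobiusSeries β (truncate S c)) ξ n)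
    (partialFourier (mobiusSeries β c) ξ n)
  rw [dist_comm (partialFourier (mobiusSeries β (truncate S c)) ξ n)] at t4
  show dist (partialFourier (mobiusSeries β c) ξ m) (partialFourier (mobiusSeries β c) ξ n) < ε
  linarith

theorem exists_hasPVFourier_sq_le (hβ : 0 < β) (j : ℕ) :
    ∃ C : ℝ≥0∞, C ≠ ⊤ ∧ ∀ c : ℤ → ℂ, weightedSq (j + 1) c ≠ ⊤ → ∀ ξ : ℝ, ξ ≠ 0 → ∀ a,
      HasPVFourier (mobiusSeries β c) ξ a →
        ‖ξ‖ₑ ^ (2 * (j + 1)) * ‖a‖ₑ ^ 2 ≤ C * weightedSq (j + 1) c := by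
  obtain ⟨C, hC, h⟩ := exists_hasPVFourier_sq_le_of_finite hβ j
  obtain ⟨C', hC', h'⟩ := exists_partialFourier_sq_le hβ
  refine ⟨C, hC, fun c hc ξ hξ a ha => ?_⟩
  have hj : (1 : ℝ) ≤ j + 1 := by
    have : (0 : ℝ) ≤ j := by positivity
    linarith
  have hs := summable_norm_of_weightedSq hj hc
  have hc1 : weightedSq 1 c ≠ ⊤ := ne_top_of_le_ne_top hc (weightedSq_mono_exponent hj c)
  choose b hb using fun S : Finset ℤ => exists_hasPVFourier_of_finite hβ (truncate_finite S c) hξ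
  -- The order 1 bound for the tail is uniform in R, so it passes to the limit and compares the
  -- principal values themselves.
  have hdiff : ∀ S, ‖ξ‖ₑ ^ 2 * ‖a - b S‖ₑ ^ 2 ≤ C' * weightedSq 1 (c - truncate S c) := fun S => by
    have hS := summable_norm_of_finite (truncate_finite S c)
    have hlim := (hasPVFourier_iff.1 ha).sub (hasPVFourier_iff.1 (hb S))
    refine le_of_tendsto' (ENNReal.Tendsto.const_mul (a := ‖ξ‖ₑ ^ 2)
      (ENNReal.Tendsto.pow (n := 2) (Tendsto.enorm hlim)) (Or.inr (by simp))) fun R => ?_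
    rw [← partialFourier_mobiusSeries_sub hβ hs hS]
    exact h' _ (ne_top_of_le_ne_top hc1 (weightedSq_mono (enorm_sub_truncate_le S c))) ξ hξ R
  have hξe : ‖ξ‖ₑ ^ 2 ≠ 0 := by simpa using hξ
  have hba : Tendsto b atTop (𝓝 a) := by
    have h0 : Tendsto (fun S : Finset ℤ => C' * weightedSq 1 (c - truncate S c)) atTop (𝓝 0) := by
      simpa using ENNReal.Tendsto.const_mul (a := C') (tendsto_weightedSq_sub_truncate hc1)
        (Or.inr hC')
    have h1 := tendsto_of_tendsto_of_tendsto_of_le_of_le tendsto_const_nhds h0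
      (fun _ => zero_le) hdiff
    have h2 := ENNReal.Tendsto.const_mul (a := (‖ξ‖ₑ ^ 2)⁻¹) h1 (Or.inr (by simpa using hξ))
    simp only [← mul_assoc, ENNReal.inv_mul_cancel hξe (by simp : ‖ξ‖ₑ ^ 2 ≠ ⊤), one_mul,
      mul_zero] at h2
    have h3 := h2.ennrpow_const (1 / 2)
    rw [tendsto_iff_edist_tendsto_0]
    have hz : (0 : ℝ≥0∞) ^ (1 / 2 : ℝ) = 0 := by norm_num
    rw [hz] at h3
    refine h3.congr fun S => ?_
    rw [← ENNReal.rpow_natCast_mul, edist_comm, edist_eq_enorm_sub]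
    norm_num
  refine le_of_tendsto' (ENNReal.Tendsto.const_mul (a := ‖ξ‖ₑ ^ (2 * (j + 1)))
    (ENNReal.Tendsto.pow (n := 2) (Tendsto.enorm hba)) (Or.inr (by simp))) fun S => ?_
  refine (h _ (truncate_finite S c) ξ hξ _ (hb S)).trans ?_
  gcongr
  exact weightedSq_mono (enorm_truncate_le S c)

end PrincipalValue

/-! ### Uniform bounds for truncated Fourier integrals -/

theorem norm_pow_sub_one_le {z : ℂ} (hz : ‖z‖ = 1) (n : ℕ) : ‖z ^ n - 1‖ ≤ n * ‖z - 1‖ := by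
  induction n with
  | zero => simp
  | succ n ih =>
    have h : z ^ (n + 1) - 1 = z * (z ^ n - 1) + (z - 1) := by ring
    rw [h]
    refine (norm_add_le _ _).trans ?_
    rw [norm_mul, hz, one_mul]
    push_cast
    linarith

theorem norm_pow_sub_one_sub_le {z : ℂ} (hz : ‖z‖ = 1) (n : ℕ) :
    ‖z ^ n - 1 - n * (z - 1)‖ ≤ n ^ 2 * ‖z - 1‖ ^ 2 := by
  induction n with
  | zero => simp
  | succ n ih =>
    have h : z ^ (n + 1) - 1 - (n + 1 : ℕ) * (z - 1) =
        (z ^ n - 1) * (z - 1) + (z ^ n - 1 - n * (z - 1)) := by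
      push_cast
      ring
    rw [h]
    refine (norm_add_le _ _).trans ?_
    rw [norm_mul]
    have h1 := mul_le_mul_of_nonneg_right (norm_pow_sub_one_le hz n) (norm_nonneg (z - 1))
    push_cast
    nlinarith [sq_nonneg ‖z - 1‖, mul_nonneg (Nat.cast_nonneg (α := ℝ) n) (sq_nonneg ‖z - 1‖)]

theorem norm_zpow_sub_one_sub_le {z : ℂ} (hz : ‖z‖ = 1) (k : ℤ) :
    ‖z ^ k - 1 - k * (z - 1)‖ ≤ 2 * (|(k : ℝ)| * ‖z - 1‖) ^ 2 := by
  have hz0 : z ≠ 0 := norm_ne_zero_iff.1 (by rw [hz]; exact one_ne_zero)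
  obtain ⟨n, rfl | rfl⟩ := Int.eq_nat_or_neg k
  · have h := norm_pow_sub_one_sub_le hz n
    rw [zpow_natCast, mul_pow, sq_abs]
    push_cast
    nlinarith [mul_nonneg (sq_nonneg (n : ℝ)) (sq_nonneg ‖z - 1‖)]
  · have hw : ‖z⁻¹‖ = 1 := by rw [norm_inv, hz, inv_one]
    have hd : ‖z⁻¹ - 1‖ = ‖z - 1‖ := by
      have : z⁻¹ - 1 = -(z⁻¹ * (z - 1)) := by
        field_simp
        ring
      rw [this, norm_neg, norm_mul, hw, one_mul]
    have h := norm_pow_sub_one_sub_le hw n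
    rw [hd] at h
    -- Negative powers are expanded around z⁻¹. Replacing z⁻¹ - 1 by -(z - 1) costs z⁻¹(z - 1)² per
    -- power, and n ≤ n² absorbs this into the factor 2.
    have he : z ^ (-(n : ℤ)) - 1 - ((-(n : ℤ) : ℤ) : ℂ) * (z - 1) =
        ((z⁻¹) ^ n - 1 - n * (z⁻¹ - 1)) + n * (z⁻¹ * ((z - 1) * (z - 1))) := by
      rw [zpow_neg, zpow_natCast, inv_pow]
      push_cast
      field_simp
      ring
    rw [he]
    refine (norm_add_le _ _).trans ?_
    rw [norm_mul, norm_mul, hw, norm_mul, Complex.norm_natCast, mul_pow, sq_abs]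
    push_cast
    have hn : (n : ℝ) ≤ n ^ 2 := by exact_mod_cast Nat.le_self_pow two_ne_zero n
    nlinarith [mul_le_mul_of_nonneg_right hn (sq_nonneg ‖z - 1‖)]

theorem norm_zpow_sub_one_le {z : ℂ} (hz : ‖z‖ = 1) (k : ℤ) :
    ‖z ^ k - 1‖ ≤ |(k : ℝ)| * ‖z - 1‖ := by
  have hz0 : z ≠ 0 := norm_ne_zero_iff.1 (by rw [hz]; exact one_ne_zero)
  obtain ⟨n, rfl | rfl⟩ := Int.eq_nat_or_neg k
  · simpa using norm_pow_sub_one_le hz n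
  · have h : z ^ (-(n : ℤ)) - 1 = -(z ^ (-(n : ℤ)) * (z ^ n - 1)) := by
      rw [mul_sub, ← zpow_natCast, ← zpow_add₀ hz0]
      simp
    rw [h, norm_neg, norm_mul, norm_zpow, hz, one_zpow, one_mul]
    simpa using norm_pow_sub_one_le hz n

/-- For y = |k||z - 1|, the quadratic bound is used when y ≤ 1 and the linear one when y ≥ 1. An
exponent just above 1 loses little in k while still making the remainder integrable over the line.
-/
theorem norm_zpow_sub_one_sub_le_rpow {z : ℂ} (hz : ‖z‖ = 1) (k : ℤ) {δ : ℝ} (h0 : 0 ≤ δ)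
    (h1 : δ ≤ 1) :
    ‖z ^ k - 1 - k * (z - 1)‖ ≤ 2 * (|(k : ℝ)| * ‖z - 1‖) ^ (1 + δ) := by
  set y := |(k : ℝ)| * ‖z - 1‖ with hy
  have hy0 : 0 ≤ y := by positivity
  rcases le_total y 1 with h | h
  · refine (norm_zpow_sub_one_sub_le hz k).trans ?_
    rcases hy0.eq_or_lt with h2 | h2
    · rw [← hy, ← h2]
      simp
      positivity
    · rw [← Real.rpow_two]
      gcongr 2 * ?_
      exact Real.rpow_le_rpow_of_exponent_ge h2 h (by linarith)
  · have h3 : y ≤ y ^ (1 + δ) := by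
      conv_lhs => rw [← Real.rpow_one y]
      exact Real.rpow_le_rpow_of_exponent_le h (by linarith)
    have h4 := norm_zpow_sub_one_le hz k
    refine (norm_sub_le _ _).trans ?_
    rw [norm_mul, Complex.norm_intCast]
    linarith

section

variable {β : ℝ}

theorem norm_mobius_sub_one_mul_le (hβ : 0 < β) (x : ℝ) : ‖mobius β x - 1‖ * |x| ≤ 2 * β := by
  have h := norm_one_sub_mobius_sq hβ x
  rw [norm_sub_rev, mobiusWeight] at h
  refine abs_le_of_sq_le_sq' ?_ (by positivity) |>.2
  rw [mul_pow, h, sq_abs, ← mul_div_assoc, div_mul_eq_mul_div, div_le_iff₀ (sq_add_sq_pos hβ x)]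
  nlinarith [sq_nonneg (β * x), sq_nonneg (β * β)]

theorem norm_mobius_sub_one_le_two (hβ : 0 < β) (x : ℝ) : ‖mobius β x - 1‖ ≤ 2 := by
  have := norm_mobius_zpow_sub_one_le hβ 1 x
  simpa using this

theorem mobius_continuous (hβ : 0 < β) : Continuous fun x : ℝ => mobius β x := by
  simpa using mobius_zpow_continuous hβ 1

theorem integrable_norm_mobius_sub_one_rpow (hβ : 0 < β) {δ : ℝ} (hδ : 0 < δ) :
    Integrable fun x : ℝ => ‖mobius β x - 1‖ ^ (1 + δ) := by
  have h := (integrable_one_add_norm (E := ℝ) (μ := volume) (r := 1 + δ)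
    (by simpa using hδ)).const_mul ((2 + 2 * β) ^ (1 + δ))
  refine h.mono' ?_ (Eventually.of_forall fun x => ?_)
  · exact (((mobius_continuous hβ).sub continuous_const).norm.rpow_const
      fun _ => Or.inr (by linarith)).aestronglyMeasurable
  · rw [Real.norm_of_nonneg (by positivity), Real.rpow_neg (by positivity), ← div_eq_mul_inv,
      ← Real.div_rpow (by positivity) (by positivity)]
    refine Real.rpow_le_rpow (norm_nonneg _) ?_ (by linarith)
    rw [le_div_iff₀ (by positivity), Real.norm_eq_abs]
    nlinarith [norm_mobius_sub_one_mul_le hβ x, norm_mobius_sub_one_le_two hβ x]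

theorem mobius_sub_one_add_neg (hβ : 0 < β) (x : ℝ) :
    (mobius β x - 1) + (mobius β (-x : ℝ) - 1) = -(2 * β * mobiusWeight β x : ℝ) := by
  have h : mobius β (-x : ℝ) = (mobius β x)⁻¹ := by
    rw [mobius, mobius, inv_div, ← neg_div_neg_eq]
    push_cast
    ring
  have h2 := mobiusWeight_eq hβ x
  rw [h]
  push_cast
  linear_combination h2

/-- M(-x) = M(x)⁻¹, so symmetrising cancels the part of M - 1 that decays only like 1/x and leaves
the integrable -βw. -/
theorem integral_mobius_sub_one (hβ : 0 < β) (R : ℝ) :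
    ∫ x in (-R)..R, (mobius β x - 1) = -(β * ∫ x in (-R)..R, mobiusWeight β x : ℝ) := by
  have hc : Continuous fun x : ℝ => mobius β x - 1 := (mobius_continuous hβ).sub continuous_const
  have h1 : ∫ x in (-R)..R, (mobius β (-x : ℝ) - 1) = ∫ x in (-R)..R, (mobius β x - 1) := by
    have := intervalIntegral.integral_comp_neg (a := -R) (b := R) fun x : ℝ => mobius β x - 1
    simpa using this
  have hn : IntervalIntegrable (fun x : ℝ => mobius β (-x : ℝ) - 1) volume (-R) R :=
    (hc.comp continuous_neg).intervalIntegrable _ _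
  have h2 : ∫ x in (-R)..R, ((mobius β x - 1) + (mobius β (-x : ℝ) - 1)) =
      (∫ x in (-R)..R, (mobius β x - 1)) + ∫ x in (-R)..R, (mobius β (-x : ℝ) - 1) :=
    intervalIntegral.integral_add (hc.intervalIntegrable _ _) hn
  have h3 : ∫ x in (-R)..R, ((mobius β x - 1) + (mobius β (-x : ℝ) - 1)) =
      -(2 * β * ∫ x in (-R)..R, mobiusWeight β x : ℝ) := by
    simp only [mobius_sub_one_add_neg hβ]
    rw [intervalIntegral.integral_neg, intervalIntegral.integral_ofReal,
      intervalIntegral.integral_const_mul]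
  rw [h1, h3] at h2
  push_cast at h2 ⊢
  linear_combination (-1 / 2 : ℂ) * h2

theorem integral_mobiusWeight_le (hβ : 0 < β) {R : ℝ} (hR : 0 ≤ R) :
    ‖∫ x in (-R)..R, mobiusWeight β x‖ ≤ 2 * Real.pi := by
  rw [← integral_mobiusWeight hβ, intervalIntegral.integral_of_le (by linarith),
    Real.norm_of_nonneg
      (setIntegral_nonneg measurableSet_Ioc fun x _ => (mobiusWeight_pos hβ x).le)]
  exact setIntegral_le_integral (integrable_mobiusWeight hβ)
    (Eventually.of_forall fun x => (mobiusWeight_pos hβ x).le)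

/-- When |ξ|R ≤ 1 the exponential is compared with 1. The symmetric integral gives 2πβ; the error
integrand is at most |ξ||x||M - 1| ≤ 2β|ξ|, which over length 2R gives 4β. -/
theorem norm_partialFourier_mobius_sub_one_le_of_small (hβ : 0 < β) {ξ R : ℝ} (hR : 0 ≤ R)
    (h : |ξ| * R ≤ 1) :
    ‖partialFourier (fun x => mobius β x - 1) ξ R‖ ≤ 2 * Real.pi * β + 4 * β := by
  have hc : Continuous fun x : ℝ => mobius β x - 1 := (mobius_continuous hβ).sub continuous_const
  have he : partialFourier (fun x => mobius β x - 1) ξ R =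
      (∫ x in (-R)..R, (mobius β x - 1)) +
      ∫ x in (-R)..R, (Complex.exp (-(Complex.I * ξ * x)) - 1) * (mobius β x - 1) := by
    have hi : IntervalIntegrable (fun x : ℝ => (Complex.exp (-(Complex.I * ξ * x)) - 1) *
        (mobius β x - 1)) volume (-R) R :=
      (((continuous_exp_neg_I_mul ξ).sub continuous_const).mul hc).intervalIntegrable _ _
    rw [← intervalIntegral.integral_add (hc.intervalIntegrable _ _) hi, partialFourier]
    congr 1
    funext x
    ring
  rw [he]
  refine (norm_add_le _ _).trans (add_le_add ?_ ?_)
  · rw [integral_mobius_sub_one hβ, norm_neg, Complex.norm_real, norm_mul,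
      Real.norm_of_nonneg hβ.le, mul_comm]
    gcongr
    exact integral_mobiusWeight_le hβ hR
  · refine (intervalIntegral.norm_integral_le_of_norm_le_const (C := |ξ| * (2 * β))
      fun x _ => ?_).trans ?_
    · rw [norm_mul]
      have h1 : ‖Complex.exp (-(Complex.I * ξ * x)) - 1‖ ≤ |ξ| * |x| := by
        have := Real.norm_exp_I_mul_ofReal_sub_one_le (x := -(ξ * x))
        rw [norm_neg, norm_mul, Real.norm_eq_abs, Real.norm_eq_abs] at this
        convert this using 4
        push_cast
        ring
      calc _ ≤ |ξ| * |x| * ‖mobius β x - 1‖ := by gcongr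
        _ = |ξ| * (‖mobius β x - 1‖ * |x|) := by ring
        _ ≤ _ := mul_le_mul_of_nonneg_left (norm_mobius_sub_one_mul_le hβ x) (abs_nonneg ξ)
    · have h2 : |R - -R| = 2 * R := by
        rw [sub_neg_eq_add, abs_of_nonneg (by linarith)]
        ring
      rw [h2]
      nlinarith

/-- Beyond |x| = 1/|ξ| the oscillation is used: after one integration by parts the two boundary
terms and the integral of |M'| ≤ 2β/x² are each at most 2β|ξ|, and the factor 1/|ξ| leaves 6β. -/
theorem norm_integral_exp_mul_mobius_sub_one_le (hβ : 0 < β) {ξ A a b : ℝ} (hA : 0 < A)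
    (hξ : |ξ| * A = 1) (hab : a ≤ b) (h : A ≤ a ∨ b ≤ -A) :
    ‖∫ x in a..b, Complex.exp (-(Complex.I * ξ * x)) * (mobius β x - 1)‖ ≤ 6 * β := by
  have hξ0 : ξ ≠ 0 := by
    rintro rfl
    simp at hξ
  have hx : ∀ x ∈ Set.Icc a b, A ≤ |x| := fun x hx => by
    rcases h with h | h
    · exact (h.trans hx.1).trans (le_abs_self x)
    · have := neg_le_abs x
      linarith [hx.2]
  have hx0 : ∀ x ∈ Set.Icc a b, x ≠ 0 := fun x hx' => by
    have := hx x hx'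
    intro h0
    rw [h0, abs_zero] at this
    linarith
  have hder : ∀ x : ℝ, HasDerivAt (fun x : ℝ => mobius β x - 1)
      (Complex.I * mobiusWeight β x * mobius β x) x := fun x =>
    (hasDerivAt_mobius hβ x).sub_const 1
  have hcont : Continuous fun x : ℝ => Complex.I * mobiusWeight β x * mobius β x :=
    (continuous_const.mul (Complex.continuous_ofReal.comp (mobiusWeight_continuous hβ))).mul
      (mobius_continuous hβ)
  rw [integral_exp_neg_I_mul_mul hder hcont hξ0, norm_mul, norm_div, Complex.norm_I,
    Complex.norm_real, Real.norm_eq_abs]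
  have hq : ∀ x ∈ Set.Icc a b,
      ‖Complex.exp (-(Complex.I * ξ * x)) * (mobius β x - 1)‖ ≤ 2 * β * |ξ| := fun x hx' => by
    rw [norm_mul, norm_exp_neg_I_mul, one_mul]
    have h1 := norm_mobius_sub_one_mul_le hβ x
    have h2 := mul_le_mul_of_nonneg_left (hx x hx') (norm_nonneg (mobius β x - 1))
    have h3 : ‖mobius β x - 1‖ * A * |ξ| ≤ 2 * β * |ξ| :=
      mul_le_mul_of_nonneg_right (h2.trans h1) (abs_nonneg ξ)
    rw [mul_assoc, mul_comm A, hξ, mul_one] at h3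
    exact h3
  have hint : ‖∫ x in a..b, Complex.exp (-(Complex.I * ξ * x)) *
      (Complex.I * mobiusWeight β x * mobius β x)‖ ≤ 2 * β * |ξ| := by
    have hu : Set.uIcc a b = Set.Icc a b := Set.uIcc_of_le hab
    have hF : ∀ x ∈ Set.uIcc a b, HasDerivAt (fun x : ℝ => -(2 * β) * x⁻¹) (2 * β / x ^ 2) x :=
      fun x hx' => by
        rw [hu] at hx'
        refine ((hasDerivAt_inv (hx0 x hx')).const_mul (-(2 * β))).congr_deriv ?_
        field_simp
    have hI : IntervalIntegrable (fun x : ℝ => 2 * β / x ^ 2) volume a b := by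
      refine ContinuousOn.intervalIntegrable ?_
      rw [hu]
      exact continuousOn_const.div (by fun_prop) fun x hx' => pow_ne_zero 2 (hx0 x hx')
    refine (intervalIntegral.norm_integral_le_of_norm_le hab
      (Eventually.of_forall fun x hx' => ?_) hI).trans ?_
    · rw [norm_mul, norm_mul, norm_mul, norm_exp_neg_I_mul, norm_mobius hβ, Complex.norm_I,
        Complex.norm_real, Real.norm_of_nonneg (mobiusWeight_pos hβ x).le, one_mul, one_mul,
        mul_one, mobiusWeight]
      have := hx0 x (Set.Ioc_subset_Icc_self hx')
      gcongr
      nlinarith [sq_nonneg β]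
    · rw [intervalIntegral.integral_eq_sub_of_hasDerivAt hF hI]
      have hAinv : A⁻¹ = |ξ| := (eq_inv_of_mul_eq_one_left hξ).symm
      rw [← hAinv]
      rcases h with h | h
      · have ha : 0 < a := by linarith
        have hb : 0 < b := by linarith
        have h1 : a⁻¹ ≤ A⁻¹ := inv_anti₀ hA h
        have h2 : 0 < b⁻¹ := by positivity
        nlinarith
      · have h1 : (-b)⁻¹ ≤ A⁻¹ := inv_anti₀ hA (by linarith)
        have h2 : 0 < (-a)⁻¹ := inv_pos.2 (by linarith)
        rw [inv_neg] at h1 h2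
        nlinarith
  have h1 := hq b (Set.right_mem_Icc.2 hab)
  have h2 := hq a (Set.left_mem_Icc.2 hab)
  have hξp : 0 < |ξ| := abs_pos.2 hξ0
  rw [div_mul_eq_mul_div, one_mul, div_le_iff₀ hξp]
  refine (norm_sub_le _ _).trans ?_
  have h3 := norm_sub_le (Complex.exp (-(Complex.I * ξ * b)) * (mobius β b - 1))
    (Complex.exp (-(Complex.I * ξ * a)) * (mobius β a - 1))
  linarith

/-- Split the interval at ±1/|ξ|: the central piece contributes 2πβ + 4β and each tail 6β. -/
theorem norm_partialFourier_mobius_sub_one_le (hβ : 0 < β) (ξ : ℝ) {R : ℝ} (hR : 0 ≤ R) :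
    ‖partialFourier (fun x => mobius β x - 1) ξ R‖ ≤ 2 * Real.pi * β + 16 * β := by
  rcases le_or_gt (|ξ| * R) 1 with h | h
  · refine (norm_partialFourier_mobius_sub_one_le_of_small hβ hR h).trans ?_
    linarith
  · have hξ : 0 < |ξ| := by
      by_contra h0
      have : |ξ| = 0 := le_antisymm (not_lt.1 h0) (abs_nonneg ξ)
      rw [this, zero_mul] at h
      linarith
    have hA : 0 < |ξ|⁻¹ := inv_pos.2 hξ
    have hAR : |ξ|⁻¹ ≤ R := by
      rw [inv_le_iff_one_le_mul₀ hξ]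
      linarith
    have hA1 : |ξ| * |ξ|⁻¹ = 1 := mul_inv_cancel₀ hξ.ne'
    have hc : Continuous fun x : ℝ => Complex.exp (-(Complex.I * ξ * x)) * (mobius β x - 1) :=
      (continuous_exp_neg_I_mul ξ).mul ((mobius_continuous hβ).sub continuous_const)
    have h1 := norm_partialFourier_mobius_sub_one_le_of_small hβ hA.le hA1.le
    have h2 := norm_integral_exp_mul_mobius_sub_one_le hβ hA hA1 hAR (Or.inl le_rfl)
    have h3 := norm_integral_exp_mul_mobius_sub_one_le hβ hA hA1 (neg_le_neg hAR) (Or.inr le_rfl)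
    rw [partialFourier] at h1 ⊢
    rw [← intervalIntegral.integral_add_adjacent_intervals (hc.intervalIntegrable (-R) (-|ξ|⁻¹))
      (hc.intervalIntegrable _ _), ← intervalIntegral.integral_add_adjacent_intervals
      (hc.intervalIntegrable (-|ξ|⁻¹) (|ξ|⁻¹)) (hc.intervalIntegrable _ _)]
    refine (norm_add_le _ _).trans ?_
    have h4 := norm_add_le
      (∫ x in (-|ξ|⁻¹)..(|ξ|⁻¹), Complex.exp (-(Complex.I * ξ * x)) * (mobius β x - 1))
      (∫ x in (|ξ|⁻¹)..R, Complex.exp (-(Complex.I * ξ * x)) * (mobius β x - 1))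
    linarith

end

/-! ### Fourier transforms of M^k - 1 and of the series at every frequency, including zero. -/

section

variable {β : ℝ}

/-- The second order remainder `M_β^k - 1 - k (M_β - 1)`. -/
noncomputable def mobiusRemainder (β : ℝ) (k : ℤ) (x : ℝ) : ℂ :=
  mobius β x ^ k - 1 - k * (mobius β x - 1)

theorem mobiusRemainder_continuous (hβ : 0 < β) (k : ℤ) : Continuous (mobiusRemainder β k) :=
  ((mobius_zpow_continuous hβ k).sub continuous_const).sub
    (continuous_const.mul ((mobius_continuous hβ).sub continuous_const))

theorem norm_mobiusRemainder_le (hβ : 0 < β) (k : ℤ) {δ : ℝ} (h0 : 0 ≤ δ) (h1 : δ ≤ 1) (x : ℝ) :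
    ‖mobiusRemainder β k x‖ ≤ 2 * |(k : ℝ)| ^ (1 + δ) * ‖mobius β x - 1‖ ^ (1 + δ) := by
  refine (norm_zpow_sub_one_sub_le_rpow (norm_mobius hβ x) k h0 h1).trans (le_of_eq ?_)
  rw [Real.mul_rpow (abs_nonneg _) (norm_nonneg _), mul_assoc]

theorem integrable_mobiusRemainder (hβ : 0 < β) (k : ℤ) : Integrable (mobiusRemainder β k) :=
  ((integrable_norm_mobius_sub_one_rpow hβ one_pos).const_mul _).mono'
    (mobiusRemainder_continuous hβ k).aestronglyMeasurable
    (Eventually.of_forall (norm_mobiusRemainder_le hβ k zero_le_one le_rfl))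

theorem partialFourier_mobius_zpow_sub_one (hβ : 0 < β) (k : ℤ) (ξ R : ℝ) :
    partialFourier (fun x => mobius β x ^ k - 1) ξ R =
      k * partialFourier (fun x => mobius β x - 1) ξ R +
        partialFourier (mobiusRemainder β k) ξ R := by
  have hc : Continuous fun x : ℝ => mobius β x - 1 := (mobius_continuous hβ).sub continuous_const
  have i1 : IntervalIntegrable (fun x : ℝ => (k : ℂ) * (Complex.exp (-(Complex.I * ξ * x)) *
      (mobius β x - 1))) volume (-R) R :=
    (continuous_const.mul ((continuous_exp_neg_I_mul ξ).mul hc)).intervalIntegrable _ _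
  have i2 : IntervalIntegrable (fun x : ℝ => Complex.exp (-(Complex.I * ξ * x)) *
      mobiusRemainder β k x) volume (-R) R :=
    ((continuous_exp_neg_I_mul ξ).mul (mobiusRemainder_continuous hβ k)).intervalIntegrable _ _
  rw [partialFourier, partialFourier, partialFourier, ← intervalIntegral.integral_const_mul,
    ← intervalIntegral.integral_add i1 i2]
  congr 1
  funext x
  rw [mobiusRemainder]
  ring

/-- The linear part k(M - 1) has uniformly bounded partial integrals up to the factor k; the
remainder is bounded absolutely through the integral of |M - 1|^(1+δ). -/
theorem exists_partialFourier_mobius_zpow_le (hβ : 0 < β) {δ : ℝ} (h0 : 0 < δ) (h1 : δ ≤ 1) :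
    ∃ C : ℝ, 0 ≤ C ∧ ∀ (k : ℤ) (ξ R : ℝ), 0 ≤ R →
      ‖partialFourier (fun x => mobius β x ^ k - 1) ξ R‖ ≤ C * (1 + |(k : ℝ)|) ^ (1 + δ) := by
  set J := ∫ x : ℝ, ‖mobius β x - 1‖ ^ (1 + δ) with hJ
  have hJ0 : 0 ≤ J := integral_nonneg fun x => by positivity
  have hpi := Real.pi_pos
  refine ⟨(2 * Real.pi * β + 16 * β) + 2 * J, by positivity, fun k ξ R hR => ?_⟩
  rw [partialFourier_mobius_zpow_sub_one hβ, add_mul]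
  have hk1 : |(k : ℝ)| ≤ (1 + |(k : ℝ)|) ^ (1 + δ) := by
    refine le_trans ?_ (Real.rpow_le_rpow_of_exponent_le (one_le_one_add_abs k)
      (by linarith : (1 : ℝ) ≤ 1 + δ))
    rw [Real.rpow_one]
    linarith
  have hk2 : |(k : ℝ)| ^ (1 + δ) ≤ (1 + |(k : ℝ)|) ^ (1 + δ) :=
    Real.rpow_le_rpow (abs_nonneg _) (by linarith) (by linarith)
  refine (norm_add_le _ _).trans (add_le_add ?_ ?_)
  · rw [norm_mul, Complex.norm_intCast, mul_comm]
    exact mul_le_mul (norm_partialFourier_mobius_sub_one_le hβ ξ hR) hk1 (abs_nonneg _)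
      (by positivity)
  · have hle : -R ≤ R := by linarith
    have hint : Integrable fun x : ℝ => 2 * |(k : ℝ)| ^ (1 + δ) * ‖mobius β x - 1‖ ^ (1 + δ) :=
      (integrable_norm_mobius_sub_one_rpow hβ h0).const_mul _
    refine (intervalIntegral.norm_integral_le_of_norm_le hle (Eventually.of_forall fun x _ => ?_)
      hint.intervalIntegrable).trans ?_
    · rw [norm_mul, norm_exp_neg_I_mul, one_mul]
      exact norm_mobiusRemainder_le hβ k h0.le h1 x
    · rw [intervalIntegral.integral_of_le hle]
      refine (setIntegral_le_integral hint (Eventually.of_forall fun x => by positivity)).trans ?_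
      rw [integral_const_mul, ← hJ]
      nlinarith

theorem mobiusSeries_single (k : ℤ) :
    mobiusSeries β (Pi.single k 1) = fun x : ℝ => mobius β x ^ k - 1 := by
  funext x
  rw [mobiusSeries, tsum_eq_single k]
  · simp
  · intro l hl
    simp [hl]

theorem exists_hasPVFourier_mobius_zpow (hβ : 0 < β) (k : ℤ) (ξ : ℝ) :
    ∃ a, HasPVFourier (fun x => mobius β x ^ k - 1) ξ a := by
  rcases eq_or_ne ξ 0 with rfl | hξ
  -- At frequency zero integration by parts is unavailable. The limit exists because the symmetric
  -- integral of M - 1 is -β∫w and the remainder is integrable.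
  · have hw := intervalIntegral_tendsto_integral (integrable_mobiusWeight hβ)
      tendsto_neg_atTop_atBot tendsto_id
    have hr := intervalIntegral_tendsto_integral (integrable_mobiusRemainder hβ k)
      tendsto_neg_atTop_atBot tendsto_id
    have hw' := ((Complex.continuous_ofReal.tendsto _).comp (hw.const_mul β)).neg.const_mul (k : ℂ)
    refine ⟨_, (hw'.add hr).congr fun R => ?_⟩
    have := partialFourier_mobius_zpow_sub_one hβ k 0 R
    simp only [partialFourier, Complex.ofReal_zero, mul_zero, zero_mul, neg_zero, Complex.exp_zero,
      one_mul] at this ⊢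
    rw [this, integral_mobius_sub_one hβ]
    rfl
  · have := exists_hasPVFourier_of_finite hβ (c := Pi.single k 1)
      ((Set.finite_singleton k).subset Pi.support_single_subset) hξ
    rwa [mobiusSeries_single] at this

theorem hasSum_partialFourier_mobiusSeries (hβ : 0 < β) {c : ℤ → ℂ} (hc : Summable fun k => ‖c k‖)
    (ξ R : ℝ) :
    HasSum (fun k => c k * partialFourier (fun x => mobius β x ^ k - 1) ξ R)
      (partialFourier (mobiusSeries β c) ξ R) := by
  have h := intervalIntegral.hasSum_integral_of_dominated_convergence (μ := volume) (a := -R)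
    (b := R) (F := fun (k : ℤ) (x : ℝ) => c k * (Complex.exp (-(Complex.I * ξ * x)) *
      (mobius β x ^ k - 1)))
    (f := fun x => Complex.exp (-(Complex.I * ξ * x)) * mobiusSeries β c x)
    (fun k _ => ‖c k‖ * 2)
    (fun k => (continuous_const.mul ((continuous_exp_neg_I_mul ξ).mul
      ((mobius_zpow_continuous hβ k).sub continuous_const))).aestronglyMeasurable)
    (fun k => Eventually.of_forall fun x _ => by
      rw [norm_mul, norm_mul, norm_exp_neg_I_mul, one_mul]
      gcongr
      exact norm_mobius_zpow_sub_one_le hβ k x)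
    (Eventually.of_forall fun x _ => hc.mul_right 2)
    intervalIntegrable_const
    (Eventually.of_forall fun x _ => by
      have := (summable_mobiusSeries hβ hc x).hasSum.mul_left (Complex.exp (-(Complex.I * ξ * x)))
      refine this.congr_fun ?_
      intro k
      ring)
  simp only [intervalIntegral.integral_const_mul] at h
  exact h

/-- Dominated convergence for series: the bounds on the partial integrals of M^k - 1 do not depend
on R, so the limit R → ∞ may be taken term by term. -/
theorem exists_hasPVFourier_le_absMoment (hβ : 0 < β) {δ : ℝ} (h0 : 0 < δ) (h1 : δ ≤ 1) :
    ∃ C : ℝ≥0∞, C ≠ ⊤ ∧ ∀ c, absMoment (1 + δ) c ≠ ⊤ → ∀ ξ : ℝ, ∃ a,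
      HasPVFourier (mobiusSeries β c) ξ a ∧ ‖a‖ₑ ≤ C * absMoment (1 + δ) c := by
  obtain ⟨C, hC, hK⟩ := exists_partialFourier_mobius_zpow_le hβ h0 h1
  refine ⟨ENNReal.ofReal C, ENNReal.ofReal_ne_top, fun c hc ξ => ?_⟩
  have hs := summable_norm_of_absMoment (by linarith) hc
  choose p hp using fun k => exists_hasPVFourier_mobius_zpow hβ k ξ
  have hpk : ∀ k : ℤ, ‖p k‖ ≤ C * (1 + |(k : ℝ)|) ^ (1 + δ) := fun k =>
    le_of_tendsto (hp k).norm ((eventually_ge_atTop 0).mono fun R hR => hK k ξ R hR)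
  have hsum : Summable fun k : ℤ => ‖c k‖ * (C * (1 + |(k : ℝ)|) ^ (1 + δ)) := by
    have := (ENNReal.summable_toReal hc).mul_left C
    refine this.congr fun k => ?_
    rw [ENNReal.toReal_mul, ENNReal.toReal_ofReal (Real.rpow_nonneg (one_add_abs_pos k).le _),
      toReal_enorm]
    ring
  refine ⟨∑' k, c k * p k, ?_, ?_⟩
  · have : Tendsto (fun R => ∑' k, c k * partialFourier (fun x => mobius β x ^ k - 1) ξ R) atTop
        (𝓝 (∑' k, c k * p k)) :=
      tendsto_tsum_of_dominated_convergence hsum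
      (fun k => (hasPVFourier_iff.1 (hp k)).const_mul (c k))
      ((eventually_ge_atTop 0).mono fun R hR k => by
        rw [norm_mul]
        gcongr
        exact hK k ξ R hR)
    rw [hasPVFourier_iff]
    exact this.congr fun R => (hasSum_partialFourier_mobiusSeries hβ hs ξ R).tsum_eq
  · refine enorm_tsum_le_tsum_enorm.trans ?_
    rw [absMoment, ← ENNReal.tsum_mul_left]
    refine ENNReal.tsum_le_tsum fun k => ?_
    rw [enorm_mul, ← mul_assoc, ← ENNReal.ofReal_mul hC, mul_comm]
    gcongr
    rw [← ofReal_norm]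
    exact ENNReal.ofReal_le_ofReal (hpk k)

theorem exists_hasPVFourier_le_weightedSq (hβ : 0 < β) {ε : ℝ} (hε : 0 < ε) :
    ∃ C : ℝ≥0∞, C ≠ ⊤ ∧ ∀ c, weightedSq (3 / 2 + ε) c ≠ ⊤ → ∀ ξ : ℝ, ∃ a,
      HasPVFourier (mobiusSeries β c) ξ a ∧ ‖a‖ₑ ^ 2 ≤ C * weightedSq (3 / 2 + ε) c := by
  -- With δ ≤ ε/2 the zeta exponent is 1 + 2(ε - δ) ≥ 1 + ε, hence convergent; δ ≤ 1 is required by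
  -- the remainder estimate.
  set δ := min (ε / 2) 1 with hδ
  have hδ0 : 0 < δ := lt_min (by linarith) one_pos
  have hδ1 : δ ≤ 1 := min_le_right _ _
  have hδ2 : δ ≤ ε / 2 := min_le_left _ _
  obtain ⟨C, hC, h⟩ := exists_hasPVFourier_le_absMoment hβ hδ0 hδ1
  have hr : 1 < 2 * (3 / 2 + ε - (1 + δ)) := by linarith
  refine ⟨C ^ 2 * latticeZeta (2 * (3 / 2 + ε - (1 + δ))),
    ENNReal.mul_ne_top (by finiteness) (latticeZeta_ne_top hr), fun c hc ξ => ?_⟩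
  obtain ⟨a, ha, hle⟩ := h c (absMoment_ne_top hr hc) ξ
  refine ⟨a, ha, ?_⟩
  calc ‖a‖ₑ ^ 2 ≤ (C * absMoment (1 + δ) c) ^ 2 := by gcongr
    _ = C ^ 2 * absMoment (1 + δ) c ^ 2 := mul_pow _ _ _
    _ ≤ C ^ 2 * (latticeZeta (2 * (3 / 2 + ε - (1 + δ))) * weightedSq (3 / 2 + ε) c) := by
        gcongr
        exact absMoment_sq_le _ _ _
    _ = _ := by ring

end

end RationalFourier

namespace RationalFourier

open scoped ENNReal SchwartzMap LineDeriv

/-! ### The Fourier transform of square integrable functions -/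

theorem eLpNorm_two_sq {α E : Type*} [MeasurableSpace α] [NormedAddCommGroup E] (μ : Measure α)
    (h : α → E) : eLpNorm h 2 μ ^ 2 = ∫⁻ x, ‖h x‖ₑ ^ 2 ∂μ := by
  have := eLpNorm_nnreal_pow_eq_lintegral (μ := μ) (f := h) (p := 2) two_ne_zero
  simpa using this

theorem memLp_two_of_lintegral {α E : Type*} [MeasurableSpace α] [NormedAddCommGroup E]
    {μ : Measure α} {h : α → E} (hm : AEStronglyMeasurable h μ)
    (hfin : ∫⁻ x, ‖h x‖ₑ ^ 2 ∂μ ≠ ⊤) : MemLp h 2 μ := by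
  refine ⟨hm, lt_top_iff_ne_top.2 fun htop => hfin ?_⟩
  rw [← eLpNorm_two_sq, htop]
  simp

theorem lintegral_comp_div_two_pi {g : ℝ → ℝ≥0∞} (hg : AEMeasurable g) :
    ∫⁻ k : ℝ, g (k / (2 * Real.pi)) = ENNReal.ofReal (2 * Real.pi) * ∫⁻ x, g x := by
  have hpi : (2 * Real.pi)⁻¹ ≠ 0 := by positivity
  have hmap := Real.map_volume_mul_right hpi
  rw [inv_inv, abs_of_pos (by positivity)] at hmap
  have hm : Measurable fun k : ℝ => k * (2 * Real.pi)⁻¹ := by fun_prop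
  simp only [div_eq_mul_inv]
  rw [← lintegral_map' (μ := volume) (f := g) (g := fun k : ℝ => k * (2 * Real.pi)⁻¹)
    (by rw [hmap]; exact hg.smul_measure _) hm.aemeasurable, hmap, lintegral_smul_measure,
    smul_eq_mul]

theorem ae_comp_div_two_pi {p : ℝ → Prop} (h : ∀ᵐ x, p x) : ∀ᵐ k : ℝ, p (k / (2 * Real.pi)) := by
  have hpi : (2 * Real.pi)⁻¹ ≠ 0 := by positivity
  have hm : Measurable fun k : ℝ => k * (2 * Real.pi)⁻¹ := by fun_prop
  simp only [div_eq_mul_inv]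
  refine ae_of_ae_map hm.aemeasurable (p := p) ?_
  rw [Real.map_volume_mul_right hpi]
  exact Measure.ae_smul_measure h _

theorem l2Fourier_eq {h : ℝ → ℂ} (hh : MemLp h 2 (volume : Measure ℝ)) (k : ℝ) :
    l2Fourier h k = (𝓕 (hh.toLp h) : Lp ℂ 2 (volume : Measure ℝ)) (k / (2 * Real.pi)) := by
  rw [l2Fourier, dif_pos hh]

theorem l2Fourier_measurable {h : ℝ → ℂ} (hh : MemLp h 2 (volume : Measure ℝ)) :
    Measurable (l2Fourier h) := by
  have : l2Fourier h = fun k => (𝓕 (hh.toLp h) : Lp ℂ 2 (volume : Measure ℝ))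
      (k / (2 * Real.pi)) := funext fun k => l2Fourier_eq hh k
  rw [this]
  exact (Lp.stronglyMeasurable _).measurable.comp (by fun_prop)

/-- Plancherel; the factor 2π is the Jacobian of the rescaled frequency. -/
theorem lintegral_l2Fourier_sq {h : ℝ → ℂ} (hh : MemLp h 2 (volume : Measure ℝ)) :
    ∫⁻ k, ‖l2Fourier h k‖ₑ ^ 2 = ENNReal.ofReal (2 * Real.pi) * ∫⁻ x, ‖h x‖ₑ ^ 2 := by
  simp only [l2Fourier_eq hh]
  rw [lintegral_comp_div_two_pi (g := fun x =>
    ‖(𝓕 (hh.toLp h) : Lp ℂ 2 (volume : Measure ℝ)) x‖ₑ ^ 2)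
    ((Lp.stronglyMeasurable _).measurable.enorm.pow_const 2).aemeasurable]
  congr 1
  rw [← eLpNorm_two_sq, ← Lp.enorm_def, ← ofReal_norm, Lp.norm_fourier_eq, ofReal_norm,
    Lp.enorm_def, eLpNorm_congr_ae hh.coeFn_toLp, eLpNorm_two_sq]

theorem l2Fourier_add {g h : ℝ → ℂ} (hg : MemLp g 2 (volume : Measure ℝ))
    (hh : MemLp h 2 (volume : Measure ℝ)) :
    ∀ᵐ k, l2Fourier (fun x => g x + h x) k = l2Fourier g k + l2Fourier h k := by
  have hgh : MemLp (fun x => g x + h x) 2 (volume : Measure ℝ) := hg.add hh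
  have he : (𝓕 (hgh.toLp _) : Lp ℂ 2 (volume : Measure ℝ)) = 𝓕 (hg.toLp g) + 𝓕 (hh.toLp h) := by
    rw [← FourierTransform.fourier_add]
    rfl
  have := ae_comp_div_two_pi (Lp.coeFn_add (𝓕 (hg.toLp g) : Lp ℂ 2 (volume : Measure ℝ))
    (𝓕 (hh.toLp h)))
  filter_upwards [this] with k hk
  rw [l2Fourier_eq hgh, l2Fourier_eq hg, l2Fourier_eq hh, he, hk]
  rfl

/-- Neither function need be integrable, so the identity is proved for tempered distributions: the
classical derivative is the distributional one, whose transform is multiplication by 2πix. Testing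
against compactly supported smooth functions then recovers equality almost everywhere. -/
theorem l2Fourier_deriv {h h' : ℝ → ℂ} (hh : MemLp h 2 (volume : Measure ℝ))
    (hh' : MemLp h' 2 (volume : Measure ℝ)) (hd : ∀ x, HasDerivAt h (h' x) x) :
    ∀ᵐ k : ℝ, l2Fourier h' k = Complex.I * k * l2Fourier h k := by
  set v : Lp ℂ 2 (volume : Measure ℝ) := 𝓕 (hh.toLp h) with hv
  set v' : Lp ℂ 2 (volume : Measure ℝ) := 𝓕 (hh'.toLp h') with hv'
  have hder : ∂_{(1 : ℝ)} ((hh.toLp h : Lp ℂ 2 (volume : Measure ℝ)) : 𝓢'(ℝ, ℂ)) =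
      ((hh'.toLp h' : Lp ℂ 2 (volume : Measure ℝ)) : 𝓢'(ℝ, ℂ)) := by
    ext φ
    rw [TemperedDistribution.lineDerivOp_apply_apply, Lp.toTemperedDistribution_apply,
      Lp.toTemperedDistribution_apply]
    have e1 : ∫ x, (-∂_{(1 : ℝ)} φ) x • (hh.toLp h : Lp ℂ 2 (volume : Measure ℝ)) x =
        -∫ x, deriv φ x * h x := by
      rw [← integral_neg]
      refine integral_congr_ae ?_
      filter_upwards [hh.coeFn_toLp] with x hx
      rw [hx]
      simp [SchwartzMap.lineDerivOp_apply_eq_fderiv]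
    have e2 : ∫ x, φ x • (hh'.toLp h' : Lp ℂ 2 (volume : Measure ℝ)) x = ∫ x, φ x * h' x := by
      refine integral_congr_ae ?_
      filter_upwards [hh'.coeFn_toLp] with x hx
      rw [hx, smul_eq_mul]
    have hφ : MemLp φ 2 (volume : Measure ℝ) := φ.memLp 2
    have hφ' : MemLp (deriv φ) 2 (volume : Measure ℝ) := by
      have := (SchwartzMap.derivCLM ℂ ℂ φ).memLp 2 (volume : Measure ℝ)
      exact this
    -- Integrability of the products, each of two L² functions, is enough to make the boundary terms
    -- disappear.
    rw [e1, e2, integral_mul_deriv_eq_deriv_mul_of_integrable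
      (fun x _ => (φ.differentiable x).hasDerivAt) (fun x _ => hd x) (hφ.integrable_mul hh')
      (hφ'.integrable_mul hh) (hφ.integrable_mul hh)]
  have hF := TemperedDistribution.fourier_lineDerivOp_eq
    ((hh.toLp h : Lp ℂ 2 (volume : Measure ℝ)) : 𝓢'(ℝ, ℂ)) (1 : ℝ)
  rw [hder, Lp.fourier_toTemperedDistribution_eq, Lp.fourier_toTemperedDistribution_eq,
    ← hv, ← hv'] at hF
  have hloc : LocallyIntegrable (v : ℝ → ℂ) := (Lp.memLp v).locallyIntegrable one_le_two
  have hloc' : LocallyIntegrable (v' : ℝ → ℂ) := (Lp.memLp v').locallyIntegrable one_le_two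
  have hlocm : LocallyIntegrable fun x : ℝ => (2 * Real.pi * Complex.I * x) * v x :=
    hloc.continuous_mul (by fun_prop)
  have hae : ∀ᵐ x : ℝ, v' x = (2 * Real.pi * Complex.I * x) * v x := by
    refine ae_eq_of_integral_contDiff_smul_eq hloc' hlocm fun g hg hgc => ?_
    have hg₁ : HasCompactSupport (Complex.ofRealCLM ∘ g) := hgc.comp_left rfl
    have hg₂ : ContDiff ℝ ((⊤ : ℕ∞) : WithTop ℕ∞) (Complex.ofRealCLM ∘ g) :=
      Complex.ofRealCLM.contDiff.comp hg
    have := congrArg (fun T : 𝓢'(ℝ, ℂ) => T (hg₁.toSchwartzMap hg₂)) hF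
    have hgr : (fun x : ℝ => (x : ℂ)).HasTemperateGrowth := by fun_prop
    simp [TemperedDistribution.smulLeftCLM_apply_apply,
      SchwartzMap.smulLeftCLM_apply_apply hgr] at this
    simp only [Complex.real_smul]
    rw [this, ← integral_const_mul]
    refine integral_congr_ae (Eventually.of_forall fun x => ?_)
    ring
  filter_upwards [ae_comp_div_two_pi hae] with k hk
  rw [l2Fourier_eq hh', l2Fourier_eq hh, ← hv, ← hv', hk]
  push_cast
  field_simp

/-! ### Dyadic sums -/

/-- The geometric sum `∑ 2^{-ip}`. -/
noncomputable def dyadicSum (p : ℝ) : ℝ≥0∞ := ∑' i : ℕ, ENNReal.ofReal (((2 : ℝ) ^ i) ^ (-p))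

theorem dyadicSum_ne_top {p : ℝ} (hp : 0 < p) : dyadicSum p ≠ ⊤ := by
  have h1 : ∀ i : ℕ, ((2 : ℝ) ^ i) ^ (-p) = (2 ^ (-p)) ^ i := fun i => by
    rw [← Real.rpow_natCast_mul (by norm_num), ← Real.rpow_mul_natCast (by norm_num), mul_comm]
  have h2 : Summable fun i : ℕ => ((2 : ℝ) ^ i) ^ (-p) := by
    simp only [h1]
    exact summable_geometric_of_lt_one (by positivity)
      (Real.rpow_lt_one_of_one_lt_of_neg one_lt_two (by linarith))
  rw [dyadicSum, ← ENNReal.ofReal_tsum_of_nonneg (fun i => by positivity) h2]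
  exact ENNReal.ofReal_ne_top

/-- A geometric series starting at the least power 2^m₀ ≥ a. -/
theorem tsum_dyadic_ge_le {p a : ℝ} (hp : 0 < p) (ha : 0 < a) :
    ∑' m : ℕ, (if a ≤ 2 ^ m then ENNReal.ofReal (((2 : ℝ) ^ m) ^ (-p)) else 0) ≤
      dyadicSum p * ENNReal.ofReal (a ^ (-p)) := by
  obtain ⟨m₀, hm₀, hmin⟩ : ∃ m : ℕ, a ≤ 2 ^ m ∧ ∀ l, a ≤ 2 ^ l → m ≤ l := by
    have hex : ∃ m : ℕ, a ≤ 2 ^ m := (pow_unbounded_of_one_lt a one_lt_two).imp fun _ => le_of_lt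
    classical
    exact ⟨Nat.find hex, Nat.find_spec hex, fun l => Nat.find_min' hex⟩
  rw [← (add_right_injective m₀).tsum_eq, dyadicSum, ← ENNReal.tsum_mul_right]
  · refine ENNReal.tsum_le_tsum fun i => ?_
    split_ifs
    · rw [← ENNReal.ofReal_mul (by positivity), ← Real.mul_rpow (by positivity) ha.le]
      refine ENNReal.ofReal_le_ofReal (Real.rpow_le_rpow_of_nonpos (by positivity) ?_ (by linarith))
      rw [pow_add, mul_comm]
      gcongr
    · exact zero_le
  · intro m hm
    have : a ≤ 2 ^ m := by
      by_contra h
      simp [h] at hm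
    exact ⟨m - m₀, Nat.add_sub_cancel' (hmin m this)⟩

/-- A geometric sum read downwards from its top term, the last power of two below a. -/
theorem tsum_dyadic_lt_le {p a : ℝ} (hp : 0 < p) (ha : 0 < a) :
    ∑' m : ℕ, (if a ≤ 2 ^ m then 0 else ENNReal.ofReal (((2 : ℝ) ^ m) ^ p)) ≤
      dyadicSum p * ENNReal.ofReal (a ^ p) := by
  obtain ⟨m₀, hm₀, hmin⟩ : ∃ m : ℕ, a ≤ 2 ^ m ∧ ∀ l, l < m → 2 ^ l < a := by
    have hex : ∃ m : ℕ, a ≤ 2 ^ m := (pow_unbounded_of_one_lt a one_lt_two).imp fun _ => le_of_lt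
    classical
    exact ⟨Nat.find hex, Nat.find_spec hex, fun l hl => not_le.1 (Nat.find_min hex hl)⟩
  rw [tsum_eq_sum (s := Finset.range m₀), ← Finset.sum_range_reflect]
  · rw [dyadicSum, ← ENNReal.tsum_mul_right]
    refine le_trans (Finset.sum_le_sum fun i hi => ?_) (ENNReal.sum_le_tsum (Finset.range m₀))
    have hi' := Finset.mem_range.1 hi
    split_ifs
    · exact zero_le
    · rw [← ENNReal.ofReal_mul (by positivity)]
      refine ENNReal.ofReal_le_ofReal ?_
      rw [Real.rpow_neg (by positivity), ← Real.inv_rpow (by positivity),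
        ← Real.mul_rpow (by positivity) ha.le]
      refine Real.rpow_le_rpow (by positivity) ?_ hp.le
      rw [← div_eq_inv_mul, le_div_iff₀ (by positivity), ← pow_add]
      refine (hmin _ ?_).le
      omega
  · intro m hm
    have h1 : m₀ ≤ m := by simpa using hm
    have h2 : a ≤ 2 ^ m := hm₀.trans (pow_le_pow_right₀ one_le_two h1)
    rw [if_pos h2]

/-! ### Frequency-weighted L² bounds for finite series, and dyadic interpolation of the order. -/

section

variable {β : ℝ}

theorem memLp_mobiusSeries (hβ : 0 < β) {c : ℤ → ℂ} (hc : absMoment (1 / 2) c ≠ ⊤) :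
    MemLp (mobiusSeries β c) 2 (volume : Measure ℝ) := by
  have hs := summable_norm_of_absMoment (by norm_num) hc
  refine memLp_two_of_lintegral (mobiusSeries_continuous hβ hs).aestronglyMeasurable ?_
  exact ne_top_of_le_ne_top (by finiteness) (lintegral_mobiusSeries_sq_le hβ hs)

theorem absMoment_ne_top_of_finite (p : ℝ) {c : ℤ → ℂ} (hc : c.support.Finite) :
    absMoment p c ≠ ⊤ :=
  absMoment_ne_top (σ := p + 1) (by linarith) (weightedSq_ne_top_of_finite _ hc)

theorem memLp_mobiusSeries_of_finite (hβ : 0 < β) {c : ℤ → ℂ} (hc : c.support.Finite) :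
    MemLp (mobiusSeries β c) 2 (volume : Measure ℝ) :=
  memLp_mobiusSeries hβ (absMoment_ne_top_of_finite _ hc)

theorem lintegral_l2Fourier_mobiusSeries_le (hβ : 0 < β) {c : ℤ → ℂ}
    (hc : absMoment (1 / 2) c ≠ ⊤) :
    ∫⁻ k, ‖l2Fourier (mobiusSeries β c) k‖ₑ ^ 2 ≤
      ENNReal.ofReal (2 * Real.pi * (4 * Real.pi * β)) * absMoment (1 / 2) c ^ 2 := by
  rw [lintegral_l2Fourier_sq (memLp_mobiusSeries hβ hc),
    ENNReal.ofReal_mul (p := 2 * Real.pi) (by positivity),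
    mul_assoc]
  gcongr
  exact lintegral_mobiusSeries_sq_le hβ (summable_norm_of_absMoment (by norm_num) hc)

theorem l2Fourier_derivCoef (hβ : 0 < β) {c : ℤ → ℂ} (hc : c.support.Finite) :
    ∀ᵐ k : ℝ, ‖l2Fourier (mobiusSeries β (derivCoef β c)) k‖ₑ ^ 2 =
      ‖k‖ₑ ^ 2 * ‖l2Fourier (mobiusSeries β c) k‖ₑ ^ 2 := by
  filter_upwards [l2Fourier_deriv (memLp_mobiusSeries_of_finite hβ hc)
    (memLp_mobiusSeries_of_finite hβ (derivCoef_finite hc))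
    (hasDerivAt_mobiusSeries hβ hc)] with k hk
  rw [hk, enorm_mul, enorm_mul, mul_pow, mul_pow]
  simp [← ofReal_norm]

/-- Powers of |k| are converted into derivatives, that is, into `derivCoef`. The last one is
estimated by Plancherel and the L² bound for the derivative. -/
theorem exists_lintegral_pow_mul_l2Fourier_le (hβ : 0 < β) (j : ℕ) :
    ∃ C : ℝ≥0∞, C ≠ ⊤ ∧ ∀ c : ℤ → ℂ, c.support.Finite →
      ∫⁻ k : ℝ, ‖k‖ₑ ^ (2 * (j + 1)) * ‖l2Fourier (mobiusSeries β c) k‖ₑ ^ 2 ≤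
        C * weightedSq (j + 1) c := by
  induction j with
  | zero =>
    refine ⟨ENNReal.ofReal (2 * Real.pi) * ENNReal.ofReal (4 * Real.pi / β), by finiteness,
      fun c hc => ?_⟩
    have hd := derivCoef_finite (β := β) hc
    have he : ∫⁻ k : ℝ, ‖k‖ₑ ^ (2 * (0 + 1)) * ‖l2Fourier (mobiusSeries β c) k‖ₑ ^ 2 =
        ∫⁻ k, ‖l2Fourier (mobiusSeries β (derivCoef β c)) k‖ₑ ^ 2 := by
      refine lintegral_congr_ae ?_
      filter_upwards [l2Fourier_derivCoef hβ hc] with k hk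
      rw [hk]
    rw [he, lintegral_l2Fourier_sq (memLp_mobiusSeries_of_finite hβ hd), mul_assoc]
    gcongr
    simpa using lintegral_mobiusSeries_derivCoef_sq_le hβ hc
  | succ j ih =>
    obtain ⟨C, hC, h⟩ := ih
    obtain ⟨C', hC', h'⟩ := exists_weightedSq_derivCoef_le β (s := (j : ℝ) + 1) (by positivity)
    refine ⟨C * C', ENNReal.mul_ne_top hC hC', fun c hc => ?_⟩
    have he : ∫⁻ k : ℝ, ‖k‖ₑ ^ (2 * (j + 1 + 1)) * ‖l2Fourier (mobiusSeries β c) k‖ₑ ^ 2 =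
        ∫⁻ k : ℝ, ‖k‖ₑ ^ (2 * (j + 1)) *
          ‖l2Fourier (mobiusSeries β (derivCoef β c)) k‖ₑ ^ 2 := by
      refine lintegral_congr_ae ?_
      filter_upwards [l2Fourier_derivCoef hβ hc] with k hk
      rw [hk]
      ring
    rw [he, mul_assoc]
    refine (h _ (derivCoef_finite hc)).trans ?_
    gcongr
    push_cast
    exact h' c

theorem setLIntegral_le_of_le_abs {A : Set ℝ} {N : ℝ} (hN : 0 < N) (hA : MeasurableSet A)
    (h : ∀ k ∈ A, N ≤ |k|) (u : ℝ → ℂ) (q : ℕ) :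
    ∫⁻ k in A, ‖u k‖ₑ ^ 2 ≤
      ENNReal.ofReal (N ^ (-(2 * (q : ℝ)))) * ∫⁻ k : ℝ, ‖k‖ₑ ^ (2 * q) * ‖u k‖ₑ ^ 2 := by
  rw [← lintegral_const_mul' _ _ ENNReal.ofReal_ne_top]
  refine le_trans (setLIntegral_mono' hA fun k hk => ?_) (setLIntegral_le_lintegral A _)
  rw [← mul_assoc]
  refine le_mul_of_one_le_left zero_le ?_
  rw [← ofReal_norm, ← ENNReal.ofReal_pow (norm_nonneg _), ← ENNReal.ofReal_mul (by positivity),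
    ← ENNReal.ofReal_one]
  refine ENNReal.ofReal_le_ofReal ?_
  rw [Real.rpow_neg hN.le, ← div_eq_inv_mul, one_le_div (by positivity), Real.norm_eq_abs]
  have : N ^ (2 * (q : ℝ)) = N ^ (2 * q) := by
    rw [← Real.rpow_natCast]
    push_cast
    rfl
  rw [this]
  exact pow_le_pow_left₀ hN.le (h k hk) _

/-- The part of a sequence on the indices with `1 + |k| ≤ N`. -/
noncomputable def lowPart (N : ℝ) (c : ℤ → ℂ) (k : ℤ) : ℂ := if 1 + |(k : ℝ)| ≤ N then c k else 0

/-- The part of a sequence on the indices with `1 + |k| > N`. -/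
noncomputable def highPart (N : ℝ) (c : ℤ → ℂ) (k : ℤ) : ℂ := if 1 + |(k : ℝ)| ≤ N then 0 else c k

theorem lowPart_add_highPart (N : ℝ) (c : ℤ → ℂ) : lowPart N c + highPart N c = c := by
  funext k
  by_cases h : 1 + |(k : ℝ)| ≤ N <;> simp [lowPart, highPart, h]

theorem lowPart_finite (N : ℝ) {c : ℤ → ℂ} (hc : c.support.Finite) :
    (lowPart N c).support.Finite :=
  hc.subset fun k hk h => hk (by simp [lowPart, h])

theorem highPart_finite (N : ℝ) {c : ℤ → ℂ} (hc : c.support.Finite) :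
    (highPart N c).support.Finite :=
  hc.subset fun k hk h => hk (by simp [highPart, h])

/-- After exchanging the sums, only scales 2^m ≥ 1 + |k| see the index k. Their geometric series
supplies (1+|k|)^(-2(σ-t)), which lowers the order from σ to t. -/
theorem tsum_lowPart_le {σ t : ℝ} (h : t < σ) (c : ℤ → ℂ) :
    ∑' m : ℕ, ENNReal.ofReal (((2 : ℝ) ^ m) ^ (-(2 * σ - 2 * t))) *
        weightedSq σ (lowPart (2 ^ m) c) ≤ dyadicSum (2 * σ - 2 * t) * weightedSq t c := by
  simp only [weightedSq, ← ENNReal.tsum_mul_left]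
  rw [ENNReal.tsum_comm]
  refine ENNReal.tsum_le_tsum fun k => ?_
  have hk := one_add_abs_pos k
  calc ∑' m : ℕ, ENNReal.ofReal (((2 : ℝ) ^ m) ^ (-(2 * σ - 2 * t))) *
        (ENNReal.ofReal ((1 + |(k : ℝ)|) ^ (2 * σ)) * ‖lowPart (2 ^ m) c k‖ₑ ^ 2)
      = ∑' m : ℕ, (if 1 + |(k : ℝ)| ≤ 2 ^ m then
          ENNReal.ofReal (((2 : ℝ) ^ m) ^ (-(2 * σ - 2 * t))) else 0) *
          (ENNReal.ofReal ((1 + |(k : ℝ)|) ^ (2 * σ)) * ‖c k‖ₑ ^ 2) := by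
        refine tsum_congr fun m => ?_
        by_cases hm : 1 + |(k : ℝ)| ≤ 2 ^ m <;> simp [lowPart, hm]
    _ ≤ (dyadicSum (2 * σ - 2 * t) * ENNReal.ofReal ((1 + |(k : ℝ)|) ^ (-(2 * σ - 2 * t)))) *
          (ENNReal.ofReal ((1 + |(k : ℝ)|) ^ (2 * σ)) * ‖c k‖ₑ ^ 2) := by
        rw [ENNReal.tsum_mul_right]
        gcongr
        exact tsum_dyadic_ge_le (by linarith) hk
    _ = dyadicSum (2 * σ - 2 * t) * ((ENNReal.ofReal ((1 + |(k : ℝ)|) ^ (-(2 * σ - 2 * t))) *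
          ENNReal.ofReal ((1 + |(k : ℝ)|) ^ (2 * σ))) * ‖c k‖ₑ ^ 2) := by ring
    _ = _ := by
        rw [← ofReal_rpow_add hk]
        congr 4
        ring_nf

/-- The complementary case: only scales 2^m < 1 + |k| contribute, and they raise the order from σ to
t. -/
theorem tsum_highPart_le {σ t : ℝ} (h : σ < t) (c : ℤ → ℂ) :
    ∑' m : ℕ, ENNReal.ofReal (((2 : ℝ) ^ m) ^ (2 * t - 2 * σ)) *
        weightedSq σ (highPart (2 ^ m) c) ≤ dyadicSum (2 * t - 2 * σ) * weightedSq t c := by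
  simp only [weightedSq, ← ENNReal.tsum_mul_left]
  rw [ENNReal.tsum_comm]
  refine ENNReal.tsum_le_tsum fun k => ?_
  have hk := one_add_abs_pos k
  calc ∑' m : ℕ, ENNReal.ofReal (((2 : ℝ) ^ m) ^ (2 * t - 2 * σ)) *
        (ENNReal.ofReal ((1 + |(k : ℝ)|) ^ (2 * σ)) * ‖highPart (2 ^ m) c k‖ₑ ^ 2)
      = ∑' m : ℕ, (if 1 + |(k : ℝ)| ≤ 2 ^ m then 0 else
          ENNReal.ofReal (((2 : ℝ) ^ m) ^ (2 * t - 2 * σ))) *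
          (ENNReal.ofReal ((1 + |(k : ℝ)|) ^ (2 * σ)) * ‖c k‖ₑ ^ 2) := by
        refine tsum_congr fun m => ?_
        by_cases hm : 1 + |(k : ℝ)| ≤ 2 ^ m <;> simp [highPart, hm]
    _ ≤ (dyadicSum (2 * t - 2 * σ) * ENNReal.ofReal ((1 + |(k : ℝ)|) ^ (2 * t - 2 * σ))) *
          (ENNReal.ofReal ((1 + |(k : ℝ)|) ^ (2 * σ)) * ‖c k‖ₑ ^ 2) := by
        rw [ENNReal.tsum_mul_right]
        gcongr
        exact tsum_dyadic_lt_le (by linarith) hk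
    _ = dyadicSum (2 * t - 2 * σ) * ((ENNReal.ofReal ((1 + |(k : ℝ)|) ^ (2 * t - 2 * σ)) *
          ENNReal.ofReal ((1 + |(k : ℝ)|) ^ (2 * σ))) * ‖c k‖ₑ ^ 2) := by ring
    _ = _ := by
        rw [← ofReal_rpow_add hk]
        congr 4
        ring_nf

theorem l2Fourier_mobiusSeries_add (hβ : 0 < β) {c d : ℤ → ℂ} (hc : absMoment (1 / 2) c ≠ ⊤)
    (hd : absMoment (1 / 2) d ≠ ⊤) :
    ∀ᵐ k : ℝ, l2Fourier (mobiusSeries β (c + d)) k =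
      l2Fourier (mobiusSeries β c) k + l2Fourier (mobiusSeries β d) k := by
  have he : mobiusSeries β (c + d) = fun x => mobiusSeries β c x + mobiusSeries β d x :=
    funext fun x => mobiusSeries_add hβ (summable_norm_of_absMoment (by norm_num) hc)
      (summable_norm_of_absMoment (by norm_num) hd) x
  rw [he]
  exact l2Fourier_add (memLp_mobiusSeries hβ hc) (memLp_mobiusSeries hβ hd)

/-- The dyadic annulus `2^m ≤ |k| < 2^{m+1}`. -/
def dyadicAnnulus (m : ℕ) : Set ℝ := {k | 2 ^ m ≤ |k| ∧ |k| < 2 ^ (m + 1)}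

theorem measurableSet_dyadicAnnulus (m : ℕ) : MeasurableSet (dyadicAnnulus m) :=
  (measurableSet_le measurable_const (measurable_id.abs)).inter
    (measurableSet_lt (measurable_id.abs) measurable_const)

theorem exists_mem_dyadicAnnulus {k : ℝ} (hk : 1 ≤ |k|) : ∃ m, k ∈ dyadicAnnulus m := by
  obtain ⟨m, hm⟩ := exists_nat_pow_near hk one_lt_two
  exact ⟨m, hm⟩

/-- Real interpolation on the annulus |k| ~ 2^m: coefficients with index up to 2^m are measured at
the high order j + 1, where they gain from the decay in frequency, and the others at order 1. -/
theorem exists_setLIntegral_dyadicAnnulus_le (hβ : 0 < β) (j : ℕ) :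
    ∃ C : ℝ≥0∞, C ≠ ⊤ ∧ ∀ (t : ℝ) (c : ℤ → ℂ), 0 ≤ t → c.support.Finite → ∀ m : ℕ,
      ∫⁻ k in dyadicAnnulus m, ENNReal.ofReal ((1 + |k|) ^ (2 * t)) *
          ‖l2Fourier (mobiusSeries β c) k‖ₑ ^ 2 ≤ ENNReal.ofReal (4 ^ (2 * t)) * C *
        (ENNReal.ofReal (((2 : ℝ) ^ m) ^ (-(2 * ((j : ℝ) + 1) - 2 * t))) *
            weightedSq (j + 1) (lowPart (2 ^ m) c) +
          ENNReal.ofReal (((2 : ℝ) ^ m) ^ (2 * t - 2 * 1)) *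
            weightedSq 1 (highPart (2 ^ m) c)) := by
  obtain ⟨C₁, hC₁, h₁⟩ := exists_lintegral_pow_mul_l2Fourier_le hβ j
  obtain ⟨C₂, hC₂, h₂⟩ := exists_lintegral_pow_mul_l2Fourier_le hβ 0
  refine ⟨2 * (C₁ + C₂), by finiteness, fun t c ht hc m => ?_⟩
  set N : ℝ := 2 ^ m with hN
  have hN0 : 0 < N := by positivity
  have hN1 : 1 ≤ N := one_le_pow₀ one_le_two
  have hA := measurableSet_dyadicAnnulus m
  have hAN : ∀ k ∈ dyadicAnnulus m, N ≤ |k| := fun k hk => hk.1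
  have hl := lowPart_finite N hc
  have hh := highPart_finite N hc
  set u := l2Fourier (mobiusSeries β c)
  set ul := l2Fourier (mobiusSeries β (lowPart N c))
  set uh := l2Fourier (mobiusSeries β (highPart N c))
  have hadd := l2Fourier_mobiusSeries_add hβ (absMoment_ne_top_of_finite _ hl)
    (absMoment_ne_top_of_finite _ hh)
  rw [lowPart_add_highPart] at hadd
  have hlow : ∫⁻ k in dyadicAnnulus m, ‖ul k‖ₑ ^ 2 ≤
      ENNReal.ofReal (N ^ (-(2 * ((j : ℝ) + 1)))) * (C₁ * weightedSq (j + 1) (lowPart N c)) := by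
    have := setLIntegral_le_of_le_abs hN0 hA hAN ul (j + 1)
    push_cast at this
    refine this.trans ?_
    gcongr
    exact h₁ _ hl
  have hhigh : ∫⁻ k in dyadicAnnulus m, ‖uh k‖ₑ ^ 2 ≤
      ENNReal.ofReal (N ^ (-(2 * (1 : ℝ)))) * (C₂ * weightedSq 1 (highPart N c)) := by
    have := setLIntegral_le_of_le_abs hN0 hA hAN uh 1
    push_cast at this
    refine this.trans ?_
    gcongr
    simpa using h₂ _ hh
  have hsplit : ∫⁻ k in dyadicAnnulus m, ‖u k‖ₑ ^ 2 ≤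
      2 * ((∫⁻ k in dyadicAnnulus m, ‖ul k‖ₑ ^ 2) + ∫⁻ k in dyadicAnnulus m, ‖uh k‖ₑ ^ 2) := by
    rw [← lintegral_add_left
      ((l2Fourier_measurable (memLp_mobiusSeries_of_finite hβ hl)).enorm.pow_const 2),
      ← lintegral_const_mul' _ _ (by finiteness)]
    refine lintegral_mono_ae (ae_restrict_of_ae ?_)
    filter_upwards [hadd] with k hk
    rw [show u k = ul k + uh k from hk]
    exact enorm_add_sq_le _ _
  have hweight : ∫⁻ k in dyadicAnnulus m, ENNReal.ofReal ((1 + |k|) ^ (2 * t)) * ‖u k‖ₑ ^ 2 ≤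
      ENNReal.ofReal (4 ^ (2 * t)) * ENNReal.ofReal (N ^ (2 * t)) *
        ∫⁻ k in dyadicAnnulus m, ‖u k‖ₑ ^ 2 := by
    rw [← lintegral_const_mul' _ _ (by finiteness)]
    refine setLIntegral_mono' hA fun k hk => ?_
    gcongr
    rw [← ENNReal.ofReal_mul (by positivity), ← Real.mul_rpow (by norm_num) hN0.le]
    refine ENNReal.ofReal_le_ofReal (Real.rpow_le_rpow (by positivity) ?_ (by linarith))
    have := hk.2
    rw [pow_succ, ← hN] at this
    linarith
  have e1 : N ^ (-(2 * ((j : ℝ) + 1) - 2 * t)) = N ^ (2 * t) * N ^ (-(2 * ((j : ℝ) + 1))) := by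
    rw [← Real.rpow_add hN0]
    ring_nf
  have e2 : N ^ (2 * t - 2 * 1) = N ^ (2 * t) * N ^ (-(2 * (1 : ℝ))) := by
    rw [← Real.rpow_add hN0]
    ring_nf
  rw [e1, e2, ENNReal.ofReal_mul (by positivity), ENNReal.ofReal_mul (by positivity)]
  set a := ENNReal.ofReal (N ^ (2 * t))
  set b₁ := ENNReal.ofReal (N ^ (-(2 * ((j : ℝ) + 1))))
  set b₂ := ENNReal.ofReal (N ^ (-(2 * (1 : ℝ))))
  set W₁ := weightedSq (j + 1) (lowPart N c)
  set W₂ := weightedSq 1 (highPart N c)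
  calc _ ≤ ENNReal.ofReal (4 ^ (2 * t)) * a *
        (2 * (b₁ * (C₁ * W₁) + b₂ * (C₂ * W₂))) := by
        refine hweight.trans ?_
        gcongr
        refine hsplit.trans ?_
        gcongr
    _ ≤ ENNReal.ofReal (4 ^ (2 * t)) * a *
        (2 * (b₁ * ((C₁ + C₂) * W₁) + b₂ * ((C₁ + C₂) * W₂))) := by
        gcongr
        · exact le_self_add
        · exact le_add_self
    _ = _ := by ring

theorem exists_setLIntegral_one_le_abs_le (hβ : 0 < β) {t : ℝ} (ht : 1 < t) :
    ∃ C : ℝ≥0∞, C ≠ ⊤ ∧ ∀ c : ℤ → ℂ, c.support.Finite →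
      ∫⁻ k in {k : ℝ | 1 ≤ |k|}, ENNReal.ofReal ((1 + |k|) ^ (2 * t)) *
          ‖l2Fourier (mobiusSeries β c) k‖ₑ ^ 2 ≤ C * weightedSq t c := by
  -- Any integer order above t will do: with 1 < t < j + 1 the low and high dyadic series both
  -- converge.
  obtain ⟨j, hj⟩ := exists_nat_gt t
  obtain ⟨C, hC, h⟩ := exists_setLIntegral_dyadicAnnulus_le hβ j
  have h1 := dyadicSum_ne_top (p := 2 * ((j : ℝ) + 1) - 2 * t) (by linarith)
  have h2 := dyadicSum_ne_top (p := 2 * t - 2 * 1) (by linarith)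
  refine ⟨ENNReal.ofReal (4 ^ (2 * t)) * C *
    (dyadicSum (2 * ((j : ℝ) + 1) - 2 * t) + dyadicSum (2 * t - 2 * 1)), by finiteness,
    fun c hc => ?_⟩
  have hsub : {k : ℝ | 1 ≤ |k|} ⊆ ⋃ m, dyadicAnnulus m := fun k hk =>
    Set.mem_iUnion.2 (exists_mem_dyadicAnnulus hk)
  refine (lintegral_mono_set hsub).trans ((lintegral_iUnion_le _ _).trans ?_)
  refine (ENNReal.tsum_le_tsum fun m => h t c (by linarith) hc m).trans ?_
  rw [ENNReal.tsum_mul_left, ENNReal.tsum_add, mul_assoc, mul_assoc (_ * _), add_mul]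
  rw [mul_assoc]
  gcongr
  · exact tsum_lowPart_le (by linarith) c
  · exact tsum_highPart_le ht c

end

/-! ### Bounds in H^t(ℝ) and their extension to infinite series. -/

section

variable {β : ℝ}

theorem sobolevNormR_sq (t : ℝ) (h : ℝ → ℂ) :
    sobolevNormR t h ^ 2 =
      ∫⁻ k : ℝ, ENNReal.ofReal ((1 + |k|) ^ (2 * t)) * ‖l2Fourier h k‖ₑ ^ 2 := by
  rw [sobolevNormR, eLpNorm_two_sq]
  refine lintegral_congr fun k => ?_
  have hk : 0 ≤ 1 + |k| := by positivity
  rw [enorm_mul, mul_pow, ← ofReal_norm (((1 + |k|) ^ t : ℝ) : ℂ), Complex.norm_real,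
    Real.norm_of_nonneg (by positivity), ofReal_rpow_sq hk]

/-- For t ≤ 1 the weight is at most 2(1 + |k|²), so the L² bound and a single derivative suffice.
The constant is the same for all such t, which keeps the coefficient of n^(1+ε-s) independent of t.
-/
theorem exists_sobolevNormR_sq_le_of_finite_of_le_one (hβ : 0 < β) :
    ∃ C : ℝ≥0∞, C ≠ ⊤ ∧ ∀ t : ℝ, t ≤ 1 → ∀ c : ℤ → ℂ, c.support.Finite →
      sobolevNormR t (mobiusSeries β c) ^ 2 ≤ C * (absMoment (1 / 2) c ^ 2 + weightedSq 1 c) := by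
  obtain ⟨C, hC, h⟩ := exists_lintegral_pow_mul_l2Fourier_le hβ 0
  set K := ENNReal.ofReal (2 * Real.pi * (4 * Real.pi * β))
  refine ⟨2 * (K + C), by finiteness, fun t ht c hc => ?_⟩
  have h0 := lintegral_l2Fourier_mobiusSeries_le hβ (absMoment_ne_top_of_finite (1 / 2) hc)
  have h1 := h c hc
  have hm := (l2Fourier_measurable (memLp_mobiusSeries_of_finite hβ hc)).enorm.pow_const 2
  rw [sobolevNormR_sq]
  calc _ ≤ ∫⁻ k : ℝ, 2 * (‖l2Fourier (mobiusSeries β c) k‖ₑ ^ 2 +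
        ‖k‖ₑ ^ (2 * (0 + 1)) * ‖l2Fourier (mobiusSeries β c) k‖ₑ ^ 2) := by
        refine lintegral_mono fun k => ?_
        rw [← one_add_mul, ← mul_assoc]
        gcongr
        rw [← ofReal_norm, ← ENNReal.ofReal_pow (norm_nonneg _), ← ENNReal.ofReal_one,
          ← ENNReal.ofReal_add (by norm_num) (by positivity), ← ENNReal.ofReal_ofNat 2,
          ← ENNReal.ofReal_mul (by norm_num), Real.norm_eq_abs]
        refine ENNReal.ofReal_le_ofReal ?_
        have hk := abs_nonneg k
        calc (1 + |k|) ^ (2 * t) ≤ (1 + |k|) ^ (2 : ℝ) :=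
              Real.rpow_le_rpow_of_exponent_le (by linarith) (by linarith)
          _ = (1 + |k|) ^ 2 := Real.rpow_two _
          _ ≤ 2 * (1 + |k| ^ 2) := by nlinarith [sq_nonneg (1 - |k|)]
    _ = 2 * ((∫⁻ k, ‖l2Fourier (mobiusSeries β c) k‖ₑ ^ 2) +
        ∫⁻ k : ℝ, ‖k‖ₑ ^ (2 * (0 + 1)) * ‖l2Fourier (mobiusSeries β c) k‖ₑ ^ 2) := by
        rw [lintegral_const_mul' _ _ (by finiteness), lintegral_add_left hm]
    _ ≤ 2 * (K * absMoment (1 / 2) c ^ 2 + C * weightedSq 1 c) := by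
        gcongr
        simpa using h1
    _ ≤ 2 * ((K + C) * absMoment (1 / 2) c ^ 2 + (K + C) * weightedSq 1 c) := by
        gcongr
        · exact le_self_add
        · exact le_add_self
    _ = _ := by ring

/-- For |k| < 1 the weight is at most 2^(2t) and the L² bound applies; the rest is the dyadic
estimate. The constant of the moment is left explicit so that it can later be bounded uniformly over
t ≤ s. -/
theorem exists_sobolevNormR_sq_le_of_finite (hβ : 0 < β) {t : ℝ} (ht : 1 < t) :
    ∃ C : ℝ≥0∞, C ≠ ⊤ ∧ ∀ c : ℤ → ℂ, c.support.Finite →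
      sobolevNormR t (mobiusSeries β c) ^ 2 ≤ ENNReal.ofReal (2 ^ (2 * t)) *
          ENNReal.ofReal (2 * Real.pi * (4 * Real.pi * β)) * absMoment (1 / 2) c ^ 2 +
        C * weightedSq t c := by
  obtain ⟨C, hC, h⟩ := exists_setLIntegral_one_le_abs_le hβ ht
  refine ⟨C, hC, fun c hc => ?_⟩
  have hA : MeasurableSet {k : ℝ | 1 ≤ |k|} := measurableSet_le measurable_const measurable_id.abs
  rw [sobolevNormR_sq, ← lintegral_add_compl _ hA, add_comm]
  refine add_le_add ?_ (h c hc)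
  rw [mul_assoc]
  refine le_trans ?_ (mul_le_mul_right (lintegral_l2Fourier_mobiusSeries_le hβ
    (absMoment_ne_top_of_finite (1 / 2) hc)) _)
  rw [← lintegral_const_mul' _ _ (by finiteness)]
  refine le_trans (setLIntegral_mono' hA.compl fun k hk => ?_) (setLIntegral_le_lintegral _ _)
  gcongr
  have : |k| < 1 := not_le.1 hk
  linarith

theorem tendsto_l2Fourier_truncate (hβ : 0 < β) {c : ℤ → ℂ} (hc : absMoment (1 / 2) c ≠ ⊤) :
    Tendsto (fun S : Finset ℤ => eLpNorm (fun k => l2Fourier (mobiusSeries β (truncate S c)) k -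
      l2Fourier (mobiusSeries β c) k) 2 volume) atTop (𝓝 0) := by
  set K := ENNReal.ofReal (2 * Real.pi * (4 * Real.pi * β)) with hK
  have hlim : Tendsto (fun S : Finset ℤ => (K * absMoment (1 / 2) (c - truncate S c) ^ 2) ^
      (1 / 2 : ℝ)) atTop (𝓝 0) := by
    have h1 := ENNReal.Tendsto.const_mul (a := K) (ENNReal.Tendsto.pow (n := 2)
      (tendsto_absMoment_sub_truncate hc)) (Or.inr (by finiteness))
    have h2 := h1.ennrpow_const (1 / 2)
    simpa using h2
  refine tendsto_of_tendsto_of_tendsto_of_le_of_le tendsto_const_nhds hlim (fun _ => zero_le)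
    fun S => ?_
  have hS := absMoment_ne_top_of_finite (1 / 2) (truncate_finite S c)
  have hd : absMoment (1 / 2) (c - truncate S c) ≠ ⊤ :=
    ne_top_of_le_ne_top hc (absMoment_mono (enorm_sub_truncate_le S c))
  have hadd := l2Fourier_mobiusSeries_add hβ hS hd
  rw [add_sub_cancel] at hadd
  have hsq : eLpNorm (fun k => l2Fourier (mobiusSeries β (truncate S c)) k -
      l2Fourier (mobiusSeries β c) k) 2 volume ^ 2 ≤
        K * absMoment (1 / 2) (c - truncate S c) ^ 2 := by
    rw [eLpNorm_two_sq]
    refine le_trans (le_of_eq (lintegral_congr_ae ?_)) (lintegral_l2Fourier_mobiusSeries_le hβ hd)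
    filter_upwards [hadd] with k hk
    rw [hk, sub_add_cancel_left, enorm_neg]
  have := ENNReal.rpow_le_rpow hsq (by norm_num : (0 : ℝ) ≤ 1 / 2)
  rw [← ENNReal.rpow_natCast_mul] at this
  simpa using this

/-- The transforms of the truncations converge in L², hence almost everywhere along a sequence, and
Fatou's lemma preserves the bound. No prior finiteness of the weighted norm is needed. -/
theorem sobolevNormR_sq_le_of_truncate (hβ : 0 < β) {c : ℤ → ℂ} (hc : absMoment (1 / 2) c ≠ ⊤)
    {t : ℝ} {K : ℝ≥0∞}
    (h : ∀ S : Finset ℤ, sobolevNormR t (mobiusSeries β (truncate S c)) ^ 2 ≤ K) :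
    sobolevNormR t (mobiusSeries β c) ^ 2 ≤ K := by
  have hmS : ∀ S : Finset ℤ, Measurable (l2Fourier (mobiusSeries β (truncate S c))) := fun S =>
    l2Fourier_measurable (memLp_mobiusSeries_of_finite hβ (truncate_finite S c))
  have hmeas : TendstoInMeasure volume
      (fun S : Finset ℤ => l2Fourier (mobiusSeries β (truncate S c))) atTop
      (l2Fourier (mobiusSeries β c)) :=
    tendstoInMeasure_of_tendsto_eLpNorm two_ne_zero
      (fun S => (hmS S).aestronglyMeasurable)
      (l2Fourier_measurable (memLp_mobiusSeries hβ hc)).aestronglyMeasurable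
      (tendsto_l2Fourier_truncate hβ hc)
  obtain ⟨S, -, hS⟩ := hmeas.exists_seq_tendsto_ae'
  rw [sobolevNormR_sq]
  calc _ ≤ ∫⁻ k : ℝ, liminf (fun n => ENNReal.ofReal ((1 + |k|) ^ (2 * t)) *
        ‖l2Fourier (mobiusSeries β (truncate (S n) c)) k‖ₑ ^ 2) atTop := by
        refine lintegral_mono_ae ?_
        filter_upwards [hS] with k hk
        have hlim := ENNReal.Tendsto.const_mul (a := ENNReal.ofReal ((1 + |k|) ^ (2 * t)))
          (ENNReal.Tendsto.pow (n := 2) (Tendsto.enorm hk)) (Or.inr (by finiteness))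
        exact hlim.liminf_eq.ge
    _ ≤ liminf (fun n => ∫⁻ k : ℝ, ENNReal.ofReal ((1 + |k|) ^ (2 * t)) *
        ‖l2Fourier (mobiusSeries β (truncate (S n) c)) k‖ₑ ^ 2) atTop := by
        refine lintegral_liminf_le fun n => ?_
        exact (by fun_prop : Measurable fun k : ℝ => ENNReal.ofReal ((1 + |k|) ^ (2 * t))).mul
          ((hmS (S n)).enorm.pow_const 2)
    _ ≤ K := by
        refine liminf_le_of_frequently_le' (Frequently.of_forall fun n => ?_)
        rw [← sobolevNormR_sq]
        exact h (S n)

theorem exists_sobolevNormR_sq_le_of_le_one (hβ : 0 < β) :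
    ∃ C : ℝ≥0∞, C ≠ ⊤ ∧ ∀ t : ℝ, t ≤ 1 → ∀ c : ℤ → ℂ, absMoment (1 / 2) c ≠ ⊤ →
      sobolevNormR t (mobiusSeries β c) ^ 2 ≤ C * (absMoment (1 / 2) c ^ 2 + weightedSq 1 c) := by
  obtain ⟨C, hC, h⟩ := exists_sobolevNormR_sq_le_of_finite_of_le_one hβ
  refine ⟨C, hC, fun t ht c hc => sobolevNormR_sq_le_of_truncate hβ hc fun S =>
    (h t ht _ (truncate_finite S c)).trans ?_⟩
  gcongr
  · exact absMoment_mono (enorm_truncate_le S c)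
  · exact weightedSq_mono (enorm_truncate_le S c)

theorem exists_sobolevNormR_sq_le (hβ : 0 < β) {t : ℝ} (ht : 1 < t) :
    ∃ C : ℝ≥0∞, C ≠ ⊤ ∧ ∀ c : ℤ → ℂ, absMoment (1 / 2) c ≠ ⊤ →
      sobolevNormR t (mobiusSeries β c) ^ 2 ≤ ENNReal.ofReal (2 ^ (2 * t)) *
          ENNReal.ofReal (2 * Real.pi * (4 * Real.pi * β)) * absMoment (1 / 2) c ^ 2 +
        C * weightedSq t c := by
  obtain ⟨C, hC, h⟩ := exists_sobolevNormR_sq_le_of_finite hβ ht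
  refine ⟨C, hC, fun c hc => sobolevNormR_sq_le_of_truncate hβ hc fun S =>
    (h _ (truncate_finite S c)).trans ?_⟩
  gcongr
  · exact absMoment_mono (enorm_truncate_le S c)
  · exact weightedSq_mono (enorm_truncate_le S c)

end

/-! ### The pullback to the circle and its Fourier series -/

section

variable {β : ℝ}

theorem pullback_periodic (β : ℝ) (f : ℝ → ℂ) :
    Function.Periodic (pullback β f) (2 * Real.pi) := fun θ => by
  have h : Complex.exp (Complex.I * ((θ + 2 * Real.pi : ℝ) : ℂ)) = Complex.exp (Complex.I * θ) := by
    have := Complex.exp_periodic (Complex.I * θ)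
    rw [← this]
    congr 1
    push_cast
    ring
  simp only [pullback, changeVar, h]

theorem pullback_zero (β : ℝ) (f : ℝ → ℂ) : pullback β f 0 = 0 := by
  simp [pullback]

theorem abs_changeVar (hβ : 0 < β) (θ : ℝ) :
    |changeVar β θ| = β * ‖Complex.exp (Complex.I * θ) + 1‖ *
      ‖Complex.exp (Complex.I * θ) - 1‖⁻¹ := by
  rw [← Real.norm_eq_abs, ← Complex.norm_real, changeVar_eq, mobiusInv, norm_mul, norm_div,
    norm_div, Complex.norm_I, Complex.norm_real, Real.norm_of_nonneg hβ.le]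
  ring

theorem tendsto_changeVar_cocompact (hβ : 0 < β) {θ₀ : ℝ}
    (h0 : Complex.exp (Complex.I * θ₀) = 1) :
    Tendsto (changeVar β) (𝓝 θ₀ ⊓ 𝓟 {θ | ¬ Complex.exp (Complex.I * θ) = 1}) (cocompact ℝ) := by
  have hc : Tendsto (fun θ : ℝ => Complex.exp (Complex.I * θ)) (𝓝 θ₀) (𝓝 1) := by
    rw [← h0]
    exact (by fun_prop : Continuous fun θ : ℝ => Complex.exp (Complex.I * θ)).tendsto θ₀
  have hc' := hc.mono_left (inf_le_left (b := 𝓟 {θ : ℝ | ¬ Complex.exp (Complex.I * θ) = 1}))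
  rw [← Metric.cobounded_eq_cocompact, ← tendsto_norm_atTop_iff_cobounded]
  simp only [Real.norm_eq_abs, abs_changeVar hβ]
  have hnum : Tendsto (fun θ : ℝ => β * ‖Complex.exp (Complex.I * θ) + 1‖)
      (𝓝 θ₀ ⊓ 𝓟 {θ : ℝ | ¬ Complex.exp (Complex.I * θ) = 1}) (𝓝 (β * 2)) := by
    have := ((hc'.add_const 1).norm).const_mul β
    norm_num at this
    exact this
  refine hnum.pos_mul_atTop (by positivity) (tendsto_inv_nhdsGT_zero.comp ?_)
  refine tendsto_nhdsWithin_iff.2 ⟨?_, ?_⟩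
  · have := (hc'.sub_const 1).norm
    simpa using this
  · filter_upwards [mem_inf_of_right (mem_principal_self _)] with θ hθ
    exact norm_pos_iff.2 (sub_ne_zero.2 hθ)

theorem pullback_continuous (hβ : 0 < β) {f : ℝ → ℂ} (hf : Continuous f)
    (hf0 : Tendsto f (cocompact ℝ) (𝓝 0)) : Continuous (pullback β f) := by
  classical
  have he : Continuous fun θ : ℝ => Complex.exp (Complex.I * θ) := by fun_prop
  refine continuous_iff_continuousAt.2 fun θ₀ => ?_
  by_cases h0 : Complex.exp (Complex.I * θ₀) = 1
  · have hval : pullback β f θ₀ = 0 := by rw [pullback, if_pos h0]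
    rw [ContinuousAt, hval]
    unfold pullback
    exact Tendsto.if tendsto_const_nhds (hf0.comp (tendsto_changeVar_cocompact hβ h0))
  · have hev : ∀ᶠ θ : ℝ in 𝓝 θ₀, Complex.exp (Complex.I * θ) ≠ 1 :=
      he.continuousAt.eventually_ne h0
    have hcv : ContinuousAt (changeVar β) θ₀ := by
      refine Complex.continuous_re.continuousAt.comp ?_
      exact continuousAt_const.mul ((he.continuousAt.add continuousAt_const).div
        (he.continuousAt.sub continuousAt_const) (sub_ne_zero.2 h0))
    refine (hf.continuousAt.comp hcv).congr ?_
    filter_upwards [hev] with θ hθ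
    rw [pullback, if_neg hθ]
    rfl

theorem hasSum_fourierCoef {F : ℝ → ℂ} (hF : Continuous F)
    (hp : Function.Periodic F (2 * Real.pi)) (hs : Summable fun k => ‖fourierCoef F k‖) (θ : ℝ) :
    HasSum (fun k : ℤ => fourierCoef F k * Complex.exp (Complex.I * k * θ)) (F θ) := by
  have : Fact (0 < 2 * Real.pi) := ⟨by positivity⟩
  have hlift : Continuous (hp.lift : AddCircle (2 * Real.pi) → ℂ) := by
    refine (QuotientAddGroup.isQuotientMap_mk (N := AddSubgroup.zmultiples (2 * Real.pi))
      ).continuous_iff.2 ?_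
    exact hF
  set G : C(AddCircle (2 * Real.pi), ℂ) := ⟨hp.lift, hlift⟩ with hG
  have hco : ∀ k, fourierCoeff G k = fourierCoef F k := fun k => by
    rw [fourierCoeff_eq_intervalIntegral G k 0, fourierCoef, zero_add]
    have : ∀ x : ℝ, (fourier (-k) (x : AddCircle (2 * Real.pi)) : ℂ) • G (x : AddCircle _) =
        Complex.exp (-(Complex.I * k * x)) * F x := fun x => by
      rw [fourier_coe_apply, smul_eq_mul]
      congr 2
      push_cast
      have : (Real.pi : ℂ) ≠ 0 := by exact_mod_cast Real.pi_ne_zero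
      field_simp
    simp only [this]
    rw [Complex.real_smul]
    push_cast
    rfl
  have hsum : Summable (fourierCoeff G) := by
    refine Summable.of_norm (hs.congr fun k => ?_)
    rw [hco]
  have h := has_pointwise_sum_fourier_series_of_summable hsum (θ : AddCircle (2 * Real.pi))
  refine h.congr_fun fun k => ?_
  rw [hco, fourier_coe_apply, smul_eq_mul]
  congr 2
  push_cast
  have : (Real.pi : ℂ) ≠ 0 := by exact_mod_cast Real.pi_ne_zero
  field_simp

theorem exists_changeVar_eq (hβ : 0 < β) (x : ℝ) :
    ∃ θ : ℝ, Complex.exp (Complex.I * θ) = mobius β x ∧ Complex.exp (Complex.I * θ) ≠ 1 ∧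
      changeVar β θ = x := by
  have he : Complex.exp (Complex.I * (Complex.arg (mobius β x) : ℂ)) = mobius β x := by
    have := Complex.norm_mul_exp_arg_mul_I (mobius β x)
    rw [norm_mobius hβ, Complex.ofReal_one, one_mul, mul_comm] at this
    exact this
  have h1 := add_I_mul_ne_zero hβ x
  have hβ' : (β : ℂ) ≠ 0 := by exact_mod_cast hβ.ne'
  have hI := Complex.I_ne_zero
  have hne : mobius β x ≠ 1 := by
    intro h
    have := one_sub_mobius hβ x
    rw [h, sub_self, eq_comm, div_eq_zero_iff] at this
    rcases this with h | h
    · simp [hβ'] at h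
    · exact h1 h
  refine ⟨_, he, by rwa [he], ?_⟩
  rw [changeVar, he]
  have : mobiusInv β (mobius β x) = x := by
    have e1 : mobius β x - 1 = -(2 * Complex.I * β) / (x + Complex.I * β) := by
      rw [neg_div, ← one_sub_mobius hβ]
      ring
    have e2 : mobius β x + 1 = 2 * x / (x + Complex.I * β) := by
      rw [mobius]
      field_simp
      ring
    rw [mobiusInv, e1, e2, div_div_div_cancel_right₀ h1, div_neg]
    have h3 : (β : ℂ) / Complex.I * -(2 * x / (2 * Complex.I * β)) =
        -(x / (Complex.I * Complex.I)) := by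
      field_simp
    rw [h3, Complex.I_mul_I]
    ring
  rw [this, Complex.ofReal_re]

theorem tsum_fourierCoef_pullback {f : ℝ → ℂ} (hF : Continuous (pullback β f))
    (hs : Summable fun k => ‖fourierCoef (pullback β f) k‖) :
    HasSum (fourierCoef (pullback β f)) 0 := by
  have := hasSum_fourierCoef hF (pullback_periodic β f) hs 0
  simpa [pullback_zero] using this

/-- Evaluate the Fourier series of F at the angle of M(x) and subtract its value 0 at θ = 0, which
produces the terms -1. -/
theorem mobiusSeries_fourierCoef (hβ : 0 < β) {f : ℝ → ℂ} (hF : Continuous (pullback β f))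
    (hs : Summable fun k => ‖fourierCoef (pullback β f) k‖) :
    mobiusSeries β (fourierCoef (pullback β f)) = f := by
  funext x
  obtain ⟨θ, h1, h2, h3⟩ := exists_changeVar_eq hβ x
  have hsum := (hasSum_fourierCoef hF (pullback_periodic β f) hs θ).sub
    (tsum_fourierCoef_pullback hF hs)
  have hval : pullback β f θ = f x := by rw [pullback, if_neg h2, h3]
  rw [hval, sub_zero] at hsum
  rw [mobiusSeries, ← hsum.tsum_eq]
  refine tsum_congr fun k => ?_
  rw [mul_sub, mul_one, ← h1, ← Complex.exp_int_mul]
  congr 3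
  ring

end

/-! ### Aliasing and the interpolation error -/

theorem sum_range_exp_eq {n : ℕ} (hn : 1 ≤ n) (d : ℤ) :
    ∑ l ∈ Finset.range n, Complex.exp (Complex.I * d * ((2 * Real.pi * l / n : ℝ) : ℂ)) =
      if (n : ℤ) ∣ d then (n : ℂ) else 0 := by
  have hn0 : (n : ℂ) ≠ 0 := by
    have : n ≠ 0 := by omega
    exact_mod_cast this
  set ζ : ℂ := Complex.exp (2 * Real.pi * Complex.I * d / n) with hζ
  have hterm : ∀ l : ℕ, Complex.exp (Complex.I * d * ((2 * Real.pi * l / n : ℝ) : ℂ)) = ζ ^ l :=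
    fun l => by
      rw [hζ, ← Complex.exp_nat_mul]
      congr 1
      push_cast
      ring
  simp only [hterm]
  have hone : ζ = 1 ↔ (n : ℤ) ∣ d := by
    rw [hζ, Complex.exp_eq_one_iff]
    have h2 : (2 * Real.pi * Complex.I : ℂ) ≠ 0 := Complex.two_pi_I_ne_zero
    constructor
    · rintro ⟨m, hm⟩
      refine ⟨m, ?_⟩
      have : (d : ℂ) = n * m := by
        rw [div_eq_iff hn0] at hm
        refine mul_left_cancel₀ h2 ?_
        linear_combination hm
      exact_mod_cast this
    · rintro ⟨m, rfl⟩
      refine ⟨m, ?_⟩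
      push_cast
      field_simp
  split_ifs with h
  · rw [hone.2 h]
    simp
  · have hne : ζ ≠ 1 := fun h1 => h (hone.1 h1)
    have hpow : ζ ^ n = 1 := by
      rw [hζ, ← Complex.exp_nat_mul, mul_div_cancel₀ _ hn0, mul_comm]
      exact Complex.exp_int_mul_two_pi_mul_I d
    rw [geom_sum_eq hne, hpow, sub_self, zero_div]

/-- Aliasing: averaging over the nodes annihilates every frequency not congruent to k modulo n. -/
theorem hasSum_discreteCoef {F : ℝ → ℂ} {c : ℤ → ℂ}
    (h : ∀ θ : ℝ, HasSum (fun k : ℤ => c k * Complex.exp (Complex.I * k * θ)) (F θ)) {n : ℕ}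
    (hn : 1 ≤ n) (k : ℤ) :
    HasSum (fun j : ℤ => if (n : ℤ) ∣ j - k then c j else 0) (discreteCoef n F k) := by
  have hn0 : (n : ℂ) ≠ 0 := by
    have : n ≠ 0 := by omega
    exact_mod_cast this
  have h1 := (hasSum_sum (s := Finset.range n) fun l _ => (h (2 * Real.pi * l / n)).mul_left
    (Complex.exp (-(Complex.I * k * ((2 * Real.pi * l / n : ℝ) : ℂ))))).mul_left (1 / (n : ℂ))
  rw [discreteCoef]
  refine h1.congr_fun fun j => ?_
  have h2 : ∀ l : ℕ, Complex.exp (-(Complex.I * k * ((2 * Real.pi * l / n : ℝ) : ℂ))) *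
      (c j * Complex.exp (Complex.I * j * ((2 * Real.pi * l / n : ℝ) : ℂ))) =
      c j * Complex.exp (Complex.I * (j - k : ℤ) * ((2 * Real.pi * l / n : ℝ) : ℂ)) := fun l => by
    rw [mul_left_comm, ← Complex.exp_add]
    congr 2
    push_cast
    ring
  simp only [h2]
  rw [← Finset.mul_sum, sum_range_exp_eq hn]
  split_ifs
  · field_simp
  · simp

theorem mem_modes_iff {n : ℕ} {k : ℤ} :
    k ∈ modes n ↔ -(((n - 1) / 2 : ℕ) : ℤ) ≤ k ∧ k ≤ ((n / 2 : ℕ) : ℤ) := by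
  rw [modes, Finset.mem_Icc]

/-- The modes are n consecutive integers, since n₋ + n₊ + 1 = n for either parity, hence a complete
residue system. -/
theorem existsUnique_modes {n : ℕ} (hn : 1 ≤ n) (j : ℤ) :
    ∃ k ∈ modes n, (n : ℤ) ∣ j - k ∧ ∀ l ∈ modes n, (n : ℤ) ∣ j - l → l = k := by
  have hn0 : (0 : ℤ) < n := by exact_mod_cast hn
  set a : ℤ := (((n - 1) / 2 : ℕ) : ℤ) with ha
  set b : ℤ := ((n / 2 : ℕ) : ℤ) with hb
  have hab : a + b + 1 = n := by
    rw [ha, hb]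
    omega
  have h0 := Int.emod_nonneg (j + a) hn0.ne'
  have h1 := Int.emod_lt_of_pos (j + a) hn0
  have hdvd : (n : ℤ) ∣ j - ((j + a) % n - a) := by
    have := Int.dvd_self_sub_emod (x := j + a) (m := (n : ℤ))
    rwa [show j - ((j + a) % n - a) = j + a - (j + a) % n by ring]
  refine ⟨(j + a) % n - a, mem_modes_iff.2 ⟨by linarith, by linarith⟩, hdvd, fun l hl hlj => ?_⟩
  obtain ⟨hl1, hl2⟩ := mem_modes_iff.1 hl
  have h2 : (n : ℤ) ∣ l - ((j + a) % n - a) := by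
    have := dvd_sub hdvd hlj
    rwa [show j - ((j + a) % n - a) - (j - l) = l - ((j + a) % n - a) by ring] at this
  have h3 : |l - ((j + a) % n - a)| < n := by
    rw [abs_lt]
    constructor <;> linarith
  exact sub_eq_zero.1 (Int.eq_zero_of_abs_lt_dvd h2 h3)

theorem sum_modes_ite {M : Type*} [AddCommMonoid M] {n : ℕ} (hn : 1 ≤ n) (j : ℤ) (a : M) :
    ∑ k ∈ modes n, (if (n : ℤ) ∣ j - k then a else 0) = a := by
  obtain ⟨k, hk, hd, hu⟩ := existsUnique_modes hn j
  rw [Finset.sum_eq_single_of_mem k hk, if_pos hd]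
  intro l hl hlk
  rw [if_neg fun h => hlk (hu l hl h)]

/-- Interpolation at the node θ = 0: each Fourier coefficient is counted in exactly one residue
class, so the total is the Fourier series at 0. -/
theorem sum_discreteCoef {F : ℝ → ℂ} {c : ℤ → ℂ}
    (h : ∀ θ : ℝ, HasSum (fun k : ℤ => c k * Complex.exp (Complex.I * k * θ)) (F θ)) {n : ℕ}
    (hn : 1 ≤ n) : ∑ k ∈ modes n, discreteCoef n F k = F 0 := by
  have h1 := hasSum_sum (s := modes n) fun k _ => hasSum_discreteCoef h hn k
  have h2 := h 0
  simp only [sum_modes_ite hn] at h1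
  simp only [Complex.ofReal_zero, mul_zero, Complex.exp_zero, mul_one] at h2
  exact h1.unique h2

/-- The coefficients of the trigonometric interpolant, extended by zero. -/
noncomputable def interpCoef (n : ℕ) (F : ℝ → ℂ) (k : ℤ) : ℂ :=
  if k ∈ modes n then discreteCoef n F k else 0

theorem interpCoef_finite (n : ℕ) (F : ℝ → ℂ) : (interpCoef n F).support.Finite :=
  (modes n).finite_toSet.subset fun k hk => by
    by_contra h
    exact hk (if_neg h)

theorem two_mul_abs_le_of_mem_modes {n : ℕ} (hn : 1 ≤ n) {k : ℤ} (hk : k ∈ modes n) :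
    2 * |(k : ℝ)| ≤ n := by
  obtain ⟨h1, h2⟩ := mem_modes_iff.1 hk
  have h3 : 2 * |k| ≤ n := by
    rcases abs_cases k with h | h <;> omega
  exact_mod_cast h3

theorem le_two_mul_abs_of_notMem_modes {n : ℕ} {k : ℤ} (hk : k ∉ modes n) :
    (n : ℝ) ≤ 2 * |(k : ℝ)| := by
  rw [mem_modes_iff] at hk
  have h3 : (n : ℤ) ≤ 2 * |k| := by
    rcases abs_cases k with h | h <;> omega
  exact_mod_cast h3

theorem tsum_alias_weight_le {s : ℝ} (hs : 0 ≤ s) {n : ℕ} (hn : 1 ≤ n) {k : ℤ}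
    (hk : k ∈ modes n) :
    ∑' j : ℤ, (if (n : ℤ) ∣ j - k ∧ j ≠ k then ENNReal.ofReal ((1 + |(j : ℝ)|) ^ (-(2 * s)))
      else 0) ≤ ENNReal.ofReal (((n : ℝ) / 4) ^ (-(2 * s))) * latticeZeta (2 * s) := by
  have hn0 : (n : ℤ) ≠ 0 := by omega
  have hnr : (1 : ℝ) ≤ n := by exact_mod_cast hn
  have hinj : Function.Injective fun p : ℤ => k + n * p := fun p q hpq =>
    mul_left_cancel₀ hn0 (add_left_cancel hpq)
  rw [← hinj.tsum_eq, latticeZeta, ← ENNReal.tsum_mul_left]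
  · refine ENNReal.tsum_le_tsum fun p => ?_
    split_ifs with h
    · have hp : p ≠ 0 := by
        rintro rfl
        simp at h
      rw [← ENNReal.ofReal_mul (by positivity), ← Real.mul_rpow (by positivity)
        (one_add_abs_pos p).le]
      refine ENNReal.ofReal_le_ofReal (Real.rpow_le_rpow_of_nonpos
        (mul_pos (by positivity) (one_add_abs_pos p)) ?_ (by linarith))
      -- For p ≠ 0 and 2|k| ≤ n one has |k + np| ≥ n|p| - n/2 ≥ (n/4)(1 + |p|), which explains the
      -- quarter.
      have hp1 : (1 : ℝ) ≤ |(p : ℝ)| := by exact_mod_cast Int.one_le_abs hp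
      have h1 := two_mul_abs_le_of_mem_modes hn hk
      have h2 : (n : ℝ) * |(p : ℝ)| ≤ |((k + n * p : ℤ) : ℝ)| + |(k : ℝ)| := by
        have := abs_sub ((k + n * p : ℤ) : ℝ) (k : ℝ)
        push_cast at this ⊢
        rw [add_sub_cancel_left, abs_mul, Nat.abs_cast] at this
        exact this
      nlinarith
    · exact zero_le
  · intro j hj
    have h : (n : ℤ) ∣ j - k := by
      by_contra h
      simp [h] at hj
    obtain ⟨p, hp⟩ := h
    exact ⟨p, by simp only; linarith⟩

theorem enorm_interpCoef_sub_sq_le {F : ℝ → ℂ} {c : ℤ → ℂ}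
    (h : ∀ θ : ℝ, HasSum (fun k : ℤ => c k * Complex.exp (Complex.I * k * θ)) (F θ)) {s : ℝ}
    (hs : 0 ≤ s) {n : ℕ} (hn : 1 ≤ n) {k : ℤ} (hk : k ∈ modes n) :
    ‖discreteCoef n F k - c k‖ₑ ^ 2 ≤
      ENNReal.ofReal (((n : ℝ) / 4) ^ (-(2 * s))) * latticeZeta (2 * s) *
        ∑' j : ℤ, (if (n : ℤ) ∣ j - k then
          ENNReal.ofReal ((1 + |(j : ℝ)|) ^ (2 * s)) * ‖c j‖ₑ ^ 2 else 0) := by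
  have h1 := hasSum_discreteCoef h hn k
  have h2 : HasSum (fun j : ℤ => if j = k then c k else 0) (c k) := by
    simpa using hasSum_ite_eq k (c k)
  have h3 : HasSum (fun j : ℤ => if (n : ℤ) ∣ j - k ∧ j ≠ k then c j else 0)
      (discreteCoef n F k - c k) := by
    refine (h1.sub h2).congr_fun fun j => ?_
    by_cases hj : j = k
    · subst hj
      simp
    · simp [hj]
  -- The idempotent indicator of the proper aliases is placed in both factors before Cauchy–Schwarz.
  -- In the second factor j = k is readmitted afterwards, so that the sums over the modes add up to
  -- the full norm.
  set ρ : ℤ → ℝ≥0∞ := fun j => if (n : ℤ) ∣ j - k ∧ j ≠ k then 1 else 0 with hρ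
  have hρ2 : ∀ j, ρ j * ρ j = ρ j := fun j => by
    simp only [hρ]
    split_ifs <;> simp
  have hbound : ‖discreteCoef n F k - c k‖ₑ ≤
      ∑' j : ℤ, (ρ j * ENNReal.ofReal ((1 + |(j : ℝ)|) ^ (-s))) *
        (ρ j * (ENNReal.ofReal ((1 + |(j : ℝ)|) ^ s) * ‖c j‖ₑ)) := by
    rw [← h3.tsum_eq]
    refine enorm_tsum_le_tsum_enorm.trans (ENNReal.tsum_le_tsum fun j => ?_)
    rw [mul_mul_mul_comm, hρ2, ← mul_assoc (ENNReal.ofReal _),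
      ← ofReal_rpow_add (one_add_abs_pos j)]
    simp only [hρ]
    split_ifs <;> simp
  calc ‖discreteCoef n F k - c k‖ₑ ^ 2 ≤ _ := pow_le_pow_left' hbound 2
    _ ≤ _ := tsum_mul_sq_le _ _
    _ ≤ _ := by
        refine mul_le_mul' ?_ ?_
        · refine le_trans (le_of_eq (tsum_congr fun j => ?_)) (tsum_alias_weight_le hs hn hk)
          rw [mul_pow, sq (ρ j), hρ2, ofReal_rpow_sq (one_add_abs_pos j).le, mul_neg]
          simp only [hρ]
          split_ifs <;> simp
        · refine ENNReal.tsum_le_tsum fun j => ?_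
          rw [mul_pow, sq (ρ j), hρ2, mul_pow, ofReal_rpow_sq (one_add_abs_pos j).le]
          by_cases hj : (n : ℤ) ∣ j - k
          · rw [if_pos hj]
            refine mul_le_of_le_one_left zero_le ?_
            simp only [hρ]
            split_ifs <;> simp
          · simp [hρ, hj]

/-- On the modes 1 + |k| ≤ 2n, and the squared aliasing errors sum over residue classes to n^(-2s)
times the full norm. Off the modes the error is the Fourier tail, where 1 + |k| ≥ n/2 gives the same
rate. -/
theorem exists_weightedSq_interpCoef_sub_le {σ s : ℝ} (h0 : 0 ≤ σ) (hσ : σ ≤ s) (hs : 1 / 2 < s) :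
    ∃ C : ℝ≥0∞, C ≠ ⊤ ∧ ∀ (F : ℝ → ℂ) (c : ℤ → ℂ),
      (∀ θ : ℝ, HasSum (fun k : ℤ => c k * Complex.exp (Complex.I * k * θ)) (F θ)) →
      ∀ n : ℕ, 1 ≤ n → weightedSq σ (interpCoef n F - c) ≤
        C * ENNReal.ofReal ((n : ℝ) ^ (2 * (σ - s))) * weightedSq s c := by
  have hZ := latticeZeta_ne_top (r := 2 * s) (by linarith)
  refine ⟨ENNReal.ofReal (2 ^ (2 * σ) * (1 / 4 : ℝ) ^ (-(2 * s))) * latticeZeta (2 * s) +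
    ENNReal.ofReal ((1 / 2 : ℝ) ^ (2 * (σ - s))), by finiteness, fun F c h n hn => ?_⟩
  have hn1 : (1 : ℝ) ≤ n := by exact_mod_cast hn
  have hn0 : (0 : ℝ) < n := by linarith
  set a : ℤ → ℝ≥0∞ := fun j => ENNReal.ofReal ((1 + |(j : ℝ)|) ^ (2 * s)) * ‖c j‖ₑ ^ 2 with ha
  set A := ENNReal.ofReal (((2 : ℝ) * n) ^ (2 * σ)) *
    (ENNReal.ofReal (((n : ℝ) / 4) ^ (-(2 * s))) * latticeZeta (2 * s)) with hA
  set B := ENNReal.ofReal (((n : ℝ) / 2) ^ (2 * (σ - s))) with hB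
  have hpt : ∀ k : ℤ, ENNReal.ofReal ((1 + |(k : ℝ)|) ^ (2 * σ)) *
      ‖(interpCoef n F - c) k‖ₑ ^ 2 ≤
      (if k ∈ modes n then A * ∑' j : ℤ, (if (n : ℤ) ∣ j - k then a j else 0) else 0) +
        B * a k := fun k => by
    have hk0 := one_add_abs_pos k
    by_cases hk : k ∈ modes n
    · rw [if_pos hk]
      refine le_trans ?_ le_self_add
      rw [Pi.sub_apply, interpCoef, if_pos hk, hA, mul_assoc]
      refine mul_le_mul' (ENNReal.ofReal_le_ofReal (Real.rpow_le_rpow hk0.le ?_ (by linarith)))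
        (enorm_interpCoef_sub_sq_le h (by linarith) hn hk)
      have := two_mul_abs_le_of_mem_modes hn hk
      linarith
    · rw [if_neg hk, zero_add, Pi.sub_apply, interpCoef, if_neg hk, zero_sub, enorm_neg, ha,
        ← mul_assoc]
      gcongr
      have h1 : 2 * σ = 2 * (σ - s) + 2 * s := by ring
      rw [h1, ofReal_rpow_add hk0]
      gcongr ?_ * _
      refine ENNReal.ofReal_le_ofReal (Real.rpow_le_rpow_of_nonpos (by positivity) ?_
        (by linarith))
      have := le_two_mul_abs_of_notMem_modes hk
      linarith
  calc weightedSq σ (interpCoef n F - c)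
      ≤ ∑' k : ℤ, ((if k ∈ modes n then A * ∑' j : ℤ, (if (n : ℤ) ∣ j - k then a j else 0) else 0)
        + B * a k) := ENNReal.tsum_le_tsum hpt
    _ = A * weightedSq s c + B * weightedSq s c := by
        rw [ENNReal.tsum_add, ENNReal.tsum_mul_left, tsum_eq_sum (s := modes n)
          fun k hk => if_neg hk]
        congr 1
        rw [Finset.sum_congr rfl fun k hk => if_pos hk, ← Finset.mul_sum,
          ← Summable.tsum_finsetSum fun k _ => ENNReal.summable]
        simp only [sum_modes_ite hn]
        rfl
    _ = _ := by
        rw [← add_mul]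
        congr 1
        rw [add_mul, hA, hB, ← mul_assoc]
        congr 1
        · have he : ENNReal.ofReal ((2 * n) ^ (2 * σ)) * ENNReal.ofReal ((n / 4) ^ (-(2 * s))) =
              ENNReal.ofReal (2 ^ (2 * σ) * (1 / 4 : ℝ) ^ (-(2 * s))) *
                ENNReal.ofReal ((n : ℝ) ^ (2 * (σ - s))) := by
            rw [← ENNReal.ofReal_mul (by positivity), ← ENNReal.ofReal_mul (by positivity)]
            congr 1
            rw [div_eq_mul_one_div (n : ℝ) 4, Real.mul_rpow (by norm_num) hn0.le,
              Real.mul_rpow hn0.le (by norm_num), mul_sub, sub_eq_add_neg, Real.rpow_add hn0]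
            ring
          rw [he]
          ring
        · rw [← ENNReal.ofReal_mul (by positivity), ← Real.mul_rpow (by norm_num) hn0.le]
          congr 2
          ring

/-! ### Assembly of the three convergence estimates. -/

section

variable {β : ℝ}

theorem rationalInterp_eq_mobiusSeries {f : ℝ → ℂ} {n : ℕ}
    (h0 : ∑ k ∈ modes n, discreteCoef n (pullback β f) k = 0) :
    rationalInterp β n f = mobiusSeries β (interpCoef n (pullback β f)) := by
  funext x
  rw [rationalInterp, mobiusSeries, tsum_eq_sum (s := modes n) fun k hk => by
    rw [interpCoef, if_neg hk, zero_mul]]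
  rw [← sub_zero (∑ k ∈ modes n, _), ← h0, ← Finset.sum_sub_distrib]
  refine Finset.sum_congr rfl fun k hk => ?_
  rw [interpCoef, if_pos hk, mul_sub, mul_one]

theorem sobolevNormT_nonneg (s : ℝ) (F : ℝ → ℂ) : 0 ≤ sobolevNormT s F := Real.sqrt_nonneg _

theorem weightedSq_fourierCoef {s : ℝ} {F : ℝ → ℂ} (hF : MemSobolevT s F) :
    weightedSq s (fourierCoef F) = ENNReal.ofReal (sobolevNormT s F ^ 2) := by
  have h0 : ∀ k, 0 ≤ sobolevTerm s F k := fun k => by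
    have := one_add_abs_pos k
    rw [sobolevTerm]
    positivity
  rw [sobolevNormT, Real.sq_sqrt (tsum_nonneg h0), ENNReal.ofReal_tsum_of_nonneg h0 hF.2,
    weightedSq]
  refine tsum_congr fun k => ?_
  rw [sobolevTerm, ENNReal.ofReal_mul (Real.rpow_nonneg (one_add_abs_pos k).le _),
    ENNReal.ofReal_pow (norm_nonneg _), ofReal_norm]

/-- The rational interpolation error is a series with square summable coefficients. -/
theorem interpolation_setup (hβ : 0 < β) {s : ℝ} (hs : 1 ≤ s) {f : ℝ → ℂ} (hf : Continuous f)
    (hf0 : Tendsto f (cocompact ℝ) (𝓝 0)) (hF : MemSobolevT s (pullback β f)) :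
    weightedSq s (fourierCoef (pullback β f)) ≠ ⊤ ∧
    (∀ θ : ℝ, HasSum (fun k : ℤ => fourierCoef (pullback β f) k * Complex.exp (Complex.I * k * θ))
      (pullback β f θ)) ∧
    mobiusSeries β (fourierCoef (pullback β f)) = f ∧
    ∀ n : ℕ, 1 ≤ n →
      mobiusSeries β (interpCoef n (pullback β f)) = rationalInterp β n f ∧
      mobiusSeries β (interpCoef n (pullback β f) - fourierCoef (pullback β f)) =
        fun x => rationalInterp β n f x - f x := by
  have hW : weightedSq s (fourierCoef (pullback β f)) ≠ ⊤ := by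
    rw [weightedSq_fourierCoef hF]
    exact ENNReal.ofReal_ne_top
  have hsum := summable_norm_of_weightedSq hs hW
  have hc := pullback_continuous hβ hf hf0
  have hser := hasSum_fourierCoef hc (pullback_periodic β f) hsum
  have hfs := mobiusSeries_fourierCoef hβ hc hsum
  refine ⟨hW, hser, hfs, fun n hn => ?_⟩
  have hR := rationalInterp_eq_mobiusSeries
    ((sum_discreteCoef hser hn).trans (pullback_zero β f))
  refine ⟨hR.symm, funext fun x => ?_⟩
  rw [mobiusSeries_sub hβ (summable_norm_of_finite (interpCoef_finite _ _)) hsum, ← hR, hfs]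

theorem le_ofReal_of_sq_le {x P Q : ℝ≥0∞} {a b : ℝ} (hP : P ≠ ⊤) (hQ : Q ≠ ⊤) (ha : 0 ≤ a)
    (hb : 0 ≤ b) (h : x ^ 2 ≤ P * ENNReal.ofReal (a ^ 2) + Q * ENNReal.ofReal (b ^ 2)) :
    x ≤ ENNReal.ofReal (√P.toReal * a + √Q.toReal * b) := by
  have e : ∀ {P : ℝ≥0∞} {a : ℝ}, P ≠ ⊤ →
      P * ENNReal.ofReal (a ^ 2) = ENNReal.ofReal ((√P.toReal * a) ^ 2) := fun {P a} hP => by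
    rw [mul_pow, Real.sq_sqrt ENNReal.toReal_nonneg, ENNReal.ofReal_mul ENNReal.toReal_nonneg,
      ENNReal.ofReal_toReal hP]
  have hPa : 0 ≤ √P.toReal * a := by positivity
  have hQb : 0 ≤ √Q.toReal * b := by positivity
  rw [e hP, e hQ, ← ENNReal.ofReal_add (by positivity) (by positivity)] at h
  refine (ENNReal.pow_le_pow_left_iff two_ne_zero).1 (h.trans ?_)
  rw [← ENNReal.ofReal_pow (by positivity)]
  refine ENNReal.ofReal_le_ofReal ?_
  nlinarith

theorem norm_le_of_enorm_sq_le {z : ℂ} {P : ℝ≥0∞} {a : ℝ} (hP : P ≠ ⊤) (ha : 0 ≤ a)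
    (h : ‖z‖ₑ ^ 2 ≤ P * ENNReal.ofReal (a ^ 2)) : ‖z‖ ≤ √P.toReal * a := by
  have := le_ofReal_of_sq_le hP (Q := 0) (b := 0) (by simp) ha le_rfl (by simpa using h)
  rw [← ofReal_norm] at this
  simpa using (ENNReal.ofReal_le_ofReal_iff (by positivity)).1 this

theorem rpow_mul_sq {n : ℕ} (hn : 1 ≤ n) (p N : ℝ) :
    ENNReal.ofReal ((n : ℝ) ^ (2 * p)) * ENNReal.ofReal (N ^ 2) =
      ENNReal.ofReal (((n : ℝ) ^ p * N) ^ 2) := by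
  have hn0 : (0 : ℝ) < n := by exact_mod_cast hn
  rw [← ENNReal.ofReal_mul (by positivity), mul_pow, ← Real.rpow_mul_natCast hn0.le]
  congr 3
  push_cast
  ring

theorem uniform_convergence (hβ : 0 < β) {ε s : ℝ} (hε : 0 < ε) (hs : 3 / 2 + ε < s) :
    ∃ C : ℝ, ∀ f : ℝ → ℂ, Continuous f → Tendsto f (cocompact ℝ) (𝓝 0) →
      MemSobolevT s (pullback β f) → ∀ n : ℕ, 1 ≤ n → ∀ k : ℝ, ∃ a b : ℂ,
        HasPVFourier (rationalInterp β n f) k a ∧ HasPVFourier f k b ∧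
        ‖a - b‖ ≤ C * (n : ℝ) ^ (3 / 2 + ε - s) * sobolevNormT s (pullback β f) := by
  obtain ⟨C, hC, h⟩ := exists_hasPVFourier_le_weightedSq hβ hε
  obtain ⟨I, hI, hint⟩ := exists_weightedSq_interpCoef_sub_le (σ := 3 / 2 + ε) (s := s)
    (by linarith) hs.le (by linarith)
  refine ⟨√(C * I).toReal, fun f hf hf0 hF n hn k => ?_⟩
  obtain ⟨hW, hser, hfs, hset⟩ := interpolation_setup hβ (by linarith) hf hf0 hF
  obtain ⟨hR, hdiff⟩ := hset n hn
  have hG := hint _ _ hser n hn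
  rw [weightedSq_fourierCoef hF, mul_assoc, rpow_mul_sq hn] at hG
  obtain ⟨a, ha, -⟩ := h _ (weightedSq_ne_top_of_finite _ (interpCoef_finite n (pullback β f))) k
  obtain ⟨b, hb, -⟩ := h _ (ne_top_of_le_ne_top hW (weightedSq_mono_exponent hs.le _)) k
  obtain ⟨d, hd, hd'⟩ := h _ (ne_top_of_le_ne_top (by finiteness) hG) k
  rw [hR] at ha
  rw [hfs] at hb
  rw [hdiff] at hd
  have hRc : Continuous (rationalInterp β n f) := by
    rw [← hR]
    exact mobiusSeries_continuous_of_finite hβ (interpCoef_finite _ _)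
  -- The estimate concerns the principal value of the error series; uniqueness of limits identifies
  -- it with the difference of the two transforms.
  have hab : a - b = d := (ha.sub hRc hf hb).unique hd
  refine ⟨a, b, ha, hb, ?_⟩
  rw [hab, mul_assoc]
  have hN := sobolevNormT_nonneg s (pullback β f)
  refine norm_le_of_enorm_sq_le (by finiteness) (by positivity) (hd'.trans ?_)
  rw [mul_assoc]
  gcongr

theorem asymptotic_approximation (hβ : 0 < β) {j : ℕ} {s : ℝ} (hj : 0 < j) (hs : (j : ℝ) ≤ s) :
    ∃ C : ℝ, ∀ f : ℝ → ℂ, Continuous f → Tendsto f (cocompact ℝ) (𝓝 0) →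
      MemSobolevT s (pullback β f) → ∀ n : ℕ, 1 ≤ n → ∀ k : ℝ, k ≠ 0 → ∃ a b : ℂ,
        HasPVFourier (rationalInterp β n f) k a ∧ HasPVFourier f k b ∧
        ‖a - b‖ ≤ C * (|k| ^ j)⁻¹ * (n : ℝ) ^ ((j : ℝ) - s) * sobolevNormT s (pullback β f) := by
  obtain ⟨i, rfl⟩ : ∃ i, j = i + 1 := ⟨j - 1, by omega⟩
  push_cast at hs
  have hi0 : (0 : ℝ) ≤ i := by positivity
  obtain ⟨C, hC, h⟩ := exists_hasPVFourier_sq_le hβ i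
  obtain ⟨I, hI, hint⟩ := exists_weightedSq_interpCoef_sub_le (σ := (i : ℝ) + 1) (s := s)
    (by linarith) hs (by linarith)
  refine ⟨√(C * I).toReal, fun f hf hf0 hF n hn k hk => ?_⟩
  obtain ⟨hW, hser, hfs, hset⟩ := interpolation_setup hβ (by linarith) hf hf0 hF
  obtain ⟨hR, hdiff⟩ := hset n hn
  have hG := hint _ _ hser n hn
  rw [weightedSq_fourierCoef hF, mul_assoc, rpow_mul_sq hn] at hG
  have hGtop := ne_top_of_le_ne_top (by finiteness) hG
  obtain ⟨a, ha⟩ := exists_hasPVFourier_of_finite hβ (interpCoef_finite n (pullback β f)) hk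
  obtain ⟨b, hb⟩ := exists_hasPVFourier hβ
    (ne_top_of_le_ne_top hW (weightedSq_mono_exponent (by linarith) _)) hk
  rw [hR] at ha
  rw [hfs] at hb
  have hRc : Continuous (rationalInterp β n f) := by
    rw [← hR]
    exact mobiusSeries_continuous_of_finite hβ (interpCoef_finite _ _)
  have hd := ha.sub hRc hf hb
  rw [← hdiff] at hd
  have hle := h _ hGtop k hk _ hd
  refine ⟨a, b, ha, hb, ?_⟩
  have hN := sobolevNormT_nonneg s (pullback β f)
  have hkj : 0 < |k| ^ (i + 1) := by positivity
  -- The factor k^j is kept inside the norm while the square root is taken and divided out only at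
  -- the end.
  have hnorm : ‖(k : ℂ) ^ (i + 1) * (a - b)‖ ≤ √(C * I).toReal *
      ((n : ℝ) ^ ((i : ℝ) + 1 - s) * sobolevNormT s (pullback β f)) := by
    refine norm_le_of_enorm_sq_le (by finiteness) (by positivity) ?_
    rw [enorm_mul, enorm_pow, mul_pow, ← pow_mul, mul_comm (i + 1) 2]
    have hke : ‖(k : ℂ)‖ₑ = ‖k‖ₑ := by
      rw [← ofReal_norm, ← ofReal_norm, Complex.norm_real]
    rw [hke]
    refine hle.trans ?_
    rw [mul_assoc]
    gcongr
  rw [norm_mul, norm_pow, Complex.norm_real, Real.norm_eq_abs] at hnorm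
  push_cast
  rw [mul_comm _ (|k| ^ (i + 1))⁻¹, mul_assoc, mul_assoc, ← div_eq_inv_mul, le_div_iff₀ hkj,
    mul_comm]
  exact hnorm

theorem weighted_l2_convergence (hβ : 0 < β) :
    ∃ C₁ C₂ : ℝ → ℝ → ℝ, ∀ ε s t : ℝ, 0 < ε → 1 + ε < s → t ≤ s →
      ∀ f : ℝ → ℂ, Continuous f → Tendsto f (cocompact ℝ) (𝓝 0) →
        MemSobolevT s (pullback β f) →
        MemLp f 2 (volume : Measure ℝ) ∧
        ∀ n : ℕ, 1 ≤ n →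
          MemLp (rationalInterp β n f) 2 (volume : Measure ℝ) ∧
          sobolevNormR t (fun x => rationalInterp β n f x - f x) ≤
            ENNReal.ofReal ((C₁ ε s * (n : ℝ) ^ (1 + ε - s) + C₂ s t * (n : ℝ) ^ (t - s)) *
              sobolevNormT s (pullback β f)) := by
  obtain ⟨D, hD, hle1⟩ := exists_sobolevNormR_sq_le_of_le_one hβ
  -- The constants must be functions of the parameters fixed in advance, so each existence statement
  -- is made total, with 0 as a default outside its range.
  have hI : ∀ σ s : ℝ, ∃ I : ℝ≥0∞, I ≠ ⊤ ∧ (0 ≤ σ → σ ≤ s → 1 / 2 < s →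
      ∀ (F : ℝ → ℂ) (c : ℤ → ℂ),
      (∀ θ : ℝ, HasSum (fun k : ℤ => c k * Complex.exp (Complex.I * k * θ)) (F θ)) →
      ∀ n : ℕ, 1 ≤ n → weightedSq σ (interpCoef n F - c) ≤
        I * ENNReal.ofReal ((n : ℝ) ^ (2 * (σ - s))) * weightedSq s c) := fun σ s => by
    by_cases h : 0 ≤ σ ∧ σ ≤ s ∧ 1 / 2 < s
    · obtain ⟨I, hI, hI'⟩ := exists_weightedSq_interpCoef_sub_le h.1 h.2.1 h.2.2
      exact ⟨I, hI, fun _ _ _ => hI'⟩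
    · exact ⟨0, by simp, fun h1 h2 h3 => absurd ⟨h1, h2, h3⟩ h⟩
  choose I hItop hI using hI
  set K := ENNReal.ofReal (2 * Real.pi * (4 * Real.pi * β)) with hK
  have hB : ∀ t : ℝ, ∃ B : ℝ≥0∞, B ≠ ⊤ ∧ (1 < t → ∀ c : ℤ → ℂ, absMoment (1 / 2) c ≠ ⊤ →
      sobolevNormR t (mobiusSeries β c) ^ 2 ≤ ENNReal.ofReal (2 ^ (2 * t)) * K *
        absMoment (1 / 2) c ^ 2 + B * weightedSq t c) := fun t => by
    by_cases h : 1 < t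
    · obtain ⟨B, hB, hB'⟩ := exists_sobolevNormR_sq_le hβ h
      exact ⟨B, hB, fun _ => hB'⟩
    · exact ⟨0, by simp, fun h1 => absurd h1 h⟩
  choose B hBtop hB using hB
  -- The first summand serves t ≤ 1 and the second t > 1, where 2^(2t) ≤ 2^(2s). Thus P depends on ε
  -- and s alone, and all dependence on t sits in Q.
  set P : ℝ → ℝ → ℝ≥0∞ := fun ε s => (D * (latticeZeta (1 + 2 * ε) + 1) +
    ENNReal.ofReal (2 ^ (2 * s)) * K * latticeZeta (1 + 2 * ε)) * I (1 + ε) s with hP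
  set Q : ℝ → ℝ → ℝ≥0∞ := fun s t => B t * I t s with hQ
  refine ⟨fun ε s => √(P ε s).toReal, fun s t => √(Q s t).toReal,
    fun ε s t hε hs hts f hf hf0 hF => ?_⟩
  obtain ⟨hW, hser, hfs, hset⟩ := interpolation_setup hβ (by linarith) hf hf0 hF
  have hhalf : absMoment (1 / 2) (fourierCoef (pullback β f)) ≠ ⊤ :=
    absMoment_ne_top (by linarith) hW
  refine ⟨by rw [← hfs]; exact memLp_mobiusSeries hβ hhalf, fun n hn => ?_⟩
  obtain ⟨hR, hdiff⟩ := hset n hn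
  refine ⟨by rw [← hR]; exact memLp_mobiusSeries_of_finite hβ (interpCoef_finite _ _), ?_⟩
  have hZ := latticeZeta_ne_top (r := 1 + 2 * ε) (by linarith)
  have hIe := hItop (1 + ε) s
  have hIt := hItop t s
  have hBt := hBtop t
  have hN := sobolevNormT_nonneg s (pullback β f)
  set N := sobolevNormT s (pullback β f) with hNdef
  set G := interpCoef n (pullback β f) - fourierCoef (pullback β f) with hGdef
  have hG1 : weightedSq (1 + ε) G ≤
      I (1 + ε) s * ENNReal.ofReal (((n : ℝ) ^ (1 + ε - s) * N) ^ 2) := by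
    have := hI (1 + ε) s (by linarith) hs.le (by linarith) _ _ hser n hn
    rwa [weightedSq_fourierCoef hF, mul_assoc, rpow_mul_sq hn] at this
  have hGtop : weightedSq (1 + ε) G ≠ ⊤ := ne_top_of_le_ne_top (by finiteness) hG1
  have hGhalf : absMoment (1 / 2) G ≠ ⊤ := absMoment_ne_top (by linarith) hGtop
  have hA : absMoment (1 / 2) G ^ 2 ≤ latticeZeta (1 + 2 * ε) * weightedSq (1 + ε) G := by
    have := absMoment_sq_le (1 / 2) (1 + ε) G
    rwa [show 2 * (1 + ε - 1 / 2) = 1 + 2 * ε by ring] at this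
  have hPtop : P ε s ≠ ⊤ := by
    simp only [hP]
    finiteness
  have hQtop : Q s t ≠ ⊤ := by
    simp only [hQ]
    finiteness
  have key : sobolevNormR t (mobiusSeries β G) ^ 2 ≤
      P ε s * ENNReal.ofReal (((n : ℝ) ^ (1 + ε - s) * N) ^ 2) +
        Q s t * ENNReal.ofReal (((n : ℝ) ^ (t - s) * N) ^ 2) := by
    rcases le_or_gt t 1 with ht | ht
    -- For t ≤ 1 both the half moment and order 1 are dominated by order 1 + ε, so the term in
    -- n^(t-s) is not needed.
    · refine le_trans ?_ le_self_add
      calc _ ≤ D * (absMoment (1 / 2) G ^ 2 + weightedSq 1 G) := hle1 t ht G hGhalf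
        _ ≤ D * (latticeZeta (1 + 2 * ε) * weightedSq (1 + ε) G + weightedSq (1 + ε) G) := by
            gcongr
            exact weightedSq_mono_exponent (by linarith) G
        _ = D * (latticeZeta (1 + 2 * ε) + 1) * weightedSq (1 + ε) G := by ring
        _ ≤ (D * (latticeZeta (1 + 2 * ε) + 1) + ENNReal.ofReal (2 ^ (2 * s)) * K *
              latticeZeta (1 + 2 * ε)) *
            (I (1 + ε) s * ENNReal.ofReal (((n : ℝ) ^ (1 + ε - s) * N) ^ 2)) :=
            mul_le_mul' le_self_add hG1
        _ = _ := by simp only [hP]; ring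
    · have hGt : weightedSq t G ≤ I t s * ENNReal.ofReal (((n : ℝ) ^ (t - s) * N) ^ 2) := by
        have := hI t s (by linarith) hts (by linarith) _ _ hser n hn
        rwa [weightedSq_fourierCoef hF, mul_assoc, rpow_mul_sq hn] at this
      refine (hB t ht G hGhalf).trans (add_le_add ?_ ?_)
      · calc _ ≤ ENNReal.ofReal (2 ^ (2 * s)) * K *
              (latticeZeta (1 + 2 * ε) * weightedSq (1 + ε) G) := by
              gcongr
              · exact one_le_two
          _ = ENNReal.ofReal (2 ^ (2 * s)) * K * latticeZeta (1 + 2 * ε) *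
              weightedSq (1 + ε) G := by ring
          _ ≤ (D * (latticeZeta (1 + 2 * ε) + 1) + ENNReal.ofReal (2 ^ (2 * s)) * K *
                latticeZeta (1 + 2 * ε)) *
              (I (1 + ε) s * ENNReal.ofReal (((n : ℝ) ^ (1 + ε - s) * N) ^ 2)) :=
              mul_le_mul' le_add_self hG1
          _ = _ := by simp only [hP]; ring
      · rw [hQ, mul_assoc]
        gcongr
  rw [← hdiff]
  refine (le_ofReal_of_sq_le hPtop hQtop (by positivity) (by positivity) key).trans (le_of_eq ?_)
  congr 1
  ring

end

end RationalFourier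

theorem mainTheorem3 (β : ℝ) (hβ : 0 < β) :
    -- weighted square-integrable convergence
    (∃ C₁ C₂ : ℝ → ℝ → ℝ, ∀ ε s t : ℝ, 0 < ε → 1 + ε < s → t ≤ s →
      ∀ f : ℝ → ℂ, Continuous f → Tendsto f (cocompact ℝ) (𝓝 0) →
        RationalFourier.MemSobolevT s (RationalFourier.pullback β f) →
        MemLp f 2 (volume : Measure ℝ) ∧
        ∀ n : ℕ, 1 ≤ n →
          MemLp (RationalFourier.rationalInterp β n f) 2 (volume : Measure ℝ) ∧
          RationalFourier.sobolevNormR t (fun x => RationalFourier.rationalInterp β n f x - f x) ≤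
            ENNReal.ofReal ((C₁ ε s * (n : ℝ) ^ (1 + ε - s) + C₂ s t * (n : ℝ) ^ (t - s)) *
              RationalFourier.sobolevNormT s (RationalFourier.pullback β f))) ∧
    -- uniform convergence
    (∀ ε s : ℝ, 0 < ε → 3 / 2 + ε < s → ∃ C : ℝ,
      ∀ f : ℝ → ℂ, Continuous f → Tendsto f (cocompact ℝ) (𝓝 0) →
        RationalFourier.MemSobolevT s (RationalFourier.pullback β f) →
        ∀ n : ℕ, 1 ≤ n → ∀ k : ℝ, ∃ a b : ℂ,
          RationalFourier.HasPVFourier (RationalFourier.rationalInterp β n f) k a ∧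
          RationalFourier.HasPVFourier f k b ∧
          ‖a - b‖ ≤ C * (n : ℝ) ^ (3 / 2 + ε - s) *
            RationalFourier.sobolevNormT s (RationalFourier.pullback β f)) ∧
    -- asymptotic approximation
    (∀ (j : ℕ) (s : ℝ), 0 < j → (j : ℝ) ≤ s → ∃ C : ℝ,
      ∀ f : ℝ → ℂ, Continuous f → Tendsto f (cocompact ℝ) (𝓝 0) →
        RationalFourier.MemSobolevT s (RationalFourier.pullback β f) →
        ∀ n : ℕ, 1 ≤ n → ∀ k : ℝ, k ≠ 0 → ∃ a b : ℂ,
          RationalFourier.HasPVFourier (RationalFourier.rationalInterp β n f) k a ∧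
          RationalFourier.HasPVFourier f k b ∧
          ‖a - b‖ ≤ C * (|k| ^ j)⁻¹ * (n : ℝ) ^ ((j : ℝ) - s) *
            RationalFourier.sobolevNormT s (RationalFourier.pullback β f)) :=
  ⟨RationalFourier.weighted_l2_convergence hβ,
    fun _ _ hε hs => RationalFourier.uniform_convergence hβ hε hs,
    fun _ _ hj hs => RationalFourier.asymptotic_approximation hβ hj hs⟩
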